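/- **Proposition 3.5 (Monotone Lateral Values).** Let $1<p<\infty$, let $\Omega\subset\mathbb R^n$ be a bounded Lipschitz domain, let $T>0$, and put $\Omega_T=\Omega\times(0,T)$ and $b(z)=|z|^{p-2}z$, $b(0)=0$. Let $L^p(0,T;W^{1,p}(\Omega))$ be the space of measurable functions $u$ on $\Omega_T$ with $u(\cdot,t)\in W^{1,p}(\Omega)$ for almost every $t\in(0,T)$ and $\int_0^T\!\int_\Omega(|u|^p+|\nabla u|^p)\,dx\,dt<\infty$, where $\nabla$ is the spatial weak gradient; $L^p(0,T;W^{1,p}_0(\Omega))$ is defined analogously. Let $\psi\in C(\overline{\Omega_T})\cap L^p(0,T;W^{1,p}(\Omega))$. A function $u\in L^p(0,T;W^{1,p}(\Omega))$ is called a weak solution with boundary values $\psi$ if 1. $u-\psi\in L^p(0,T;W^{1,p}_0(\Omega))$; 2. for every $\gamma\in C_0^\infty(\Omega_T)$, $$\int_0^T\!\!\int_\Omega\bigl(-b(u)\,\partial_t\gamma+\langle|\nabla u|^{p-2}\nabla u,\nabla\gamma\rangle\bigr)\,dx\,dt=0;$$ 3. $\displaystyle\lim_{t\to0+}\int_\Omega|b(u(x,t))-b(\psi(x,t))|\,dx=0$,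 as an essential limit (that is, for $t\to 0+$ outside some set of measure zero). Suppose that the lateral boundary values are monotone in time: $$\psi(x,t)\le\psi(x,s)\qquad\text{whenever } 0<t<s<T,\ x\in\partial\Omega.$$ Then the weak solution with boundary values $\psi$ is unique: if $u_1$ and $u_2$ are two weak solutions with boundary values $\psi$, then $u_1=u_2$ almost everywhere in $\Omega_T$. -/

import Mathlib

open MeasureTheory Set Filter Topology
open scoped ContDiff

namespace Trudinger

/-- Euclidean space `ℝⁿ`. -/
abbrev Space (n : ℕ) : Type := EuclideanSpace ℝ (Fin n)

variable {n : ℕ}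

/-- A bounded Lipschitz domain: a bounded, nonempty, connected open set that near each of its
boundary points `x₀` is, for some unit vector `e`, the region strictly above the graph (in the
direction `e`) of a Lipschitz function of the component orthogonal to `e`. -/
structure IsBoundedLipschitzDomain (Ω : Set (Space n)) : Prop where
  isOpen : IsOpen Ω
  isConnected : IsConnected Ω
  isBounded : Bornology.IsBounded Ω
  lipschitz_boundary : ∀ x₀ ∈ frontier Ω,
    ∃ e : Space n, ‖e‖ = 1 ∧ ∃ g : Space n → ℝ, (∃ L, LipschitzWith L g) ∧
      ∃ r > 0, ∀ x ∈ Metric.ball x₀ r,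
        (x ∈ Ω ↔ g (x - (inner ℝ e x : ℝ) • e) < inner ℝ e x)

/-- The space-time cylinder `Ω_T = Ω × (0,T)`; its points are pairs `(x, t)`. -/
def cylinder (Ω : Set (Space n)) (T : ℝ) : Set (Space n × ℝ) := Ω ×ˢ Ioo 0 T

/-- `φ ∈ C₀^∞(U)`: smooth with compact support contained in `U`. -/
def IsTestFunction {X : Type*} [NormedAddCommGroup X] [NormedSpace ℝ X]
    (U : Set X) (φ : X → ℝ) : Prop :=
  ContDiff ℝ ∞ φ ∧ HasCompactSupport φ ∧ tsupport φ ⊆ U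

/-- `v ∈ W^{1,p}(Ω)` with weak (distributional) gradient `G`. -/
def HasW1pGradient (p : ℝ) (Ω : Set (Space n)) (v : Space n → ℝ) (G : Space n → Space n) : Prop :=
  MemLp v (ENNReal.ofReal p) (volume.restrict Ω) ∧
  MemLp G (ENNReal.ofReal p) (volume.restrict Ω) ∧
  ∀ φ : Space n → ℝ, IsTestFunction Ω φ →
    ∫ x in Ω, v x • gradient φ x = - ∫ x in Ω, φ x • G x

/-- `v ∈ W₀^{1,p}(Ω)`, the closure of `C₀^∞(Ω)` in `W^{1,p}(Ω)`, with weak gradient `G`. -/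
def HasW1pZeroGradient (p : ℝ) (Ω : Set (Space n)) (v : Space n → ℝ)
    (G : Space n → Space n) : Prop :=
  HasW1pGradient p Ω v G ∧
  ∀ ε > 0, ∃ φ : Space n → ℝ, IsTestFunction Ω φ ∧
    eLpNorm (fun x => v x - φ x) (ENNReal.ofReal p) (volume.restrict Ω) < ε ∧
    eLpNorm (fun x => G x - gradient φ x) (ENNReal.ofReal p) (volume.restrict Ω) < ε

/-- `u ∈ L^p(0,T;W^{1,p}(Ω))` with spatial weak gradient `G`: both are measurable on `Ω_T` with
finite `L^p(Ω_T)` norm, and for almost every `t ∈ (0,T)` the slice `u(·,t)` lies in `W^{1,p}(Ω)`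
with weak gradient `G(·,t)`. -/
def HasParabolicGradient (p : ℝ) (Ω : Set (Space n)) (T : ℝ) (u : Space n × ℝ → ℝ)
    (G : Space n × ℝ → Space n) : Prop :=
  MemLp u (ENNReal.ofReal p) (volume.restrict (cylinder Ω T)) ∧
  MemLp G (ENNReal.ofReal p) (volume.restrict (cylinder Ω T)) ∧
  ∀ᵐ t ∂(volume.restrict (Ioo 0 T)), HasW1pGradient p Ω (fun x => u (x, t)) (fun x => G (x, t))

/-- The parabolic Sobolev space `L^p(0,T;W^{1,p}(Ω))`. -/
def MemParabolic (p : ℝ) (Ω : Set (Space n)) (T : ℝ) (u : Space n × ℝ → ℝ) : Prop :=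
  ∃ G, HasParabolicGradient p Ω T u G

/-- The parabolic Sobolev space `L^p(0,T;W₀^{1,p}(Ω))`. -/
def MemParabolicZero (p : ℝ) (Ω : Set (Space n)) (T : ℝ) (u : Space n × ℝ → ℝ) : Prop :=
  ∃ G, HasParabolicGradient p Ω T u G ∧
    ∀ᵐ t ∂(volume.restrict (Ioo 0 T)),
      HasW1pZeroGradient p Ω (fun x => u (x, t)) (fun x => G (x, t))

/-- `b(z) = |z|^{p-2} z`, with `b(0) = 0`. -/
noncomputable def b (p z : ℝ) : ℝ := |z| ^ (p - 2) * z

/-- Weak solutions of `∂ₜ(|u|^{p-2}u) = div(|∇u|^{p-2}∇u)` in `Ω_T` with Dirichlet boundary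
values `ψ` (on the lateral boundary and initially). The gradient in `weak_eq` is determined by `u`
almost everywhere on `Ω_T`. As `u` is only determined almost everywhere, the limit `t → 0+` in
`initial` is taken along almost every `t`, i.e. as an essential limit (the weakest reading). -/
structure IsWeakSolution (p : ℝ) (Ω : Set (Space n)) (T : ℝ) (ψ u : Space n × ℝ → ℝ) : Prop where
  mem : MemParabolic p Ω T u
  boundary : MemParabolicZero p Ω T (fun z => u z - ψ z)
  weak_eq : ∃ G, HasParabolicGradient p Ω T u G ∧
    ∀ γ : Space n × ℝ → ℝ, IsTestFunction (cylinder Ω T) γ →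
      ∫ z in cylinder Ω T,
        (-(b p (u z)) * deriv (fun s => γ (z.1, s)) z.2
          + inner ℝ (‖G z‖ ^ (p - 2) • G z) (gradient (fun y => γ (y, z.2)) z.1)) = 0
  initial : Tendsto (fun t => ∫⁻ x in Ω, ENNReal.ofReal |b p (u (x, t)) - b p (ψ (x, t))|)
    (𝓝[>] (0 : ℝ) ⊓ ae volume) (𝓝 0)

end Trudinger

/-! The proof is a comparison argument with the time variable doubled. Testing the difference of the
equations with a truncation of `u₁ - u₂` at equal times is not directly possible, since a weak
solution has no time derivative as a function. Instead `u₁` is taken at time `t` and `u₂` at a later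
time `s`. Because the lateral values increase in time, `u₁(·,t) - u₂(·,s)` is nonpositive on the
lateral boundary. A smooth truncation `ramp((u₁(·,t) - u₂(·,s))/δ)`, which vanishes where the
difference is at most `δ`, therefore lies in the zero-boundary Sobolev space
(`SobolevZero.comp_add_of_nonpos_frontier`, `sobolevZero_ramp_sub`) and may be tested in both
equations.

The equation is used in increment form: outside one null set of times, the increment of `b(u)`
between two times, tested with any zero-boundary function, is minus the time integral of the tested
flux (`exists_null_increment_of_weak_eq`). Take increments over `[t-h,t]` for `u₁` and `[s-h,s]` for
`u₂`, with the same frozen test function. Convexity bounds increments of the entropies `entropyLeft`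
and `entropyRight` by the parabolic terms. In the elliptic terms, freezing the fluxes at `t` and `s`
leaves a quantity of favourable sign, by monotonicity of the `p`-Laplace flux, plus an error
(`ofReal_integral_entropy_le`). After integration over `(t,s)` this error is `o(h)`, because
translations are continuous in `L^q` (`eventually_lintegral_flux_increment_le`).

Integrating against a nonnegative cutoff `θ(t,s)` supported in `t < s`, shifting the differences
onto `θ`, then letting `h → 0` and `δ → 0`, gives `∫ (b(u₁(x,t)) - b(u₂(x,s)))₊ (∂ₜ + ∂ₛ)θ ≥ 0`
(`integral_max_sub_nonneg`). With `θ = η(t) k(s-t)` the singular factor `k` is not differentiated.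
Concentrating `k` at `0` from the right shows that `f(t) = ∫ (b(u₁) - b(u₂))₊ dx` is weakly
nonincreasing (`integral_pos_part_mul_deriv_nonneg`). The initial condition makes `f` tend to `0`
essentially at `0`, hence `f = 0`, and strict monotonicity of `b` gives `u₁ ≤ u₂`. Exchanging the
solutions finishes. -/

namespace Trudinger

/-! ### Continuity of translations and mollification in Lebesgue spaces -/

section Translation
variable {X F : Type*} [NormedAddCommGroup X] [NormedSpace ℝ X] [FiniteDimensional ℝ X]
  [MeasurableSpace X] [BorelSpace X] {μ : Measure X} [μ.IsAddHaarMeasure]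
  [NormedAddCommGroup F]

/-- This is continuity of the translation action on `Lp` for finite exponents, read on
representatives. It drives both the mollification of Sobolev functions and the smallness of the flux
error in time. -/
theorem tendsto_eLpNorm_translate {q : ENNReal} (hq1 : 1 ≤ q) (hq : q ≠ ⊤) {f : X → F}
    (hf : MemLp f q μ) :
    Tendsto (fun y : X => eLpNorm (fun x => f (y + x) - f x) q μ) (𝓝 0) (𝓝 0) := by
  have : Fact (1 ≤ q) := ⟨hq1⟩
  have : Fact (q ≠ ⊤) := ⟨hq⟩
  have hmp : ∀ y : X, MeasurePreserving (fun x => y + x) μ μ :=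
    fun y => measurePreserving_add_left μ y
  have hc : Continuous fun y : X => (DomAddAct.mk y +ᵥ hf.toLp f : Lp F q μ) :=
    (DomAddAct.mkHomeomorph.continuous).vadd continuous_const
  have h0 : Tendsto (fun y : X => edist (DomAddAct.mk y +ᵥ hf.toLp f : Lp F q μ) (hf.toLp f))
      (𝓝 0) (𝓝 0) := by
    have h := (hc.tendsto 0).edist (tendsto_const_nhds (x := hf.toLp f))
    simpa using h
  refine h0.congr fun y => ?_
  have h1 : (DomAddAct.mk y +ᵥ hf.toLp f : Lp F q μ)
      = (hf.comp_measurePreserving (hmp y)).toLp _ := rfl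
  rw [h1, Lp.edist_toLp_toLp]
  rfl

variable [CompleteSpace F]

variable [NormedSpace ℝ F]

/-- Averages of translates stay as close to `f` as the translates themselves. -/
theorem eLpNorm_average_translate_le {p : ℝ} (hp : 1 ≤ p) {f : X → F}
    (hf : MemLp f (ENNReal.ofReal p) μ) {k : X → ℝ} (hk : Continuous k) (hk0 : ∀ y, 0 ≤ k y)
    (hkc : HasCompactSupport k) (hk1 : ∫ y, k y ∂μ = 1) {r : ENNReal}
    (hr : ∀ y ∈ Function.support k,
      eLpNorm (fun x => f (-y + x) - f x) (ENNReal.ofReal p) μ ≤ r) :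
    eLpNorm (fun x => (∫ y, k y • f (x - y) ∂μ) - f x) (ENNReal.ofReal p) μ ≤ r := by
  have hp0 : 0 < p := by linarith
  have hpE : (1 : ENNReal) ≤ ENNReal.ofReal p := by simpa using hp
  have hne0 : ENNReal.ofReal p ≠ 0 := by simpa using hp0
  have hki : Integrable k μ := hk.integrable_of_hasCompactSupport hkc
  set K : X → ENNReal := fun y => ENNReal.ofReal (k y) with hK
  have hKm : Measurable K := (hk.measurable).ennreal_ofReal
  have hK1 : ∫⁻ y, K y ∂μ = 1 := by
    rw [← ofReal_integral_eq_lintegral_ofReal hki (ae_of_all _ hk0), hk1, ENNReal.ofReal_one]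
  -- With respect to this probability measure the convolution is an average. Jensen's inequality
  -- then takes the form of monotonicity of `L^r` norms in the exponent, and Tonelli reduces the
  -- claim to individual translates, of which only those in the support of `k` count.
  set ν := μ.withDensity K with hν
  have : IsProbabilityMeasure ν := ⟨by simp [hν, hK1]⟩
  have hfl : LocallyIntegrable f μ := hf.locallyIntegrable hpE
  have hprod : AEStronglyMeasurable (fun z : X × X => f (z.1 - z.2) - f z.1) (μ.prod μ) :=
    ((hf.1.comp_quasiMeasurePreserving (quasiMeasurePreserving_sub μ μ))).sub hf.1.comp_fst
  have hac : ν ≪ μ := withDensity_absolutelyContinuous _ _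
  have hprod' : AEStronglyMeasurable (fun z : X × X => f (z.1 - z.2) - f z.1) (μ.prod ν) :=
    hprod.mono_ac (Measure.AbsolutelyContinuous.rfl.prod hac)
  have hconv : ∀ x, Integrable (fun y => k y • f (x - y)) μ :=
    fun x => hkc.convolutionExists_left (ContinuousLinearMap.lsmul ℝ ℝ) hk hfl x
  have hpt : ∀ x, ‖(∫ y, k y • f (x - y) ∂μ) - f x‖ₑ ≤ eLpNorm (fun y => f (x - y) - f x) 1 ν := by
    intro x
    have h1 : (∫ y, k y • f (x - y) ∂μ) - f x = ∫ y, k y • (f (x - y) - f x) ∂μ := by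
      simp_rw [smul_sub]
      rw [integral_sub (hconv x) (hki.smul_const _), integral_smul_const, hk1, one_smul]
    rw [h1, eLpNorm_one_eq_lintegral_enorm]
    refine (enorm_integral_le_lintegral_enorm _).trans ?_
    rw [lintegral_withDensity_eq_lintegral_mul_non_measurable _ hKm
      (ae_of_all _ fun y => ENNReal.ofReal_lt_top)]
    refine lintegral_mono fun y => ?_
    simp only [Pi.mul_apply, hK, enorm_smul]
    gcongr
    rw [Real.enorm_eq_ofReal (hk0 y)]
  have hpt' : ∀ᵐ x ∂μ, ‖(∫ y, k y • f (x - y) ∂μ) - f x‖ₑ ^ p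
      ≤ ∫⁻ y, ‖f (x - y) - f x‖ₑ ^ p ∂ν := by
    filter_upwards [hprod'.prodMk_left] with x hx
    have h2 := (hpt x).trans (eLpNorm_le_eLpNorm_of_exponent_le hpE hx)
    rw [eLpNorm_eq_lintegral_rpow_enorm_toReal hne0 ENNReal.ofReal_ne_top,
      ENNReal.toReal_ofReal hp0.le] at h2
    calc _ ≤ _ := ENNReal.rpow_le_rpow h2 hp0.le
      _ = _ := by rw [← ENNReal.rpow_mul, one_div, inv_mul_cancel₀ hp0.ne', ENNReal.rpow_one]
  rw [eLpNorm_eq_lintegral_rpow_enorm_toReal hne0 ENNReal.ofReal_ne_top,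
      ENNReal.toReal_ofReal hp0.le]
  have key : ∫⁻ x, ‖(∫ y, k y • f (x - y) ∂μ) - f x‖ₑ ^ p ∂μ ≤ r ^ p := by
    calc _ ≤ ∫⁻ x, ∫⁻ y, ‖f (x - y) - f x‖ₑ ^ p ∂ν ∂μ := lintegral_mono_ae hpt'
      _ = ∫⁻ y, ∫⁻ x, ‖f (x - y) - f x‖ₑ ^ p ∂μ ∂ν :=
          lintegral_lintegral_swap (hprod'.enorm.pow_const p)
      _ ≤ ∫⁻ y, r ^ p ∂ν := by
          rw [lintegral_withDensity_eq_lintegral_mul_non_measurable _ hKm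
            (ae_of_all _ fun y => ENNReal.ofReal_lt_top),
            lintegral_withDensity_eq_lintegral_mul_non_measurable _ hKm
            (ae_of_all _ fun y => ENNReal.ofReal_lt_top)]
          refine lintegral_mono fun y => ?_
          simp only [Pi.mul_apply]
          by_cases hy : k y = 0
          · simp [hK, hy]
          · gcongr
            have h3 := hr y hy
            rw [eLpNorm_eq_lintegral_rpow_enorm_toReal hne0 ENNReal.ofReal_ne_top,
              ENNReal.toReal_ofReal hp0.le] at h3
            calc _ = ((∫⁻ x, ‖f (-y + x) - f x‖ₑ ^ p ∂μ) ^ (1 / p)) ^ p := by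
                  rw [← ENNReal.rpow_mul, one_div, inv_mul_cancel₀ hp0.ne', ENNReal.rpow_one]
                  simp [neg_add_eq_sub]
              _ ≤ _ := ENNReal.rpow_le_rpow h3 hp0.le
      _ = r ^ p := by simp
  calc _ ≤ (r ^ p) ^ (1 / p) := ENNReal.rpow_le_rpow key (by positivity)
    _ = r := by rw [← ENNReal.rpow_mul, mul_one_div_cancel hp0.ne', ENNReal.rpow_one]

end Translation
end Trudinger

/-! ### Zero boundary values via test functions, and weak gradients under mollification -/

namespace Trudinger
variable {n : ℕ}

/-- `v ∈ W₀^{1,p}(Ω)` with gradient `G`, expressed through approximation by test functions only. -/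
def SobolevZero (p : ℝ) (Ω : Set (Space n)) (v : Space n → ℝ) (G : Space n → Space n) : Prop :=
  MemLp v (ENNReal.ofReal p) (volume.restrict Ω) ∧
  MemLp G (ENNReal.ofReal p) (volume.restrict Ω) ∧
  ∀ ε : ENNReal, 0 < ε → ∃ φ : Space n → ℝ, IsTestFunction Ω φ ∧
    eLpNorm (fun x => v x - φ x) (ENNReal.ofReal p) (volume.restrict Ω) < ε ∧
    eLpNorm (fun x => G x - gradient φ x) (ENNReal.ofReal p) (volume.restrict Ω) < ε

theorem HasW1pZeroGradient.sobolevZero {p : ℝ} {Ω : Set (Space n)} {v : Space n → ℝ}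
    {G : Space n → Space n} (h : HasW1pZeroGradient p Ω v G) : SobolevZero p Ω v G :=
  ⟨h.1.1, h.1.2.1, fun ε hε => h.2 ε hε⟩

theorem SobolevZero.congr_ae {p : ℝ} {Ω : Set (Space n)} {v v' : Space n → ℝ}
    {G G' : Space n → Space n} (h : SobolevZero p Ω v G) (hv : v =ᵐ[volume.restrict Ω] v')
    (hG : G =ᵐ[volume.restrict Ω] G') : SobolevZero p Ω v' G' := by
  refine ⟨h.1.ae_eq hv, h.2.1.ae_eq hG, fun ε hε => ?_⟩
  obtain ⟨φ, hφ, h1, h2⟩ := h.2.2 ε hε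
  refine ⟨φ, hφ, ?_, ?_⟩
  · exact (eLpNorm_congr_ae (hv.sub (EventuallyEq.refl _ φ))).symm.trans_lt h1
  · exact (eLpNorm_congr_ae (hG.sub (EventuallyEq.refl _ (gradient φ)))).symm.trans_lt h2

section Gradient
variable {X : Type*} [NormedAddCommGroup X] [InnerProductSpace ℝ X] [CompleteSpace X]

theorem gradient_mul {f g : X → ℝ} {x : X} (hf : DifferentiableAt ℝ f x)
    (hg : DifferentiableAt ℝ g x) :
    gradient (fun y => f y * g y) x = f x • gradient g x + g x • gradient f x := by
  refine ext_inner_right ℝ fun e => ?_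
  rw [inner_gradient_left, inner_add_left, inner_smul_left, inner_smul_left,
    inner_gradient_left, inner_gradient_left, fderiv_fun_mul hf hg]
  simp

theorem gradient_comp_real {f : X → ℝ} {H : ℝ → ℝ} {x : X} (hf : DifferentiableAt ℝ f x)
    (hH : DifferentiableAt ℝ H (f x)) :
    gradient (fun y => H (f y)) x = deriv H (f x) • gradient f x := by
  refine ext_inner_right ℝ fun e => ?_
  rw [inner_gradient_left, inner_smul_left, inner_gradient_left]
  have := fderiv_comp x hH hf
  rw [Function.comp_def] at this
  rw [this]
  simp [mul_comm]

theorem continuous_gradient {f : X → ℝ} (hf : ContDiff ℝ 1 f) : Continuous (gradient f) :=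
  (InnerProductSpace.toDual ℝ X).symm.continuous.comp (hf.continuous_fderiv one_ne_zero)

theorem tsupport_gradient_subset (f : X → ℝ) : tsupport (gradient f) ⊆ tsupport f := by
  refine closure_minimal (fun x hx => support_fderiv_subset ℝ fun h => hx ?_) (isClosed_tsupport f)
  simp [gradient, h]

theorem gradient_add' {f g : X → ℝ} {x : X} (hf : DifferentiableAt ℝ f x)
    (hg : DifferentiableAt ℝ g x) :
    gradient (fun y => f y + g y) x = gradient f x + gradient g x := by
  refine ext_inner_right ℝ fun e => ?_
  rw [inner_gradient_left, inner_add_left, inner_gradient_left, inner_gradient_left,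
    fderiv_fun_add hf hg]
  simp

end Gradient

/-- Mollification commutes with weak gradients on the whole space. -/
theorem gradient_convolution {f : Space n → ℝ} {F : Space n → Space n}
    (hf : LocallyIntegrable f volume)
    (hw : ∀ φ : Space n → ℝ, ContDiff ℝ ∞ φ → HasCompactSupport φ →
      ∫ x, f x • gradient φ x = - ∫ x, φ x • F x)
    {k : Space n → ℝ} (hk : ContDiff ℝ ∞ k) (hkc : HasCompactSupport k) (x : Space n) :
    gradient (fun x => ∫ y, k y • f (x - y)) x = ∫ y, k y • F (x - y) := by
  have hk1 : ContDiff ℝ 1 k := hk.of_le (by simp)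
  -- For fixed `x` the reflected and translated kernel is itself a test function, so the weak
  -- gradient identity at `φ` is exactly the claim at `x`.
  let φ : Space n → ℝ := fun y => k (x - y)
  have hφ : ContDiff ℝ ∞ φ := hk.comp (contDiff_const.sub contDiff_id)
  have hφc : HasCompactSupport φ := hkc.comp_homeomorph (Homeomorph.subLeft x)
  have hdφ : ∀ y, gradient φ y = - gradient k (x - y) := by
    intro y
    refine ext_inner_right ℝ fun e => ?_
    have hd : HasFDerivAt (fun z : Space n => x - z) (-ContinuousLinearMap.id ℝ (Space n)) y :=
      (hasFDerivAt_id y).const_sub x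
    have hkd : HasFDerivAt k (fderiv ℝ k (x - y)) (x - y) :=
      (hk1.differentiable one_ne_zero _).hasFDerivAt
    rw [inner_neg_left, inner_gradient_left, inner_gradient_left, (show HasFDerivAt φ _ y from hkd.comp y hd).fderiv]
    simp
  have h1 := hw φ hφ hφc
  have e1 : (fun x => ∫ y, k y • f (x - y))
      = convolution f k (ContinuousLinearMap.lsmul ℝ ℝ) volume := by
    funext z
    rw [convolution_eq_swap]
    simp [mul_comm]
  have e2 : ∫ y, k y • F (x - y) = ∫ y, φ y • F y := by
    rw [← integral_sub_left_eq_self (fun y => φ y • F y) volume x]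
    simp [φ]
  rw [e1, e2, ← neg_eq_iff_eq_neg.2 h1]
  have hint : Integrable (fun y => f y • gradient φ y) volume :=
    hf.integrable_smul_right_of_hasCompactSupport (continuous_gradient (hφ.of_le (by simp)))
      (hφc.mono' ((subset_tsupport _).trans (tsupport_gradient_subset φ)))
  refine ext_inner_right ℝ fun e => ?_
  rw [inner_gradient_left,
    (hkc.hasFDerivAt_convolution_right (ContinuousLinearMap.lsmul ℝ ℝ) hf hk1 x).fderiv,
    convolution_precompR_apply _ hf (hkc.fderiv ℝ) (hk1.continuous_fderiv one_ne_zero),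
    inner_neg_left, ← real_inner_comm, ← integral_inner hint, ← integral_neg]
  refine integral_congr_ae (ae_of_all _ fun y => ?_)
  simp only [hdφ, ContinuousLinearMap.lsmul_apply, smul_neg, inner_neg_right, inner_smul_right,
    inner_gradient_right, neg_neg, smul_eq_mul]
  simp

/-- A cut-off Sobolev function has support in a compact subset of `Ω`. Its extension by zero
therefore has a weak gradient on the whole space, and mollifying at a small scale stays inside `Ω`.
This turns a function with arbitrary boundary values into one approximable by test functions. -/
theorem HasW1pGradient.sobolevZero_mul_testFunction {p : ℝ} (hp : 1 < p) {Ω : Set (Space n)}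
    (hΩ : IsOpen Ω) {g χ : Space n → ℝ} {G : Space n → Space n}
    (hg : HasW1pGradient p Ω g G) (hχ : IsTestFunction Ω χ) :
    SobolevZero p Ω (fun x => χ x * g x) (fun x => χ x • G x + g x • gradient χ x) := by
  obtain ⟨hχs, hχc, hχΩ⟩ := hχ
  have hp0 : 0 < p := by linarith
  have hpE : (1 : ENNReal) ≤ ENNReal.ofReal p := by simpa using hp.le
  have hχ1 : ContDiff ℝ 1 χ := hχs.of_le (by simp)
  have hgχ : Continuous (gradient χ) := continuous_gradient hχ1
  have hgχc : HasCompactSupport (gradient χ) :=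
    hχc.mono' ((subset_tsupport _).trans (tsupport_gradient_subset χ))
  have hχ0 : ∀ x, x ∉ Ω → χ x = 0 := fun x hx => by
    by_contra h; exact hx (hχΩ (subset_tsupport _ h))
  have hgχ0 : ∀ x, x ∉ Ω → gradient χ x = 0 := fun x hx => by
    by_contra h; exact hx (hχΩ (tsupport_gradient_subset χ (subset_tsupport _ h)))
  obtain ⟨C, hC⟩ := hχc.exists_bound_of_continuous hχ1.continuous
  obtain ⟨C', hC'⟩ := hgχc.exists_bound_of_continuous hgχ
  set f : Space n → ℝ := fun x => χ x * g x with hf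
  set F : Space n → Space n := fun x => χ x • G x + g x • gradient χ x with hF
  have hfΩ : MemLp f (ENNReal.ofReal p) (volume.restrict Ω) :=
    hg.1.of_le_mul (c := C) (hχ1.continuous.aestronglyMeasurable.mul hg.1.1)
      (ae_of_all _ fun x => by
        simp only [hf, norm_mul]; gcongr; exact hC x)
  have hFΩ : MemLp F (ENNReal.ofReal p) (volume.restrict Ω) := by
    refine MemLp.add ?_ ?_
    · exact hg.2.1.of_le_mul (c := C) (hχ1.continuous.aestronglyMeasurable.smul hg.2.1.1)
        (ae_of_all _ fun x => by simp only [norm_smul]; gcongr; exact hC x)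
    · exact hg.1.of_le_mul (c := C') (hg.1.1.smul hgχ.aestronglyMeasurable)
        (ae_of_all _ fun x => by simp only [norm_smul]; rw [mul_comm]; gcongr; exact hC' x)
  have hfi : f = Ω.indicator f := by
    funext x; by_cases hx : x ∈ Ω
    · simp [hx]
    · simp [hx, hf, hχ0 x hx]
  have hFi : F = Ω.indicator F := by
    funext x; by_cases hx : x ∈ Ω
    · simp [hx]
    · simp [hx, hF, hχ0 x hx, hgχ0 x hx]
  have hfL : MemLp f (ENNReal.ofReal p) volume := by
    rw [hfi]; exact (memLp_indicator_iff_restrict hΩ.measurableSet).2 hfΩ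
  have hFL : MemLp F (ENNReal.ofReal p) volume := by
    rw [hFi]; exact (memLp_indicator_iff_restrict hΩ.measurableSet).2 hFΩ
  have hfl := hfL.locallyIntegrable hpE
  have hFl := hFL.locallyIntegrable hpE
  -- The test function `φ` need not be supported in `Ω`, but `χ φ` is. Testing `g` with it and
  -- moving the term containing the gradient of `χ` across gives the product rule.
  have hw : ∀ φ : Space n → ℝ, ContDiff ℝ ∞ φ → HasCompactSupport φ →
      ∫ x, f x • gradient φ x = - ∫ x, φ x • F x := by
    intro φ hφ hφc
    have hφ1 : ContDiff ℝ 1 φ := hφ.of_le (by simp)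
    have h := hg.2.2 (fun x => χ x * φ x) ⟨hχs.mul hφ, hχc.mul_right,
      (tsupport_mul_subset_left).trans hχΩ⟩
    have i1 : Integrable (fun x => f x • gradient φ x) volume :=
      hfl.integrable_smul_right_of_hasCompactSupport (continuous_gradient hφ1)
        (hφc.mono' ((subset_tsupport _).trans (tsupport_gradient_subset φ)))
    have i2 : Integrable (fun x => φ x • F x) volume :=
      hFl.integrable_smul_left_of_hasCompactSupport hφ1.continuous hφc
    have e1 : ∀ x, g x • gradient (fun x => χ x * φ x) x
        = f x • gradient φ x + φ x • (g x • gradient χ x) := by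
      intro x
      rw [gradient_mul (hχ1.differentiable one_ne_zero x) (hφ1.differentiable one_ne_zero x),
        smul_add, smul_smul, mul_comm (g x), smul_comm (g x)]
    have e2 : ∀ x, (χ x * φ x) • G x = φ x • F x - φ x • (g x • gradient χ x) := by
      intro x
      simp only [hF, smul_add, smul_smul]
      rw [mul_comm (χ x)]; abel
    have i3 : Integrable (fun x => φ x • (g x • gradient χ x)) (volume.restrict Ω) := by
      obtain ⟨D, hD⟩ := hφc.exists_bound_of_continuous hφ1.continuous
      have hgl : LocallyIntegrable (fun x => Ω.indicator g x) volume :=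
        ((memLp_indicator_iff_restrict hΩ.measurableSet).2 hg.1).locallyIntegrable hpE
      have : Integrable (fun x => Ω.indicator g x • (φ x • gradient χ x)) volume :=
        hgl.integrable_smul_right_of_hasCompactSupport (hφ1.continuous.smul hgχ)
          hφc.smul_right
      refine (this.mono_measure Measure.restrict_le_self).congr ?_
      filter_upwards [ae_restrict_mem hΩ.measurableSet] with x hx
      simp [hx, smul_comm (g x)]
    simp_rw [e1, e2] at h
    rw [integral_add i1.integrableOn i3, integral_sub i2.integrableOn i3, neg_sub] at h
    have h' : ∫ x in Ω, f x • gradient φ x = - ∫ x in Ω, φ x • F x :=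
      add_right_cancel (h.trans (sub_eq_neg_add _ _))
    rwa [setIntegral_eq_integral_of_forall_compl_eq_zero
      (fun x hx => by simp [hf, hχ0 x hx]), setIntegral_eq_integral_of_forall_compl_eq_zero
      (fun x hx => by simp [hF, hχ0 x hx, hgχ0 x hx])] at h'
  refine ⟨hfΩ, hFΩ, fun ε hε => ?_⟩
  obtain ⟨ε', hε'0, hε'⟩ := exists_between hε
  have hneg : Tendsto (fun y : Space n => -y) (𝓝 0) (𝓝 0) := by
    simpa using (continuous_neg (G := Space n)).tendsto 0
  have t1 := ((tendsto_eLpNorm_translate hpE ENNReal.ofReal_ne_top hfL).comp hneg).eventually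
    (gt_mem_nhds hε'0)
  have t2 := ((tendsto_eLpNorm_translate hpE ENNReal.ofReal_ne_top hFL).comp hneg).eventually
    (gt_mem_nhds hε'0)
  obtain ⟨r, hr0, hr⟩ := Metric.eventually_nhds_iff_ball.1 (t1.and t2)
  obtain ⟨δ, hδ0, hδ⟩ := hχc.isCompact.exists_cthickening_subset_open hΩ hχΩ
  -- Radius below `r` makes translates of the function and of its gradient close in norm; radius
  -- below `δ` keeps the support of the mollification in `Ω`.
  let B : ContDiffBump (0 : Space n) := ⟨min r δ / 2, min r δ, by positivity, by
    have : 0 < min r δ := by positivity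
    linarith⟩
  set k : Space n → ℝ := B.normed volume with hk
  have hks : ContDiff ℝ ∞ k := B.contDiff_normed
  have hkc : HasCompactSupport k := B.hasCompactSupport_normed
  have hsupp : Function.support k = Metric.ball 0 (min r δ) := B.support_normed_eq
  have hk1 : ∫ y, k y = 1 := B.integral_normed
  have hconv : (fun x => ∫ y, k y • f (x - y))
      = convolution k f (ContinuousLinearMap.lsmul ℝ ℝ) volume := by
    funext x; rw [convolution_lsmul]
  refine ⟨fun x => ∫ y, k y • f (x - y), ⟨?_, ?_, ?_⟩, ?_, ?_⟩
  · rw [hconv]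
    exact hkc.contDiff_convolution_left _ hks hfl
  · rw [hconv]
    exact hkc.convolution _ hχc.mul_right
  · refine Subset.trans (closure_minimal ?_ (Metric.isClosed_cthickening)) hδ
    rw [hconv]
    refine (support_convolution_subset _).trans ?_
    rintro _ ⟨y, hy, x, hx, rfl⟩
    rw [hsupp, mem_ball_zero_iff, lt_min_iff] at hy
    refine Metric.mem_cthickening_of_dist_le _ x _ _
      (subset_tsupport _ fun h => hx (by simp [hf, h])) ?_
    simpa using hy.2.le
  · have := eLpNorm_average_translate_le hp.le hfL hks.continuous B.nonneg_normed hkc hk1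
      (r := ε') fun y hy => (hr y (Metric.ball_subset_ball (min_le_left _ _) (hsupp ▸ hy))).1.le
    refine (eLpNorm_mono_measure _ Measure.restrict_le_self).trans_lt ?_
    have h3 := eLpNorm_sub_comm f (fun x => ∫ y, k y • f (x - y)) (ENNReal.ofReal p) volume
    exact (h3.trans_le this).trans_lt hε'
  · have := eLpNorm_average_translate_le hp.le hFL hks.continuous B.nonneg_normed hkc hk1
      (r := ε') fun y hy => (hr y (Metric.ball_subset_ball (min_le_left _ _) (hsupp ▸ hy))).2.le
    refine (eLpNorm_mono_measure _ Measure.restrict_le_self).trans_lt ?_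
    have h3 := eLpNorm_sub_comm F (fun x => ∫ y, k y • F (x - y)) (ENNReal.ofReal p) volume
    have h4 : gradient (fun x => ∫ y, k y • f (x - y)) = fun x => ∫ y, k y • F (x - y) :=
      funext fun x => gradient_convolution hfl hw hks hkc x
    rw [h4]
    exact (h3.trans_le this).trans_lt hε'

end Trudinger

/-! ### Chain rule and truncation with zero boundary values -/

namespace Trudinger
variable {n : ℕ}

/-- The cutoff is one near each point of `K`, not merely on `K`, so that its gradient vanishes
there. -/
theorem exists_testFunction_one_nhds {X : Type*} [NormedAddCommGroup X] [NormedSpace ℝ X]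
    [FiniteDimensional ℝ X] {K U : Set X} (hK : IsCompact K) (hU : IsOpen U) (hKU : K ⊆ U) :
    ∃ χ : X → ℝ, IsTestFunction U χ ∧ (∀ x ∈ K, ∀ᶠ y in 𝓝 x, χ y = 1) ∧
      ∀ x, χ x ∈ Icc (0 : ℝ) 1 := by
  obtain ⟨t, ht, hKt, htU⟩ := exists_compact_between hK hU hKU
  obtain ⟨f, hf1, hf0, hf⟩ := exists_contMDiffMap_one_nhds_of_subset_interior
    (n := (⊤ : ℕ∞)) (modelWithCornersSelf ℝ X) hK.isClosed hKt
  have hsub : tsupport f ⊆ t := closure_minimal (fun x hx => by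
    by_contra h; exact hx (hf0 x h)) ht.isClosed
  refine ⟨f, ⟨f.contMDiff.contDiff, HasCompactSupport.of_support_subset_isCompact ht
    ((subset_tsupport _).trans hsub), hsub.trans htU⟩, fun x hx => ?_, hf⟩
  exact (eventually_nhdsSet_iff_forall.1 hf1) x hx

theorem tendsto_eLpNorm_zero_of_dominated {α E : Type*} [MeasurableSpace α] {ν : Measure α}
    [NormedAddCommGroup E] {p : ℝ} (hp : 0 < p) {f : ℕ → α → E} {g : α → ℝ}
    (hf : ∀ k, AEStronglyMeasurable (f k) ν) (hg : MemLp g (ENNReal.ofReal p) ν)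
    (hfg : ∀ k, ∀ᵐ x ∂ν, ‖f k x‖ ≤ g x)
    (hlim : ∀ᵐ x ∂ν, Tendsto (fun k => f k x) atTop (𝓝 0)) :
    Tendsto (fun k => eLpNorm (f k) (ENNReal.ofReal p) ν) atTop (𝓝 0) := by
  have hne0 : ENNReal.ofReal p ≠ 0 := by simpa using hp
  simp_rw [eLpNorm_eq_lintegral_rpow_enorm_toReal hne0 ENNReal.ofReal_ne_top,
    ENNReal.toReal_ofReal hp.le]
  have h1 : Tendsto (fun k => ∫⁻ x, ‖f k x‖ₑ ^ p ∂ν) atTop (𝓝 (∫⁻ _, 0 ∂ν)) := by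
    refine tendsto_lintegral_of_dominated_convergence' (fun x => ‖g x‖ₑ ^ p)
      (fun k => (hf k).enorm.pow_const p) (fun k => ?_) ?_ ?_
    · filter_upwards [hfg k] with x hx
      refine ENNReal.rpow_le_rpow ?_ hp.le
      exact enorm_le_iff_norm_le.2 (hx.trans (le_abs_self _))
    · have := lintegral_rpow_enorm_lt_top_of_eLpNorm_lt_top hne0 ENNReal.ofReal_ne_top hg.2
      rw [ENNReal.toReal_ofReal hp.le] at this
      exact this.ne
    · filter_upwards [hlim] with x hx
      have h2 := (ENNReal.continuous_rpow_const (y := p)).tendsto _ |>.comp hx.enorm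
      simpa [Function.comp_def, hp] using h2
  have h3 := (ENNReal.continuous_rpow_const (y := 1 / p)).tendsto _ |>.comp h1
  simpa [Function.comp_def, hp] using h3

/-- Composition with a `C¹` function of bounded derivative is continuous on `W^{1,p}`, along a
subsequence. -/
theorem exists_eLpNorm_comp_sub_lt {α E : Type*} [MeasurableSpace α] {ν : Measure α}
    [NormedAddCommGroup E] [NormedSpace ℝ E] {p : ℝ} (hp : 1 ≤ p) {H : ℝ → ℝ}
    (hH : ContDiff ℝ 1 H) {L : ℝ} (hL : ∀ z, |deriv H z| ≤ L)
    {v : α → ℝ} {G : α → E} {v' : ℕ → α → ℝ} {G' : ℕ → α → E}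
    (hv : AEStronglyMeasurable v ν) (hG : MemLp G (ENNReal.ofReal p) ν)
    (hv' : ∀ k, AEStronglyMeasurable (v' k) ν) (hG' : ∀ k, AEStronglyMeasurable (G' k) ν)
    (hvt : Tendsto (fun k => eLpNorm (fun x => v x - v' k x) (ENNReal.ofReal p) ν) atTop (𝓝 0))
    (hGt : Tendsto (fun k => eLpNorm (fun x => G x - G' k x) (ENNReal.ofReal p) ν) atTop (𝓝 0))
    {ε : ENNReal} (hε : 0 < ε) :
    ∃ k, eLpNorm (fun x => H (v x) - H (v' k x)) (ENNReal.ofReal p) ν < ε ∧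
      eLpNorm (fun x => deriv H (v x) • G x - deriv H (v' k x) • G' k x)
        (ENNReal.ofReal p) ν < ε := by
  have hp0 : 0 < p := by linarith
  have hpE : (1 : ENNReal) ≤ ENNReal.ofReal p := by simpa using hp
  have hne0 : ENNReal.ofReal p ≠ 0 := by simpa using hp0
  have hL0 : 0 ≤ L := (abs_nonneg _).trans (hL 0)
  have hdH : Continuous (deriv H) := hH.continuous_deriv le_rfl
  have hlip : ∀ a b, |H a - H b| ≤ L * |a - b| := fun a b => by
    simpa using Convex.norm_image_sub_le_of_norm_deriv_le (𝕜 := ℝ) (f := H) (C := L)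
      (fun z _ => hH.differentiable one_ne_zero z) (fun z _ => hL z) convex_univ
      (mem_univ b) (mem_univ a)
  have hvt' : Tendsto (fun k => eLpNorm (v' k - v) (ENNReal.ofReal p) ν) atTop (𝓝 0) := by
    refine hvt.congr fun k => ?_
    exact eLpNorm_sub_comm v (v' k) _ ν
  -- Only continuity of `deriv H` is available, so its values at the approximants are controlled
  -- through almost everywhere convergence, which needs a subsequence.
  obtain ⟨ns, hns, hae⟩ :=
    (tendstoInMeasure_of_tendsto_eLpNorm hne0 hv' hv hvt').exists_seq_tendsto_ae
  have T1 : Tendsto (fun j => eLpNorm (fun x => H (v x) - H (v' (ns j) x)) (ENNReal.ofReal p) ν)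
      atTop (𝓝 0) := by
    have h0 := ENNReal.Tendsto.const_mul (a := ENNReal.ofReal L) (hvt.comp hns.tendsto_atTop)
      (Or.inr ENNReal.ofReal_ne_top)
    rw [mul_zero] at h0
    refine tendsto_of_tendsto_of_tendsto_of_le_of_le tendsto_const_nhds h0 (fun _ => zero_le)
      fun j => ?_
    exact eLpNorm_le_mul_eLpNorm_of_ae_le_mul (ae_of_all _ fun x => hlip _ _) _
  have T2 : Tendsto (fun j => eLpNorm (fun x => deriv H (v' (ns j) x) • (G x - G' (ns j) x))
      (ENNReal.ofReal p) ν) atTop (𝓝 0) := by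
    have h0 := ENNReal.Tendsto.const_mul (a := ENNReal.ofReal L) (hGt.comp hns.tendsto_atTop)
      (Or.inr ENNReal.ofReal_ne_top)
    rw [mul_zero] at h0
    refine tendsto_of_tendsto_of_tendsto_of_le_of_le tendsto_const_nhds h0 (fun _ => zero_le)
      fun j => ?_
    refine eLpNorm_le_mul_eLpNorm_of_ae_le_mul (ae_of_all _ fun x => ?_) _
    rw [norm_smul]
    gcongr
    exact hL _
  -- The gradient difference splits as `(H'(v) - H'(v'))G + H'(v')(G - G')`. The second summand is
  -- small by the bound on `H'`; this first one converges by domination with `2L|G|`.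
  have T3 : Tendsto (fun j => eLpNorm (fun x => (deriv H (v x) - deriv H (v' (ns j) x)) • G x)
      (ENNReal.ofReal p) ν) atTop (𝓝 0) := by
    refine tendsto_eLpNorm_zero_of_dominated hp0 (g := fun x => 2 * L * ‖G x‖) (fun j => ?_)
      (hG.norm.const_mul _) (fun j => ae_of_all _ fun x => ?_) ?_
    · exact ((hdH.comp_aestronglyMeasurable hv).sub
        (hdH.comp_aestronglyMeasurable (hv' _))).smul hG.1
    · rw [norm_smul]
      gcongr
      calc _ ≤ |deriv H (v x)| + |deriv H (v' (ns j) x)| := abs_sub _ _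
        _ ≤ _ := by linarith [hL (v x), hL (v' (ns j) x)]
    · filter_upwards [hae] with x hx
      have := (((hdH.tendsto _).comp hx).const_sub (deriv H (v x))).smul_const (G x)
      simpa [Function.comp_def] using this
  have T4 := T3.add T2
  rw [add_zero] at T4
  obtain ⟨j, hj1, hj2⟩ := ((T1.eventually (gt_mem_nhds hε)).and
    (T4.eventually (gt_mem_nhds hε))).exists
  refine ⟨ns j, hj1, lt_of_le_of_lt ?_ hj2⟩
  refine le_trans (le_of_eq ?_) (eLpNorm_add_le ?_ ?_ hpE)
  · congr 1
    funext x
    simp only [Pi.add_apply, sub_smul, smul_sub]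
    abel
  · exact ((hdH.comp_aestronglyMeasurable hv).sub
        (hdH.comp_aestronglyMeasurable (hv' _))).smul hG.1
  · exact (hdH.comp_aestronglyMeasurable (hv' _)).smul (hG.1.sub (hG' _))

variable {p : ℝ} {Ω : Set (Space n)}

theorem IsTestFunction.gradient_aestronglyMeasurable {φ : Space n → ℝ} (hφ : IsTestFunction Ω φ)
    (ν : Measure (Space n)) : AEStronglyMeasurable (gradient φ) ν :=
  (continuous_gradient (hφ.1.of_le (by simp))).aestronglyMeasurable

theorem IsTestFunction.sobolevZero {φ : Space n → ℝ} (hφ : IsTestFunction Ω φ) :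
    SobolevZero p Ω φ (gradient φ) := by
  have hφ1 : ContDiff ℝ 1 φ := hφ.1.of_le (by simp)
  refine ⟨(hφ1.continuous.memLp_of_hasCompactSupport hφ.2.1).restrict _,
    ((continuous_gradient hφ1).memLp_of_hasCompactSupport
      (hφ.2.1.mono' ((subset_tsupport _).trans (tsupport_gradient_subset φ)))).restrict _,
    fun ε hε => ⟨φ, hφ, by simpa using hε, by simpa using hε⟩⟩

theorem SobolevZero.of_approx (hp : 1 ≤ p) {v : Space n → ℝ} {G : Space n → Space n}
    (hv : MemLp v (ENNReal.ofReal p) (volume.restrict Ω))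
    (hG : MemLp G (ENNReal.ofReal p) (volume.restrict Ω))
    (h : ∀ ε : ENNReal, 0 < ε → ∃ v' G', SobolevZero p Ω v' G' ∧
      eLpNorm (fun x => v x - v' x) (ENNReal.ofReal p) (volume.restrict Ω) < ε ∧
      eLpNorm (fun x => G x - G' x) (ENNReal.ofReal p) (volume.restrict Ω) < ε) :
    SobolevZero p Ω v G := by
  have hpE : (1 : ENNReal) ≤ ENNReal.ofReal p := by simpa using hp
  refine ⟨hv, hG, fun ε hε => ?_⟩
  obtain ⟨v', G', h0, h1, h2⟩ := h (ε / 2) (ENNReal.half_pos hε.ne')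
  obtain ⟨φ, hφ, h3, h4⟩ := h0.2.2 (ε / 2) (ENNReal.half_pos hε.ne')
  refine ⟨φ, hφ, ?_, ?_⟩
  · have := eLpNorm_add_le (hv.1.sub h0.1.1)
      (h0.1.1.sub hφ.1.continuous.aestronglyMeasurable) hpE
    refine (le_of_eq ?_).trans_lt (this.trans_lt ?_)
    · congr 1; funext x; simp
    · exact (ENNReal.add_lt_add h1 h3).trans_eq (ENNReal.add_halves ε)
  · have := eLpNorm_add_le (hG.1.sub h0.2.1.1)
      (h0.2.1.1.sub (hφ.gradient_aestronglyMeasurable _)) hpE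
    refine (le_of_eq ?_).trans_lt (this.trans_lt ?_)
    · congr 1; funext x; simp
    · exact (ENNReal.add_lt_add h2 h4).trans_eq (ENNReal.add_halves ε)

theorem SobolevZero.exists_seq {v : Space n → ℝ} {G : Space n → Space n}
    (h : SobolevZero p Ω v G) : ∃ φ : ℕ → Space n → ℝ, (∀ k, IsTestFunction Ω (φ k)) ∧
      Tendsto (fun k => eLpNorm (fun x => v x - φ k x) (ENNReal.ofReal p) (volume.restrict Ω))
        atTop (𝓝 0) ∧
      Tendsto (fun k => eLpNorm (fun x => G x - gradient (φ k) x) (ENNReal.ofReal p)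
        (volume.restrict Ω)) atTop (𝓝 0) := by
  have hpos : ∀ k : ℕ, (0 : ENNReal) < (k : ENNReal)⁻¹ := fun k => by simp
  choose φ hφ h1 h2 using fun k : ℕ => h.2.2 _ (hpos k)
  exact ⟨φ, hφ,
    tendsto_of_tendsto_of_tendsto_of_le_of_le tendsto_const_nhds
      ENNReal.tendsto_inv_nat_nhds_zero (fun _ => zero_le) fun k => (h1 k).le,
    tendsto_of_tendsto_of_tendsto_of_le_of_le tendsto_const_nhds
      ENNReal.tendsto_inv_nat_nhds_zero (fun _ => zero_le) fun k => (h2 k).le⟩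

theorem SobolevZero.add (hp : 1 ≤ p) {v w : Space n → ℝ} {G K : Space n → Space n}
    (hv : SobolevZero p Ω v G) (hw : SobolevZero p Ω w K) :
    SobolevZero p Ω (fun x => v x + w x) (fun x => G x + K x) := by
  have hpE : (1 : ENNReal) ≤ ENNReal.ofReal p := by simpa using hp
  refine ⟨hv.1.add hw.1, hv.2.1.add hw.2.1, fun ε hε => ?_⟩
  obtain ⟨φ, hφ, h1, h2⟩ := hv.2.2 (ε / 2) (ENNReal.half_pos hε.ne')
  obtain ⟨χ, hχ, h3, h4⟩ := hw.2.2 (ε / 2) (ENNReal.half_pos hε.ne')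
  have hd : ∀ {f : Space n → ℝ}, IsTestFunction Ω f → Differentiable ℝ f := fun hf =>
    hf.1.differentiable (by simp)
  refine ⟨fun x => φ x + χ x, ⟨hφ.1.add hχ.1, hφ.2.1.add hχ.2.1,
    (tsupport_add φ χ).trans (union_subset hφ.2.2 hχ.2.2)⟩, ?_, ?_⟩
  · have := eLpNorm_add_le (hv.1.1.sub hφ.1.continuous.aestronglyMeasurable)
      (hw.1.1.sub hχ.1.continuous.aestronglyMeasurable) hpE
    refine (le_of_eq ?_).trans_lt (this.trans_lt ?_)
    · congr 1; funext x; simp only [Pi.add_apply, Pi.sub_apply]; ring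
    · exact (ENNReal.add_lt_add h1 h3).trans_eq (ENNReal.add_halves ε)
  · have := eLpNorm_add_le (hv.2.1.1.sub (hφ.gradient_aestronglyMeasurable _))
      (hw.2.1.1.sub (hχ.gradient_aestronglyMeasurable _)) hpE
    refine (le_of_eq ?_).trans_lt (this.trans_lt ?_)
    · congr 1; funext x
      rw [gradient_add' (hd hφ x) (hd hχ x)]
      simp only [Pi.add_apply, Pi.sub_apply]; abel
    · exact (ENNReal.add_lt_add h2 h4).trans_eq (ENNReal.add_halves ε)

theorem SobolevZero.neg {v : Space n → ℝ} {G : Space n → Space n}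
    (hv : SobolevZero p Ω v G) : SobolevZero p Ω (fun x => - v x) (fun x => - G x) := by
  refine ⟨hv.1.neg, hv.2.1.neg, fun ε hε => ?_⟩
  obtain ⟨φ, hφ, h1, h2⟩ := hv.2.2 ε hε
  have hg : ∀ x, gradient (fun x => - φ x) x = - gradient φ x := fun x =>
    ext_inner_right ℝ fun e => by
      rw [inner_gradient_left, inner_neg_left, inner_gradient_left, fderiv_fun_neg]; rfl
  refine ⟨fun x => - φ x, ⟨hφ.1.neg, hφ.2.1.neg, ?_⟩, ?_, ?_⟩
  · exact (closure_mono fun x hx => by simpa using hx).trans hφ.2.2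
  · rw [← eLpNorm_neg]
    convert! h1 using 2
    funext x; simp only [Pi.neg_apply]; ring
  · rw [← eLpNorm_neg]
    convert! h2 using 2
    funext x; simp only [Pi.neg_apply, hg]; abel

theorem memLp_comp_of_deriv_bound {α : Type*} [MeasurableSpace α] {ν : Measure α} {q : ENNReal}
    {H : ℝ → ℝ} (hH : ContDiff ℝ 1 H) {L : ℝ} (hL : ∀ z, |deriv H z| ≤ L) (hH0 : H 0 = 0)
    {v : α → ℝ} (hv : MemLp v q ν) : MemLp (fun x => H (v x)) q ν := by
  refine hv.of_le_mul (c := L) (hH.continuous.comp_aestronglyMeasurable hv.1)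
    (ae_of_all _ fun x => ?_)
  simpa [hH0] using Convex.norm_image_sub_le_of_norm_deriv_le (𝕜 := ℝ) (f := H) (C := L)
      (fun z _ => hH.differentiable one_ne_zero z) (fun z _ => hL z) convex_univ
      (mem_univ 0) (mem_univ (v x))

theorem memLp_deriv_smul {α E : Type*} [MeasurableSpace α] {ν : Measure α} {q : ENNReal}
    [NormedAddCommGroup E] [NormedSpace ℝ E]
    {H : ℝ → ℝ} (hH : ContDiff ℝ 1 H) {L : ℝ} (hL : ∀ z, |deriv H z| ≤ L)
    {v : α → ℝ} {G : α → E} (hv : AEStronglyMeasurable v ν) (hG : MemLp G q ν) :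
    MemLp (fun x => deriv H (v x) • G x) q ν := by
  refine hG.of_le_mul (c := L)
    (((hH.continuous_deriv le_rfl).comp_aestronglyMeasurable hv).smul hG.1)
    (ae_of_all _ fun x => ?_)
  rw [norm_smul]
  gcongr
  exact hL _

/-- Since `H 0 = 0`, composing the approximating test functions with `H` does not enlarge their
supports, so the compositions are again test functions. -/
theorem SobolevZero.comp (hp : 1 ≤ p) {v : Space n → ℝ} {G : Space n → Space n}
    (hv : SobolevZero p Ω v G) {H : ℝ → ℝ} (hH : ContDiff ℝ ∞ H) (hH0 : H 0 = 0) {L : ℝ}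
    (hL : ∀ z, |deriv H z| ≤ L) :
    SobolevZero p Ω (fun x => H (v x)) (fun x => deriv H (v x) • G x) := by
  have hH1 : ContDiff ℝ 1 H := hH.of_le (by simp)
  obtain ⟨φ, hφ, t1, t2⟩ := hv.exists_seq
  refine ⟨memLp_comp_of_deriv_bound hH1 hL hH0 hv.1, memLp_deriv_smul hH1 hL hv.1.1 hv.2.1,
    fun ε hε => ?_⟩
  obtain ⟨k, hk1, hk2⟩ := exists_eLpNorm_comp_sub_lt hp hH1 hL hv.1.1 hv.2.1
    (fun k => (hφ k).1.continuous.aestronglyMeasurable)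
    (fun k => (hφ k).gradient_aestronglyMeasurable _) t1 t2 hε
  refine ⟨fun x => H (φ k x), ⟨hH.comp (hφ k).1, (hφ k).2.1.comp_left hH0, ?_⟩, hk1, ?_⟩
  · refine Subset.trans (closure_mono fun x hx => ?_) (hφ k).2.2
    exact fun h => hx (by simp [h, hH0])
  · convert! hk2 using 3
    rw [gradient_comp_real ((hφ k).1.differentiable (by simp) _)
      (hH1.differentiable one_ne_zero _)]

/-- If `g ≤ 0` on the boundary and `H` vanishes below a positive level, then `H(v + g)` has zero
boundary values. -/
theorem SobolevZero.comp_add_of_nonpos_frontier (hp : 1 < p) (hΩ : IsOpen Ω)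
    (hΩb : Bornology.IsBounded Ω) {v g : Space n → ℝ} {G K : Space n → Space n}
    (hv : SobolevZero p Ω v G) (hg : HasW1pGradient p Ω g K)
    (hgc : ContinuousOn g (closure Ω)) (hg0 : ∀ x ∈ frontier Ω, g x ≤ 0)
    {H : ℝ → ℝ} (hH : ContDiff ℝ ∞ H) {δ : ℝ} (hδ : 0 < δ) (hH0 : ∀ z ≤ δ, H z = 0) {L : ℝ}
    (hL : ∀ z, |deriv H z| ≤ L) :
    SobolevZero p Ω (fun x => H (v x + g x)) (fun x => deriv H (v x + g x) • (G x + K x)) := by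
  have hH1 : ContDiff ℝ 1 H := hH.of_le (by simp)
  have hdH0 : ∀ z < δ, deriv H z = 0 := fun z hz => by
    have : H =ᶠ[𝓝 z] fun _ => 0 := by
      filter_upwards [gt_mem_nhds hz] with y hy using hH0 y hy.le
    simpa using this.deriv_eq
  have hw : MemLp (fun x => v x + g x) (ENNReal.ofReal p) (volume.restrict Ω) := hv.1.add hg.1
  have hGK : MemLp (fun x => G x + K x) (ENNReal.ofReal p) (volume.restrict Ω) :=
    hv.2.1.add hg.2.1
  refine SobolevZero.of_approx hp.le
    (memLp_comp_of_deriv_bound hH1 hL (hH0 0 hδ.le) hw) (memLp_deriv_smul hH1 hL hw.1 hGK)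
    fun ε hε => ?_
  -- Replacing `v` by a test function `φ` reduces the claim to `H(φ + g)`, which vanishes where `φ =
  -- 0` and `g ≤ δ`, hence near the boundary.
  obtain ⟨φ, hφ, t1, t2⟩ := hv.exists_seq
  obtain ⟨k, hk1, hk2⟩ := exists_eLpNorm_comp_sub_lt (v' := fun k x => φ k x + g x)
    (G' := fun k x => gradient (φ k) x + K x) hp.le hH1 hL hw.1 hGK
    (fun k => (hφ k).1.continuous.aestronglyMeasurable.add hg.1.1)
    (fun k => ((hφ k).gradient_aestronglyMeasurable _).add hg.2.1.1)
    (by simpa using t1) (by simpa using t2) hε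
  refine ⟨_, _, ?_, hk1, hk2⟩
  have hclc : IsCompact (closure Ω) := hΩb.isCompact_closure
  -- The positive gap `δ` matters here: the set `g ≥ δ` is closed and misses the boundary, so it is
  -- a compact subset of `Ω`, whereas `g > 0` could accumulate at the boundary.
  have hSc : IsCompact {x ∈ closure Ω | δ ≤ g x} := by
    refine hclc.of_isClosed_subset ?_ (sep_subset _ _)
    exact hgc.preimage_isClosed_of_isClosed isClosed_closure isClosed_Ici
  have hSΩ : {x ∈ closure Ω | δ ≤ g x} ⊆ Ω := by
    rintro x ⟨hx, hxg⟩
    by_contra hxΩ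
    have := hg0 x ⟨hx, by rwa [hΩ.interior_eq]⟩
    linarith
  -- Replacing `g` by `χ g` does not change `H(φ + g)`: on the compact set `χ = 1`, and off it `φ =
  -- 0` while both `g` and `χ g` lie below the level where `H` starts. The same comparison applies
  -- to the gradients.
  obtain ⟨χ, hχ, hχ1, hχI⟩ := exists_testFunction_one_nhds
    (hSc.union (hφ k).2.1.isCompact) hΩ (union_subset hSΩ (hφ k).2.2)
  have h1 := ((hφ k).sobolevZero).add hp.le (hg.sobolevZero_mul_testFunction hp hΩ hχ)
  refine (h1.comp hp.le hH (hH0 0 hδ.le) hL).congr_ae ?_ ?_ <;>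
    filter_upwards [ae_restrict_mem hΩ.measurableSet] with x hx <;>
    by_cases hxK : x ∈ {x ∈ closure Ω | δ ≤ g x} ∪ tsupport (φ k)
  · simp [(hχ1 x hxK).self_of_nhds]
  · have hφ0 : φ k x = 0 := by
      by_contra h; exact hxK (Or.inr (subset_tsupport _ h))
    have hgx : g x < δ := by
      by_contra! h; exact hxK (Or.inl ⟨subset_closure hx, h⟩)
    have : χ x * g x ≤ δ := by
      obtain ⟨ha, hb⟩ := hχI x
      nlinarith
    rw [hφ0, zero_add, zero_add, hH0 _ hgx.le, hH0 _ this]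
  · have hg0 : gradient χ x = 0 := by
      have : χ =ᶠ[𝓝 x] fun _ => (1 : ℝ) := hχ1 x hxK
      rw [this.gradient_eq, gradient_fun_const]
    simp [(hχ1 x hxK).self_of_nhds, hg0]
  · have hφ0 : φ k x = 0 := by
      by_contra h; exact hxK (Or.inr (subset_tsupport _ h))
    have hgx : g x < δ := by
      by_contra! h; exact hxK (Or.inl ⟨subset_closure hx, h⟩)
    have : χ x * g x < δ := by
      obtain ⟨ha, hb⟩ := hχI x
      rcases hb.lt_or_eq with hb | hb
      · nlinarith
      · rw [hb]; linarith
    simp [hφ0, hdH0 _ hgx, hdH0 _ this]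

end Trudinger

/-! ### The nonlinearities, Hölder duality and separability -/

namespace Trudinger
variable {n : ℕ}

section Algebra
variable {p : ℝ}

/-- In this form `b` is a difference of powers with positive exponent `p - 1`, avoiding the possibly
negative exponent `p - 2`. Continuity and strict monotonicity can then be read off for every `p >
1`. -/
theorem b_eq (hp : 1 < p) (z : ℝ) : b p z = (max z 0) ^ (p - 1) - (max (-z) 0) ^ (p - 1) := by
  have h0 : (0 : ℝ) ^ (p - 1) = 0 := Real.zero_rpow (by linarith)
  have h1 : ∀ r : ℝ, 0 < r → r ^ (p - 2) * r = r ^ (p - 1) := fun r hr => by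
    rw [← Real.rpow_add_one hr.ne']; ring_nf
  rcases lt_trichotomy z 0 with hz | rfl | hz
  · rw [b, max_eq_right hz.le, max_eq_left (by linarith), h0, abs_of_neg hz,
      ← h1 (-z) (by linarith)]
    ring
  · simp [b]
  · rw [b, max_eq_left hz.le, max_eq_right (by linarith), h0, abs_of_pos hz, h1 z hz, sub_zero]

theorem continuous_b (hp : 1 < p) : Continuous (b p) := by
  rw [show b p = _ from funext (b_eq hp)]
  have : 0 ≤ p - 1 := by linarith
  exact ((continuous_id.max continuous_const).rpow_const fun _ => Or.inr this).sub
    ((continuous_neg.max continuous_const).rpow_const fun _ => Or.inr this)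

theorem strictMono_b (hp : 1 < p) : StrictMono (b p) := by
  intro y z h
  rw [b_eq hp, b_eq hp]
  have hp1 : 0 < p - 1 := by linarith
  have h1 : (max y 0) ^ (p - 1) ≤ (max z 0) ^ (p - 1) :=
    Real.rpow_le_rpow (le_max_right _ _) (max_le_max_right _ h.le) hp1.le
  have h2 : (max (-z) 0) ^ (p - 1) ≤ (max (-y) 0) ^ (p - 1) :=
    Real.rpow_le_rpow (le_max_right _ _) (max_le_max_right _ (by linarith)) hp1.le
  rcases le_or_gt z 0 with hz | hz
  · have : (max (-z) 0) ^ (p - 1) < (max (-y) 0) ^ (p - 1) := by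
      refine Real.rpow_lt_rpow (le_max_right _ _) ?_ hp1
      rw [max_eq_left (by linarith), max_eq_left (by linarith)]; linarith
    linarith
  · have : (max y 0) ^ (p - 1) < (max z 0) ^ (p - 1) := by
      refine Real.rpow_lt_rpow (le_max_right _ _) ?_ hp1
      rw [max_eq_left hz.le]
      exact max_lt h hz
    linarith

theorem abs_b (hp : 1 < p) (z : ℝ) : |b p z| = |z| ^ (p - 1) := by
  rcases eq_or_ne z 0 with rfl | hz
  · rw [b]; simp [Real.zero_rpow (show p - 1 ≠ 0 by linarith)]
  · have : 0 < |z| := abs_pos.2 hz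
    rw [b, abs_mul, abs_of_nonneg (by positivity), ← Real.rpow_add_one this.ne']
    ring_nf

theorem b_zero : b p 0 = 0 := by simp [b]

variable {E : Type*} [NormedAddCommGroup E] [InnerProductSpace ℝ E]

/-- The `p`-Laplace flux `ξ ↦ |ξ|^{p-2} ξ`. -/
noncomputable def flux (p : ℝ) (ξ : E) : E := ‖ξ‖ ^ (p - 2) • ξ

theorem norm_flux (hp : 1 < p) (ξ : E) : ‖flux p ξ‖ = ‖ξ‖ ^ (p - 1) := by
  rcases eq_or_ne ξ 0 with rfl | h
  · simp [flux, Real.zero_rpow (show p - 1 ≠ 0 by linarith)]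
  · have : 0 < ‖ξ‖ := norm_pos_iff.2 h
    rw [flux, norm_smul, Real.norm_of_nonneg (by positivity), ← Real.rpow_add_one this.ne']
    ring_nf

/-- By Cauchy–Schwarz the expression is at least `(|ξ|^(p-1) - |ζ|^(p-1))(|ξ| - |ζ|)`, a product of
two differences of equal sign. -/
theorem inner_flux_sub_nonneg (hp : 1 < p) (ξ ζ : E) :
    0 ≤ inner ℝ (flux p ξ - flux p ζ) (ξ - ζ) := by
  have key : ∀ a : E, inner ℝ (flux p a) a = ‖a‖ ^ (p - 1) * ‖a‖ := fun a => by
    rcases eq_or_ne a 0 with rfl | h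
    · simp
    · have : 0 < ‖a‖ := norm_pos_iff.2 h
      rw [flux, inner_smul_left, real_inner_self_eq_norm_sq]
      have h2 : ‖a‖ ^ (p - 1) = ‖a‖ ^ (p - 2) * ‖a‖ := by
        rw [← Real.rpow_add_one this.ne']; ring_nf
      rw [h2]; simp; ring
  have h1 := real_inner_le_norm (flux p ξ) ζ
  have h2 := real_inner_le_norm (flux p ζ) ξ
  rw [norm_flux hp] at h1 h2
  have h3 : 0 ≤ (‖ξ‖ ^ (p - 1) - ‖ζ‖ ^ (p - 1)) * (‖ξ‖ - ‖ζ‖) := by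
    rcases le_total ‖ξ‖ ‖ζ‖ with h | h
    · exact mul_nonneg_of_nonpos_of_nonpos (sub_nonpos.2 (Real.rpow_le_rpow (norm_nonneg _) h
        (by linarith))) (sub_nonpos.2 h)
    · exact mul_nonneg (sub_nonneg.2 (Real.rpow_le_rpow (norm_nonneg _) h
        (by linarith))) (sub_nonneg.2 h)
  rw [inner_sub_left, inner_sub_right, inner_sub_right, key, key]
  nlinarith

theorem measurable_flux [MeasurableSpace E] [BorelSpace E] [SecondCountableTopology E] :
    Measurable (flux p : E → E) := by
  unfold flux
  fun_prop

/-- This is the identity `(p-1)q = p`. It places both `b(u)` and the flux in the dual space `L^q`.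
-/
theorem MemLp.norm_rpow_sub_one {α F F' : Type*} [MeasurableSpace α] {ν : Measure α}
    [NormedAddCommGroup F] [NormedAddCommGroup F'] {q : ℝ} (hpq : p.HolderConjugate q)
    {f : α → F} (hf : MemLp f (ENNReal.ofReal p) ν) {g : α → F'} (hg : AEStronglyMeasurable g ν)
    (h : ∀ x, ‖g x‖ = ‖f x‖ ^ (p - 1)) : MemLp g (ENNReal.ofReal q) ν := by
  have h1 := hf.norm_rpow_div (ENNReal.ofReal (p - 1))
  have hp1 : 0 < p - 1 := by linarith [hpq.lt]
  rw [ENNReal.toReal_ofReal hp1.le, ← ENNReal.ofReal_div_of_pos hp1, ← hpq.conjugate_eq] at h1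
  exact h1.of_le hg (ae_of_all _ fun x => by rw [h x]; exact le_abs_self _)

end Algebra

section Holder
variable {α E : Type*} [MeasurableSpace α] {ν : Measure α} [NormedAddCommGroup E]
  [InnerProductSpace ℝ E] {p q : ℝ}

theorem eLpNorm_inner_le (hpq : p.HolderConjugate q) {f g : α → E}
    (hf : AEStronglyMeasurable f ν) (hg : AEStronglyMeasurable g ν) :
    eLpNorm (fun x => inner ℝ (f x) (g x)) 1 ν
      ≤ eLpNorm f (ENNReal.ofReal q) ν * eLpNorm g (ENNReal.ofReal p) ν := by
  have := hpq.symm.ennrealOfReal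
  have h := eLpNorm_le_eLpNorm_mul_eLpNorm'_of_norm (r := 1) (p := ENNReal.ofReal q)
    (q := ENNReal.ofReal p) hf hg (fun a c => inner ℝ a c) 1
    (ae_of_all _ fun x => by simpa using norm_inner_le_norm (𝕜 := ℝ) (f x) (g x))
  simpa using h

theorem integrable_inner_of_holder (hpq : p.HolderConjugate q) {f g : α → E}
    (hf : MemLp f (ENNReal.ofReal q) ν) (hg : MemLp g (ENNReal.ofReal p) ν) :
    Integrable (fun x => inner ℝ (f x) (g x)) ν := by
  rw [← memLp_one_iff_integrable]
  exact ⟨hf.1.inner hg.1, (eLpNorm_inner_le hpq hf.1 hg.1).trans_lt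
    (ENNReal.mul_lt_top hf.2 hg.2)⟩

theorem tendsto_integral_inner (hpq : p.HolderConjugate q) {f g : α → E} {g' : ℕ → α → E}
    (hf : MemLp f (ENNReal.ofReal q) ν) (hg : MemLp g (ENNReal.ofReal p) ν)
    (hg' : ∀ k, MemLp (g' k) (ENNReal.ofReal p) ν)
    (ht : Tendsto (fun k => eLpNorm (fun x => g x - g' k x) (ENNReal.ofReal p) ν) atTop (𝓝 0)) :
    Tendsto (fun k => ∫ x, inner ℝ (f x) (g' k x) ∂ν) atTop (𝓝 (∫ x, inner ℝ (f x) (g x) ∂ν)) := by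
  rw [tendsto_iff_edist_tendsto_0]
  have h0 := ENNReal.Tendsto.const_mul (a := eLpNorm f (ENNReal.ofReal q) ν) ht
    (Or.inr hf.2.ne)
  rw [mul_zero] at h0
  refine tendsto_of_tendsto_of_tendsto_of_le_of_le tendsto_const_nhds h0 (fun _ => zero_le)
    fun k => ?_
  have h1 : (∫ x, inner ℝ (f x) (g x) ∂ν) - ∫ x, inner ℝ (f x) (g' k x) ∂ν
      = ∫ x, inner ℝ (f x) (g x - g' k x) ∂ν := by
    simp_rw [inner_sub_right]
    rw [integral_sub (integrable_inner_of_holder hpq hf hg)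
      (integrable_inner_of_holder hpq hf (hg' k))]
  rw [edist_comm, edist_eq_enorm_sub, h1]
  refine (enorm_integral_le_lintegral_enorm _).trans ?_
  rw [← eLpNorm_one_eq_lintegral_enorm]
  exact eLpNorm_inner_le hpq hf.1 (hg.1.sub (hg' k).1)

theorem eLpNorm_comp_fst {β F : Type*} [MeasurableSpace β] {ρ : Measure β} [IsFiniteMeasure ρ]
    [SFinite ν] [NormedAddCommGroup F] (hp : 0 < p) {f : α → F} (hf : AEStronglyMeasurable f ν) :
    eLpNorm (fun z : α × β => f z.1) (ENNReal.ofReal p) (ν.prod ρ)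
      = ρ univ ^ (1 / p) * eLpNorm f (ENNReal.ofReal p) ν := by
  have h1 : eLpNorm f (ENNReal.ofReal p) (Measure.map Prod.fst (ν.prod ρ))
      = eLpNorm (f ∘ Prod.fst) (ENNReal.ofReal p) (ν.prod ρ) := by
    refine eLpNorm_map_measure ?_ measurable_fst.aemeasurable
    rw [Measure.map_fst_prod]
    exact hf.smul_measure _
  rw [Function.comp_def] at h1
  rw [← h1, Measure.map_fst_prod, eLpNorm_smul_measure_of_ne_top ENNReal.ofReal_ne_top]
  simp [ENNReal.toReal_ofReal hp.le]

end Holder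

theorem isTestFunction_zero {X : Type*} [NormedAddCommGroup X] [NormedSpace ℝ X] (U : Set X) :
    IsTestFunction U (fun _ => (0 : ℝ)) :=
  ⟨contDiff_const, HasCompactSupport.zero, by simp [tsupport]⟩

/-- The pair (function, gradient) lives in a separable product of `Lp` spaces, and subsets of
separable metric spaces are separable. Countability is what later gives a single exceptional null
set of times valid for all test functions. -/
theorem exists_dense_seq_testFunction {p : ℝ} (hp : 1 ≤ p) (Ω : Set (Space n)) :
    ∃ φ : ℕ → Space n → ℝ, (∀ k, IsTestFunction Ω (φ k)) ∧
      ∀ v G, SobolevZero p Ω v G → ∀ ε : ENNReal, 0 < ε → ∃ k,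
        eLpNorm (fun x => v x - φ k x) (ENNReal.ofReal p) (volume.restrict Ω) < ε ∧
        eLpNorm (fun x => G x - gradient (φ k) x) (ENNReal.ofReal p) (volume.restrict Ω) < ε := by
  have : Fact (1 ≤ ENNReal.ofReal p) := ⟨by simpa using hp⟩
  have : Fact (ENNReal.ofReal p ≠ ⊤) := ⟨ENNReal.ofReal_ne_top⟩
  let V := Lp ℝ (ENNReal.ofReal p) (volume.restrict Ω) ×
    Lp (Space n) (ENNReal.ofReal p) (volume.restrict Ω)
  let A := {φ : Space n → ℝ // IsTestFunction Ω φ}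
  let S : A → V := fun φ => (φ.2.sobolevZero.1.toLp φ.1, φ.2.sobolevZero.2.1.toLp _)
  have : Nonempty A := ⟨⟨_, isTestFunction_zero Ω⟩⟩
  have : Nonempty (range S) := (range_nonempty S).to_subtype
  have : SecondCountableTopology (Lp ℝ (ENNReal.ofReal p) (volume.restrict Ω)) := inferInstance
  have : SecondCountableTopology (Lp (Space n) (ENNReal.ofReal p) (volume.restrict Ω)) :=
    inferInstance
  have : SecondCountableTopology V := inferInstanceAs (SecondCountableTopology
    (Lp ℝ (ENNReal.ofReal p) (volume.restrict Ω) ×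
      Lp (Space n) (ENNReal.ofReal p) (volume.restrict Ω)))
  let d : ℕ → range S := TopologicalSpace.denseSeq (range S)
  choose a ha using fun k => (d k).2
  refine ⟨fun k => (a k).1, fun k => (a k).2, fun v G h ε hε => ?_⟩
  have hcl : ((h.1.toLp v, h.2.1.toLp G) : V) ∈ closure (range S) := by
    refine EMetric.mem_closure_iff.2 fun ε hε => ?_
    obtain ⟨φ, hφ, h1, h2⟩ := h.2.2 ε hε
    refine ⟨S ⟨φ, hφ⟩, mem_range_self _, ?_⟩
    rw [Prod.edist_eq, max_lt_iff]
    exact ⟨(Lp.edist_toLp_toLp _ _ h.1 hφ.sobolevZero.1).trans_lt h1,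
      (Lp.edist_toLp_toLp _ _ h.2.1 hφ.sobolevZero.2.1).trans_lt h2⟩
  have hcl2 : closure (range S) ⊆ closure (range fun k => (d k : V)) := by
    refine closure_minimal (fun x hx => ?_) isClosed_closure

    have h2 := image_closure_subset_closure_image (s := range d)
      (continuous_subtype_val (p := fun x => x ∈ range S))
    rw [← range_comp] at h2
    refine h2 ⟨⟨x, hx⟩, ?_, rfl⟩
    exact TopologicalSpace.denseRange_denseSeq (range S) ⟨x, hx⟩
  obtain ⟨_, ⟨k, rfl⟩, hk⟩ := EMetric.mem_closure_iff.1 (hcl2 hcl) ε hε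
  refine ⟨k, ?_⟩
  simp only [← ha k] at hk
  rw [Prod.edist_eq, max_lt_iff] at hk
  exact ⟨(Lp.edist_toLp_toLp _ _ h.1 (a k).2.sobolevZero.1).symm.trans_lt hk.1,
    (Lp.edist_toLp_toLp _ _ h.2.1 (a k).2.sobolevZero.2.1).symm.trans_lt hk.2⟩

end Trudinger

/-! ### Weak derivatives in time as increments -/

namespace Trudinger
variable {n : ℕ}

section Primitive
variable {k : ℝ → ℝ} {c r : ℝ}

theorem integral_eq_zero_of_le (hr : ∀ x, r ≤ |x| → k x = 0) (hrc : r < c) {s : ℝ} (hs : s ≤ -r) :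
    ∫ x in (-c)..s, k x = 0 := by
  refine intervalIntegral.integral_zero_ae (ae_of_all _ fun x hx => hr x ?_)
  rcases le_total (-c) s with h | h
  · rw [uIoc_of_le h] at hx
    rw [le_abs]; right; linarith [hx.2]
  · rw [uIoc_of_ge h] at hx
    rw [le_abs]; right; linarith [hx.2]

theorem integral_eq_one_of_ge (hr : ∀ x, r ≤ |x| → k x = 0) (hrc : r < c)
    (h1 : ∫ x, k x = 1) {s : ℝ} (hs : r ≤ s) :
    ∫ x in (-c)..s, k x = 1 := by
  by_cases h : -c ≤ s
  · rw [intervalIntegral.integral_of_le h, setIntegral_eq_integral_of_forall_compl_eq_zero, h1]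
    intro x hx
    refine hr x ?_
    rw [mem_Ioc, not_and_or, not_lt, not_le] at hx
    rw [le_abs]
    rcases hx with hx | hx
    · right; linarith
    · left; linarith
  · have hk0 : ∀ x, k x = 0 := fun x => hr x (by linarith [abs_nonneg x])
    simp [hk0] at h1

theorem contDiff_primitive (hk : ContDiff ℝ ∞ k) : ContDiff ℝ ∞ fun s => ∫ x in (-c)..s, k x := by
  have hd : ∀ s, HasDerivAt (fun s => ∫ x in (-c)..s, k x) (k s) s := fun s =>
    (hk.continuous.integral_hasStrictDerivAt _ s).hasDerivAt
  rw [contDiff_infty_iff_deriv]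
  refine ⟨fun s => (hd s).differentiableAt, ?_⟩
  rwa [show deriv (fun s => ∫ x in (-c)..s, k x) = k from funext fun s => (hd s).deriv]

theorem primitive_mem_Icc (hk0 : ∀ x, 0 ≤ k x) (hki : Integrable k)
    (hr : ∀ x, r ≤ |x| → k x = 0) (hrc : r < c) (h1 : ∫ x, k x = 1) (s : ℝ) :
    ∫ x in (-c)..s, k x ∈ Icc (0 : ℝ) 1 := by
  rcases le_total (-c) s with h | h
  · rw [intervalIntegral.integral_of_le h]
    exact ⟨integral_nonneg hk0, (setIntegral_le_integral hki (ae_of_all _ hk0)).trans_eq h1⟩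
  · rw [integral_eq_zero_of_le hr hrc (by linarith)]
    simp

end Primitive

/-- A function on an interval whose weak derivative is `-g` differs from a primitive of `-g` by a
constant, away from a null set. -/
theorem exists_null_increment {T : ℝ} {f g : ℝ → ℝ} (hf : IntegrableOn f (Ioo 0 T))
    (hg : IntegrableOn g (Ioo 0 T))
    (hw : ∀ η : ℝ → ℝ, IsTestFunction (Ioo 0 T) η →
      ∫ t in Ioo 0 T, (-f t * deriv η t + g t * η t) = 0) :
    ∃ N : Set ℝ, volume N = 0 ∧ ∀ t₁ t₂, t₁ ∉ N → t₂ ∉ N → 0 < t₁ → t₁ < t₂ → t₂ < T →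
      f t₂ - f t₁ = - ∫ t in Ioc t₁ t₂, g t := by
  let r : ℕ → ℝ := fun i => 1 / ((i : ℝ) + 1)
  have hr0 : ∀ i, 0 < r i := fun i => by positivity
  have hr1 : ∀ i, r i < 2 := fun i => by
    have : r i ≤ 1 := by
      simp only [r]; rw [div_le_one (by positivity)]; linarith [(Nat.cast_nonneg i : (0 : ℝ) ≤ i)]
    linarith
  have hrt : Tendsto r atTop (𝓝 0) := tendsto_one_div_add_atTop_nhds_zero_nat
  let B : ℕ → ContDiffBump (0 : ℝ) := fun i => ⟨r i / 2, r i, by linarith [hr0 i], by linarith [hr0 i]⟩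
  let κ : ℕ → ℝ → ℝ := fun i => (B i).normed volume
  have hκs : ∀ i, ContDiff ℝ ∞ (κ i) := fun i => (B i).contDiff_normed
  have hκ0 : ∀ i x, 0 ≤ κ i x := fun i => (B i).nonneg_normed
  have hκi : ∀ i, Integrable (κ i) := fun i => (B i).integrable_normed
  have hκ1 : ∀ i, ∫ x, κ i x = 1 := fun i => (B i).integral_normed
  have hκr : ∀ i x, r i ≤ |x| → κ i x = 0 := fun i x hx => by
    by_contra h
    have h2 : x ∈ Function.support (κ i) := h
    rw [(B i).support_normed_eq, mem_ball_zero_iff, Real.norm_eq_abs] at h2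
    exact absurd hx (not_le.2 h2)
  let F : ℝ → ℝ := (Ioo 0 T).indicator f
  have hF : Integrable F := (integrable_indicator_iff measurableSet_Ioo).2 hf
  have hconv := ContDiffBump.ae_convolution_tendsto_right_of_locallyIntegrable (μ := volume)
    (φ := B) (l := atTop) (K := 2) hrt (Eventually.of_forall fun i => by simp [B]; linarith)
    hF.locallyIntegrable
  -- The exceptional set consists of the times at which the mollifications of `f` fail to converge
  -- to its value. It depends on `f` but not on the pair of endpoints.
  refine ⟨_, ae_iff.1 hconv, fun t₁ t₂ h₁ h₂ h0 h12 hT => ?_⟩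
  simp only [mem_ofPred_eq, not_not] at h₁ h₂
  -- The radii `r i` are at most `1`, so the base point `-2` lies to the left of every kernel's
  -- support and `Θ i` is a smoothed Heaviside function.
  let Θ : ℕ → ℝ → ℝ := fun i s => ∫ x in (-2 : ℝ)..s, κ i x
  have hΘs : ∀ i, ContDiff ℝ ∞ (Θ i) := fun i => contDiff_primitive (hκs i)
  have hΘd : ∀ i s, HasDerivAt (Θ i) (κ i s) s := fun i s =>
    ((hκs i).continuous.integral_hasStrictDerivAt _ s).hasDerivAt
  have hΘ0 : ∀ i s, s ≤ - r i → Θ i s = 0 := fun i s => integral_eq_zero_of_le (hκr i) (hr1 i)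
  have hΘ1 : ∀ i s, r i ≤ s → Θ i s = 1 := fun i s =>
    integral_eq_one_of_ge (hκr i) (hr1 i) (hκ1 i)
  have hΘI : ∀ i s, Θ i s ∈ Icc (0 : ℝ) 1 := fun i s =>
    primitive_mem_Icc (hκ0 i) (hκi i) (hκr i) (hr1 i) (hκ1 i) s
  -- These approximate the indicator of `(t₁, t₂]`. Their derivatives are kernels centred at `t₁`
  -- and `t₂`, so testing produces mollified values of `f` at the two endpoints.
  let η : ℕ → ℝ → ℝ := fun i t => Θ i (t - t₁) - Θ i (t - t₂)
  have hηd : ∀ i t, deriv (η i) t = κ i (t - t₁) - κ i (t - t₂) := fun i t =>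
    (((hΘd i (t - t₁)).comp_sub_const t t₁).sub ((hΘd i (t - t₂)).comp_sub_const t t₂)).deriv
  have hηs : ∀ i, ContDiff ℝ ∞ (η i) := fun i =>
    ((hΘs i).comp (contDiff_id.sub contDiff_const)).sub
      ((hΘs i).comp (contDiff_id.sub contDiff_const))
  have hsupp : ∀ i, Function.support (η i) ⊆ Icc (t₁ - r i) (t₂ + r i) := by
    intro i t ht
    by_contra h
    rw [mem_Icc, not_and_or, not_le, not_le] at h
    refine ht ?_
    rcases h with h | h
    · simp only [η]; rw [hΘ0 i _ (by linarith), hΘ0 i _ (by linarith), sub_zero]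
    · simp only [η]; rw [hΘ1 i _ (by linarith), hΘ1 i _ (by linarith), sub_self]
  have htest : ∀ᶠ i in atTop, IsTestFunction (Ioo 0 T) (η i) := by
    filter_upwards [hrt.eventually (gt_mem_nhds h0),
      hrt.eventually (gt_mem_nhds (sub_pos.2 hT))] with i hi1 hi2
    refine ⟨hηs i, HasCompactSupport.of_support_subset_isCompact isCompact_Icc (hsupp i),
      (closure_minimal (hsupp i) isClosed_Icc).trans fun t ht => ⟨?_, ?_⟩⟩
    · linarith [ht.1]
    · linarith [ht.2]
  have hcv : ∀ i t₀, ∫ t in Ioo 0 T, f t * κ i (t - t₀)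
      = convolution (κ i) F (ContinuousLinearMap.lsmul ℝ ℝ) volume t₀ := by
    intro i t₀
    rw [convolution_lsmul_swap, ← integral_indicator measurableSet_Ioo]
    refine integral_congr_ae (ae_of_all _ fun t => ?_)
    have h3 : κ i (t - t₀) = κ i (t₀ - t) := by
      rw [← neg_sub]; exact (B i).normed_neg _
    beta_reduce
    by_cases ht : t ∈ Ioo 0 T
    · rw [indicator_of_mem ht, h3, show F t = f t from indicator_of_mem ht f]
      exact mul_comm _ _
    · rw [indicator_of_notMem ht, show F t = 0 from indicator_of_notMem ht f, smul_zero]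
  have hbd : ∀ i t₀, Integrable (fun t => f t * κ i (t - t₀)) (volume.restrict (Ioo 0 T)) := by
    intro i t₀
    obtain ⟨C, hC⟩ := (B i).hasCompactSupport_normed.exists_bound_of_continuous
      (hκs i).continuous
    exact hf.mul_bdd (c := C) ((hκs i).continuous.comp
      (continuous_id.sub continuous_const)).aestronglyMeasurable (ae_of_all _ fun t => hC _)
  have hηb : ∀ i t, ‖η i t‖ ≤ 1 := fun i t => by
    have h1 := hΘI i (t - t₁); have h2 := hΘI i (t - t₂)
    rw [Real.norm_eq_abs, abs_le]
    exact ⟨by simp only [η]; linarith [h1.1, h2.2], by simp only [η]; linarith [h1.2, h2.1]⟩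
  have hgη : ∀ i, Integrable (fun t => g t * η i t) (volume.restrict (Ioo 0 T)) := fun i =>
    hg.mul_bdd (c := 1) (hηs i).continuous.aestronglyMeasurable (ae_of_all _ fun t => hηb i t)
  have heq : ∀ᶠ i in atTop, convolution (κ i) F (ContinuousLinearMap.lsmul ℝ ℝ) volume t₂
      - convolution (κ i) F (ContinuousLinearMap.lsmul ℝ ℝ) volume t₁
      = - ∫ t in Ioo 0 T, g t * η i t := by
    filter_upwards [htest] with i hi
    have h := hw (η i) hi
    rw [← hcv, ← hcv]
    have h4 : ∀ t, -f t * deriv (η i) t + g t * η i t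
        = (f t * κ i (t - t₂) - f t * κ i (t - t₁)) + g t * η i t := fun t => by
      rw [hηd]; ring
    simp_rw [h4] at h
    have hs : Integrable (fun t => f t * κ i (t - t₂) - f t * κ i (t - t₁))
      (volume.restrict (Ioo 0 T)) := (hbd i t₂).sub (hbd i t₁)
    rw [integral_add hs (hgη i), integral_sub (hbd i t₂) (hbd i t₁)] at h
    linarith
  have hlim1 := h₂.sub h₁
  have hlim2 : Tendsto (fun i => ∫ t in Ioo 0 T, g t * η i t) atTop
      (𝓝 (∫ t in Ioo 0 T, (Ioc t₁ t₂).indicator g t)) := by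
    refine tendsto_integral_of_dominated_convergence (fun t => ‖g t‖)
      (fun i => (hgη i).aestronglyMeasurable) hg.norm
      (fun i => ae_of_all _ fun t => ?_) ?_
    · rw [norm_mul]
      exact mul_le_of_le_one_right (norm_nonneg _) (hηb i t)
    · have hne : ∀ᵐ t ∂(volume.restrict (Ioo 0 T)), t ≠ t₁ ∧ t ≠ t₂ := by
        refine ae_restrict_of_ae ?_
        exact (Measure.ae_ne volume t₁).and (Measure.ae_ne volume t₂)
      filter_upwards [hne] with t ht
      have hev : ∀ t₀ : ℝ, t ≠ t₀ → ∀ᶠ i in atTop, Θ i (t - t₀) = if t₀ < t then 1 else 0 := by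
        intro t₀ ht₀
        filter_upwards [hrt.eventually (gt_mem_nhds (abs_pos.2 (sub_ne_zero.2 ht₀)))] with i hi
        split_ifs with h
        · exact hΘ1 i _ (by rw [abs_of_pos (sub_pos.2 h)] at hi; exact hi.le)
        · exact hΘ0 i _ (by
            rw [abs_of_nonpos (sub_nonpos.2 (not_lt.1 h))] at hi; linarith)
      refine tendsto_const_nhds.congr' ?_
      filter_upwards [hev t₁ ht.1, hev t₂ ht.2] with i hi1 hi2
      simp only [η, hi1, hi2, indicator_apply, mem_Ioc]
      rcases lt_trichotomy t₂ t with h | h | h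
      · simp [h, h12.trans h, not_le.2 h]
      · exact absurd h.symm ht.2
      · by_cases h' : t₁ < t <;> simp [h', h.le, not_lt.2 h.le]
  have hI : ∫ t in Ioo 0 T, (Ioc t₁ t₂).indicator g t = ∫ t in Ioc t₁ t₂, g t := by
    rw [integral_indicator measurableSet_Ioc, Measure.restrict_restrict measurableSet_Ioc,
      inter_eq_left.2]
    exact fun t ht => ⟨h0.trans ht.1, ht.2.trans_lt hT⟩
  have := tendsto_nhds_unique (hlim1.congr' heq) hlim2.neg
  rw [hI] at this
  rw [← this]
  simp [F, h0, hT, h12.trans hT, h0.trans h12]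

end Trudinger

/-! ### The weak equation in increment form -/

namespace Trudinger
variable {n : ℕ} {p q T : ℝ} {Ω : Set (Space n)}

theorem IsTestFunction.exists_bound {φ : Space n → ℝ} (hφ : IsTestFunction Ω φ) :
    ∃ C, (∀ x, ‖φ x‖ ≤ C) ∧ ∀ x, ‖gradient φ x‖ ≤ C := by
  obtain ⟨C, hC⟩ := hφ.2.1.exists_bound_of_continuous hφ.1.continuous
  obtain ⟨D, hD⟩ := (hφ.2.1.mono' ((subset_tsupport _).trans
    (tsupport_gradient_subset φ))).exists_bound_of_continuous
      (continuous_gradient (hφ.1.of_le (by simp)))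
  exact ⟨max C D, fun x => (hC x).trans (le_max_left _ _), fun x => (hD x).trans (le_max_right _ _)⟩

theorem integrable_smul_gradient [IsFiniteMeasure (volume.restrict Ω)] (hp : 1 ≤ p)
    {v φ : Space n → ℝ} (hv : MemLp v (ENNReal.ofReal p) (volume.restrict Ω))
    (hφ : IsTestFunction Ω φ) : Integrable (fun x => v x • gradient φ x) (volume.restrict Ω) := by
  obtain ⟨C, -, hC⟩ := hφ.exists_bound
  exact (hv.integrable (by simpa using hp)).smul_bdd C
    (hφ.gradient_aestronglyMeasurable _) (ae_of_all _ hC)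

theorem integrable_testFunction_smul [IsFiniteMeasure (volume.restrict Ω)] (hp : 1 ≤ p)
    {G : Space n → Space n} {φ : Space n → ℝ}
    (hG : MemLp G (ENNReal.ofReal p) (volume.restrict Ω))
    (hφ : IsTestFunction Ω φ) : Integrable (fun x => φ x • G x) (volume.restrict Ω) := by
  obtain ⟨C, hC, -⟩ := hφ.exists_bound
  exact (hG.integrable (by simpa using hp)).bdd_smul C
    hφ.1.continuous.aestronglyMeasurable (ae_of_all _ hC)

/-- Weak gradients are unique: the difference of the two candidates annihilates all test functions.
This reconciles the gradient in the equation with the one supplied by the boundary condition. -/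
theorem HasW1pGradient.ae_eq_add [IsFiniteMeasure (volume.restrict Ω)] (hp : 1 ≤ p)
    (hΩ : IsOpen Ω) {u ψ : Space n → ℝ} {G G₀ K : Space n → Space n}
    (hu : HasW1pGradient p Ω u G) (hd : HasW1pGradient p Ω (fun x => u x - ψ x) G₀)
    (hψ : HasW1pGradient p Ω ψ K) : G =ᵐ[volume.restrict Ω] fun x => G₀ x + K x := by
  have hpE : (1 : ENNReal) ≤ ENNReal.ofReal p := by simpa using hp
  have hint : IntegrableOn (fun x => G x - (G₀ x + K x)) Ω :=
    (hu.2.1.integrable hpE).sub ((hd.2.1.integrable hpE).add (hψ.2.1.integrable hpE))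
  have h := hΩ.ae_eq_zero_of_integral_contDiff_smul_eq_zero hint.locallyIntegrableOn
    fun φ h1 h2 h3 => by
      have hφ : IsTestFunction Ω φ := ⟨h1, h2, h3⟩
      rw [← setIntegral_eq_integral_of_forall_compl_eq_zero (s := Ω) (fun x hx => by
        rw [image_eq_zero_of_notMem_tsupport (fun h => hx (h3 h)), zero_smul])]
      simp_rw [smul_sub, smul_add]
      have i1 := integrable_testFunction_smul hp hu.2.1 hφ
      have i2 := integrable_testFunction_smul hp hd.2.1 hφ
      have i3 := integrable_testFunction_smul hp hψ.2.1 hφ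
      have i23 : Integrable (fun x => φ x • G₀ x + φ x • K x) (volume.restrict Ω) := i2.add i3
      rw [integral_sub i1 i23, integral_add i2 i3, ← neg_eq_iff_eq_neg.2 (hu.2.2 φ hφ),
        ← neg_eq_iff_eq_neg.2 (hd.2.2 φ hφ), ← neg_eq_iff_eq_neg.2 (hψ.2.2 φ hφ)]
      simp_rw [sub_smul]
      rw [integral_sub (integrable_smul_gradient hp hu.1 hφ) (integrable_smul_gradient hp hψ.1 hφ)]
      abel
  filter_upwards [ae_restrict_of_ae h, ae_restrict_mem hΩ.measurableSet] with x hx hxΩ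
  exact sub_eq_zero.1 (hx hxΩ)

/-- A representative of a weak solution, with its gradient, for which the equation holds in
increment form at all times outside a null set. -/
structure IsIncrementSolution (p : ℝ) (Ω : Set (Space n)) (T : ℝ) (ψ u : Space n × ℝ → ℝ)
    (G : Space n × ℝ → Space n) : Prop where
  measurable : Measurable u
  measurable_grad : Measurable G
  memLp : MemLp u (ENNReal.ofReal p) volume
  memLp_grad : MemLp G (ENNReal.ofReal p) volume
  eq_zero : ∀ z ∉ cylinder Ω T, u z = 0
  boundary : ∀ᵐ t ∂(volume.restrict (Ioo 0 T)), ∃ v G₀ K, SobolevZero p Ω v G₀ ∧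
    HasW1pGradient p Ω (fun x => ψ (x, t)) K ∧
    (fun x => u (x, t)) =ᵐ[volume.restrict Ω] (fun x => v x + ψ (x, t)) ∧
    (fun x => G (x, t)) =ᵐ[volume.restrict Ω] (fun x => G₀ x + K x)
  increment : ∃ N : Set ℝ, volume N = 0 ∧ ∀ t₁ t₂, t₁ ∉ N → t₂ ∉ N → 0 < t₁ → t₁ < t₂ → t₂ < T →
    ∀ v K, SobolevZero p Ω v K →
      ∫ x in Ω, (b p (u (x, t₂)) - b p (u (x, t₁))) * v x
        = - ∫ t in Ioc t₁ t₂, ∫ x in Ω, inner ℝ (flux p (G (x, t))) (K x)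

theorem volume_restrict_cylinder : (volume : Measure (Space n × ℝ)).restrict (cylinder Ω T)
    = (volume.restrict Ω).prod (volume.restrict (Ioo 0 T)) := by
  rw [cylinder, Measure.volume_eq_prod, Measure.prod_restrict]

theorem isTestFunction_mul {φ : Space n → ℝ} {η : ℝ → ℝ} (hφ : IsTestFunction Ω φ)
    (hη : IsTestFunction (Ioo 0 T) η) :
    IsTestFunction (cylinder Ω T) fun z : Space n × ℝ => φ z.1 * η z.2 := by
  have hsub : Function.support (fun z : Space n × ℝ => φ z.1 * η z.2) ⊆ tsupport φ ×ˢ tsupport η :=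
    fun z hz => ⟨subset_tsupport _ (left_ne_zero_of_mul hz),
      subset_tsupport _ (right_ne_zero_of_mul hz)⟩
  refine ⟨(hφ.1.comp contDiff_fst).mul (hη.1.comp contDiff_snd),
    HasCompactSupport.of_support_subset_isCompact (hφ.2.1.isCompact.prod hη.2.1.isCompact) hsub,
    (closure_minimal hsub ((isClosed_tsupport φ).prod (isClosed_tsupport η))).trans
      (prod_mono hφ.2.2 hη.2.2)⟩

section
variable {α β E : Type*} [MeasurableSpace α] [MeasurableSpace β] {ν : Measure α} {ρ : Measure β}
  [IsFiniteMeasure ρ] [NormedAddCommGroup E] [InnerProductSpace ℝ E]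

theorem integrable_inner_fst (hpq : p.HolderConjugate q) {A : α × β → E} {K : α → E}
    (hA : MemLp A (ENNReal.ofReal q) (ν.prod ρ)) (hK : MemLp K (ENNReal.ofReal p) ν) :
    Integrable (fun z => inner ℝ (A z) (K z.1)) (ν.prod ρ) :=
  integrable_inner_of_holder hpq hA (hK.comp_fst ρ)

variable [SFinite ν]

/-- A function of space alone gains only the factor `ρ(univ)^(1/p)` in norm when viewed on the
finite cylinder, so spatial convergence passes to the time-integrated pairing with the flux. -/
theorem tendsto_integral_inner_fst (hpq : p.HolderConjugate q) {A : α × β → E} {K : α → E}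
    {K' : ℕ → α → E} (hA : MemLp A (ENNReal.ofReal q) (ν.prod ρ))
    (hK : MemLp K (ENNReal.ofReal p) ν) (hK' : ∀ k, MemLp (K' k) (ENNReal.ofReal p) ν)
    (ht : Tendsto (fun k => eLpNorm (fun x => K x - K' k x) (ENNReal.ofReal p) ν) atTop (𝓝 0)) :
    Tendsto (fun k => ∫ t, ∫ x, inner ℝ (A (x, t)) (K' k x) ∂ν ∂ρ) atTop
      (𝓝 (∫ t, ∫ x, inner ℝ (A (x, t)) (K x) ∂ν ∂ρ)) := by
  have h := tendsto_integral_inner hpq hA (hK.comp_fst ρ) (fun k => (hK' k).comp_fst ρ)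
    (by
      have h0 := ENNReal.Tendsto.const_mul (a := ρ univ ^ (1 / p)) ht
        (Or.inr (ENNReal.rpow_ne_top_of_nonneg (by have := hpq.pos; positivity)
          (measure_ne_top _ _)))
      rw [mul_zero] at h0
      refine h0.congr fun k => (eLpNorm_comp_fst hpq.pos (hK.1.sub (hK' k).1)).symm)
  rw [integral_prod_symm _ (integrable_inner_fst hpq hA hK)] at h
  refine h.congr fun k => ?_
  rw [integral_prod_symm _ (integrable_inner_fst hpq hA (hK' k))]

end

/-- Products `φ(x) η(t)` of test functions reduce the equation to a one-dimensional weak derivative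
for each fixed `φ`. Doing so along a dense sequence costs one null set, and both sides are
continuous in the Sobolev test function by Hölder, which covers all of them. -/
theorem exists_null_increment_of_weak_eq (hpq : p.HolderConjugate q)
    (hΩb : Bornology.IsBounded Ω)
    {β : Space n × ℝ → ℝ} {A : Space n × ℝ → Space n}
    (hβ : MemLp β (ENNReal.ofReal q) (volume.restrict (cylinder Ω T)))
    (hA : MemLp A (ENNReal.ofReal q) (volume.restrict (cylinder Ω T)))
    (hβt : ∀ᵐ t ∂(volume.restrict (Ioo 0 T)),
      MemLp (fun x => β (x, t)) (ENNReal.ofReal q) (volume.restrict Ω))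
    (hw : ∀ γ : Space n × ℝ → ℝ, IsTestFunction (cylinder Ω T) γ →
      ∫ z in cylinder Ω T, (-(β z) * deriv (fun s => γ (z.1, s)) z.2
          + inner ℝ (A z) (gradient (fun y => γ (y, z.2)) z.1)) = 0) :
    ∃ N : Set ℝ, volume N = 0 ∧ ∀ t₁ t₂, t₁ ∉ N → t₂ ∉ N → 0 < t₁ → t₁ < t₂ → t₂ < T →
      ∀ v K, SobolevZero p Ω v K → ∫ x in Ω, (β (x, t₂) - β (x, t₁)) * v x
        = - ∫ t in Ioc t₁ t₂, ∫ x in Ω, inner ℝ (A (x, t)) (K x) := by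
  have hfin : IsFiniteMeasure (volume.restrict Ω) := ⟨by
    rw [Measure.restrict_apply_univ]; exact hΩb.measure_lt_top⟩
  rw [volume_restrict_cylinder] at hβ hA hw
  obtain ⟨φ, hφ, hdense⟩ := exists_dense_seq_testFunction hpq.lt.le Ω
  have key : ∀ k, ∃ N : Set ℝ, volume N = 0 ∧ ∀ t₁ t₂, t₁ ∉ N → t₂ ∉ N → 0 < t₁ → t₁ < t₂ →
      t₂ < T → (∫ x in Ω, inner ℝ (β (x, t₂)) (φ k x)) - ∫ x in Ω, inner ℝ (β (x, t₁)) (φ k x)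
        = - ∫ t in Ioc t₁ t₂, ∫ x in Ω, inner ℝ (A (x, t)) (gradient (φ k) x) := by
    intro k
    have i1 := integrable_inner_fst hpq hβ (hφ k).sobolevZero.1
    have i2 := integrable_inner_fst hpq hA (hφ k).sobolevZero.2.1
    refine exists_null_increment i1.integral_prod_right i2.integral_prod_right fun η hη => ?_
    have h := hw _ (isTestFunction_mul (hφ k) hη)
    obtain ⟨C, hC⟩ := hη.2.1.exists_bound_of_continuous hη.1.continuous
    have hη1 : ContDiff ℝ 1 η := hη.1.of_le (by simp)
    obtain ⟨D, hD⟩ := hη.2.1.deriv.exists_bound_of_continuous (hη1.continuous_deriv le_rfl)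
    have j1 : Integrable (fun z : Space n × ℝ => inner ℝ (β z) (φ k z.1) * deriv η z.2)
        ((volume.restrict Ω).prod (volume.restrict (Ioo 0 T))) :=
      i1.mul_bdd (c := D) ((hη1.continuous_deriv le_rfl).comp continuous_snd).aestronglyMeasurable
        (ae_of_all _ fun z => hD _)
    have j2 : Integrable (fun z : Space n × ℝ => inner ℝ (A z) (gradient (φ k) z.1) * η z.2)
        ((volume.restrict Ω).prod (volume.restrict (Ioo 0 T))) :=
      i2.mul_bdd (c := C) (hη1.continuous.comp continuous_snd).aestronglyMeasurable
        (ae_of_all _ fun z => hC _)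
    have e : ∀ z : Space n × ℝ, -(β z) * deriv (fun s => φ k z.1 * η s) z.2
          + inner ℝ (A z) (gradient (fun y => φ k y * η z.2) z.1)
        = -(inner ℝ (β z) (φ k z.1) * deriv η z.2)
          + inner ℝ (A z) (gradient (φ k) z.1) * η z.2 := by
      intro z
      have hg : gradient (fun y => φ k y * η z.2) z.1 = η z.2 • gradient (φ k) z.1 := by
        rw [gradient_mul ((hφ k).1.differentiable (by simp) _) (differentiableAt_const _)]
        simp
      have hd : deriv (fun s => φ k z.1 * η s) z.2 = φ k z.1 * deriv η z.2 :=
        deriv_const_mul _ (hη1.differentiable one_ne_zero _)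
      rw [hg, hd, inner_smul_right]
      simp; ring
    simp only [e] at h
    have hpt : ∀ t, -(∫ x in Ω, inner ℝ (β (x, t)) (φ k x)) * deriv η t
        + (∫ x in Ω, inner ℝ (A (x, t)) (gradient (φ k) x)) * η t
        = -(∫ x in Ω, inner ℝ (β (x, t)) (φ k x) * deriv η t)
          + ∫ x in Ω, inner ℝ (A (x, t)) (gradient (φ k) x) * η t := fun t => by
      rw [integral_mul_const, integral_mul_const]; ring
    simp_rw [hpt]
    have j1n : Integrable (fun z : Space n × ℝ => -(inner ℝ (β z) (φ k z.1) * deriv η z.2))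
        ((volume.restrict Ω).prod (volume.restrict (Ioo 0 T))) := j1.neg
    rw [integral_add j1n j2, integral_neg, integral_prod_symm _ j1, integral_prod_symm _ j2] at h
    have r1 : Integrable (fun t => -(∫ x in Ω, inner ℝ (β (x, t)) (φ k x) * deriv η t))
      (volume.restrict (Ioo 0 T)) := j1.integral_prod_right.neg
    rw [integral_add r1 j2.integral_prod_right, integral_neg]
    exact h
  choose N hN0 hN using key
  rw [ae_restrict_iff' measurableSet_Ioo] at hβt
  -- Times whose slice of `β` is not in `L^q` are discarded as well; otherwise the left side would
  -- not be continuous in `v`.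
  refine ⟨(⋃ k, N k) ∪ _, measure_union_null (measure_iUnion_null hN0) (ae_iff.1 hβt),
    fun t₁ t₂ h₁ h₂ h0 h12 hT v K hv => ?_⟩
  rw [mem_union, not_or, mem_iUnion, not_exists] at h₁ h₂
  have m1 : MemLp (fun x => β (x, t₁)) (ENNReal.ofReal q) (volume.restrict Ω) := by
    have := h₁.2
    rw [mem_ofPred_eq, not_not] at this
    exact this ⟨h0, h12.trans hT⟩
  have m2 : MemLp (fun x => β (x, t₂)) (ENNReal.ofReal q) (volume.restrict Ω) := by
    have := h₂.2
    rw [mem_ofPred_eq, not_not] at this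
    exact this ⟨h0.trans h12, hT⟩
  have hpos : ∀ k : ℕ, (0 : ENNReal) < (k : ENNReal)⁻¹ := fun k => by simp
  choose j hj1 hj2 using fun k : ℕ => hdense v K hv _ (hpos k)
  have t1 : Tendsto (fun k => eLpNorm (fun x => v x - φ (j k) x) (ENNReal.ofReal p)
      (volume.restrict Ω)) atTop (𝓝 0) :=
    tendsto_of_tendsto_of_tendsto_of_le_of_le tendsto_const_nhds
      ENNReal.tendsto_inv_nat_nhds_zero (fun _ => zero_le) fun k => (hj1 k).le
  have t2 : Tendsto (fun k => eLpNorm (fun x => K x - gradient (φ (j k)) x) (ENNReal.ofReal p)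
      (volume.restrict Ω)) atTop (𝓝 0) :=
    tendsto_of_tendsto_of_tendsto_of_le_of_le tendsto_const_nhds
      ENNReal.tendsto_inv_nat_nhds_zero (fun _ => zero_le) fun k => (hj2 k).le
  have hA' : MemLp A (ENNReal.ofReal q) ((volume.restrict Ω).prod (volume.restrict (Ioc t₁ t₂))) :=
    by
    have hsub : Ioc t₁ t₂ ⊆ Ioo 0 T := fun t ht => ⟨h0.trans ht.1, ht.2.trans_lt hT⟩
    exact hA.mono_measure (Measure.prod_mono le_rfl (Measure.restrict_mono hsub le_rfl))
  have L1 := tendsto_integral_inner hpq m1 hv.1 (fun k => (hφ (j k)).sobolevZero.1) t1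
  have L2 := tendsto_integral_inner hpq m2 hv.1 (fun k => (hφ (j k)).sobolevZero.1) t1
  have L3 := tendsto_integral_inner_fst hpq hA' hv.2.1
    (fun k => (hφ (j k)).sobolevZero.2.1) t2
  have h := tendsto_nhds_unique (L2.sub L1) (L3.neg.congr fun k =>
    (hN (j k) t₁ t₂ (h₁.1 _) (h₂.1 _) h0 h12 hT).symm)
  rw [← h, ← integral_sub (integrable_inner_of_holder hpq m2 hv.1)
    (integrable_inner_of_holder hpq m1 hv.1)]
  refine integral_congr_ae (ae_of_all _ fun x => ?_)
  simp; ring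

end Trudinger

/-! ### Measurable representatives of weak solutions -/

namespace Trudinger
variable {n : ℕ} {p q T : ℝ} {Ω : Set (Space n)}

theorem ae_ae_of_ae_prod_swap {α β : Type*} [MeasurableSpace α] [MeasurableSpace β]
    {ν : Measure α} {ρ : Measure β} [SFinite ν] [SFinite ρ] {P : α × β → Prop}
    (h : ∀ᵐ z ∂(ν.prod ρ), P z) : ∀ᵐ y ∂ρ, ∀ᵐ x ∂ν, P (x, y) := by
  rw [← Measure.prod_swap] at h
  exact Measure.ae_ae_of_ae_prod (ae_of_ae_map measurable_swap.aemeasurable h)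

theorem measurableSet_cylinder (hΩ : IsOpen Ω) : MeasurableSet (cylinder Ω T) :=
  hΩ.measurableSet.prod measurableSet_Ioo

/-- A measurable representative vanishing off the cylinder. -/
theorem exists_measurable_representative (hΩ : IsOpen Ω) {E : Type*} [NormedAddCommGroup E]
    [MeasurableSpace E] [BorelSpace E] {r : ENNReal} {u : Space n × ℝ → E}
    (hu : MemLp u r (volume.restrict (cylinder Ω T))) :
    ∃ u' : Space n × ℝ → E, Measurable u' ∧ MemLp u' r volume ∧ (∀ z ∉ cylinder Ω T, u' z = 0) ∧
      u =ᵐ[volume.restrict (cylinder Ω T)] u' := by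
  have hm := measurableSet_cylinder (T := T) hΩ
  refine ⟨(cylinder Ω T).indicator (hu.1.mk u), (hu.1.stronglyMeasurable_mk.indicator hm).measurable,
    (memLp_indicator_iff_restrict hm).2 (hu.ae_eq hu.1.ae_eq_mk),
    fun z hz => indicator_of_notMem hz _, ?_⟩
  exact hu.1.ae_eq_mk.trans (indicator_ae_eq_restrict hm).symm

/-- Global Borel representatives are needed because the later argument shifts time and evaluates
slices. The equation and the boundary condition survive, since changes on null sets of the cylinder
affect almost no time slice. -/
theorem IsWeakSolution.exists_incrementSolution (hp : 1 < p) (hΩ : IsOpen Ω)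
    (hΩb : Bornology.IsBounded Ω) {ψ u : Space n × ℝ → ℝ} (hψ : MemParabolic p Ω T ψ)
    (hu : IsWeakSolution p Ω T ψ u) :
    ∃ u' G', IsIncrementSolution p Ω T ψ u' G' ∧ u =ᵐ[volume.restrict (cylinder Ω T)] u' := by
  have hfin : IsFiniteMeasure (volume.restrict Ω) := ⟨by
    rw [Measure.restrict_apply_univ]; exact hΩb.measure_lt_top⟩
  obtain ⟨G, hG, hw⟩ := hu.weak_eq
  obtain ⟨Gψ, -, -, hGψ⟩ := hψ
  obtain ⟨Gb, -, hGb⟩ := hu.boundary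
  obtain ⟨u', hu'm, hu'L, hu'0, huu'⟩ := exists_measurable_representative hΩ hG.1
  obtain ⟨G', hG'm, hG'L, hG'0, hGG'⟩ := exists_measurable_representative hΩ hG.2.1
  have hus : ∀ᵐ t ∂(volume.restrict (Ioo 0 T)), ∀ᵐ x ∂(volume.restrict Ω), u (x, t) = u' (x, t) := by
    rw [volume_restrict_cylinder] at huu'; exact ae_ae_of_ae_prod_swap huu'
  have hGs : ∀ᵐ t ∂(volume.restrict (Ioo 0 T)), ∀ᵐ x ∂(volume.restrict Ω), G (x, t) = G' (x, t) := by
    rw [volume_restrict_cylinder] at hGG'; exact ae_ae_of_ae_prod_swap hGG'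
  have hpq : p.HolderConjugate p.conjExponent := Real.HolderConjugate.conjExponent hp
  refine ⟨u', G', ⟨hu'm, hG'm, hu'L, hG'L, hu'0, ?_, ?_⟩, huu'⟩
  · filter_upwards [hus, hGs, hG.2.2, hGψ, hGb] with t h1 h2 h3 h4 h5
    refine ⟨_, _, _, h5.sobolevZero, h4, ?_, ?_⟩
    · filter_upwards [h1] with x hx
      rw [← hx]; ring
    · have h6 : (fun x => G (x, t)) =ᵐ[volume.restrict Ω] fun x => G' (x, t) := h2
      exact h6.symm.trans (h3.ae_eq_add hp.le hΩ h5.1 h4)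
  · refine exists_null_increment_of_weak_eq (β := fun z => b p (u' z))
      (A := fun z => flux p (G' z)) hpq hΩb ?_ ?_ ?_ ?_
    · exact MemLp.norm_rpow_sub_one hpq (hu'L.restrict _)
        ((continuous_b hp).measurable.comp hu'm).aestronglyMeasurable fun z => abs_b hp _
    · exact MemLp.norm_rpow_sub_one hpq (hG'L.restrict _)
        (measurable_flux.comp hG'm).aestronglyMeasurable fun z => norm_flux hp _
    · filter_upwards [hus, hG.2.2] with t h1 h2
      exact MemLp.norm_rpow_sub_one hpq (h2.1.ae_eq h1)
        (((continuous_b hp).measurable.comp hu'm).comp (measurable_id.prodMk measurable_const)).aestronglyMeasurable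
          fun z => abs_b hp _
    · intro γ hγ
      rw [← hw γ hγ]
      refine integral_congr_ae ?_
      filter_upwards [huu', hGG'] with z h1 h2
      rw [h1, h2]; rfl

end Trudinger

/-! ### The smooth truncation and its two entropies -/

namespace Trudinger

/-- A smooth probability density supported in `[1, 2]`. -/
noncomputable def layerBump : ContDiffBump (3 / 2 : ℝ) := ⟨1 / 4, 1 / 2, by norm_num, by norm_num⟩

noncomputable def layerWeight : ℝ → ℝ := layerBump.normed volume

theorem contDiff_layerWeight : ContDiff ℝ ∞ layerWeight := layerBump.contDiff_normed

theorem layerWeight_nonneg (r : ℝ) : 0 ≤ layerWeight r := layerBump.nonneg_normed r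

theorem layerWeight_eq_zero {r : ℝ} (h : r ∉ Icc (1 : ℝ) 2) : layerWeight r = 0 := by
  by_contra h0
  have h2 : r ∈ Function.support layerWeight := h0
  rw [layerWeight, layerBump.support_normed_eq, Real.ball_eq_Ioo] at h2
  refine h (Ioo_subset_Icc_self ⟨?_, ?_⟩)
  · have := h2.1; norm_num [layerBump] at this; exact this
  · have := h2.2; norm_num [layerBump] at this; exact this

theorem exists_layerWeight_le : ∃ C, ∀ r, |layerWeight r| ≤ C :=
  layerBump.hasCompactSupport_normed.exists_bound_of_continuous contDiff_layerWeight.continuous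

theorem setIntegral_layerWeight : ∫ r in Icc (1 : ℝ) 2, layerWeight r = 1 := by
  rw [setIntegral_eq_integral_of_forall_compl_eq_zero fun r hr => layerWeight_eq_zero hr]
  exact layerBump.integral_normed

/-- The smooth step function with derivative `layerWeight`. -/
noncomputable def ramp (s : ℝ) : ℝ := ∫ x in (0 : ℝ)..s, layerWeight x

theorem hasDerivAt_ramp (s : ℝ) : HasDerivAt ramp (layerWeight s) s :=
  (contDiff_layerWeight.continuous.integral_hasStrictDerivAt _ s).hasDerivAt

theorem contDiff_ramp : ContDiff ℝ ∞ ramp := by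
  rw [contDiff_infty_iff_deriv]
  refine ⟨fun s => (hasDerivAt_ramp s).differentiableAt, ?_⟩
  rw [show deriv ramp = layerWeight from funext fun s => (hasDerivAt_ramp s).deriv]
  exact contDiff_layerWeight

/-- The truncation is an average of sharp Heaviside functions with the same weight as the entropies,
so inequalities between them can be checked for each level `r` separately. -/
theorem ramp_eq (s : ℝ) :
    ramp s = ∫ r in Icc (1 : ℝ) 2, layerWeight r * (Iic s).indicator (fun _ => 1) r := by
  rw [setIntegral_eq_integral_of_forall_compl_eq_zero
    (fun r hr => by rw [layerWeight_eq_zero hr, zero_mul])]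
  have h1 : ∀ r, layerWeight r * (Iic s).indicator (fun _ => 1) r
      = (Iic s).indicator layerWeight r := fun r => by
    by_cases h : r ∈ Iic s
    · rw [indicator_of_mem h, indicator_of_mem h, mul_one]
    · rw [indicator_of_notMem h, indicator_of_notMem h, mul_zero]
  simp_rw [h1]
  rw [integral_indicator measurableSet_Iic, ramp]
  rcases le_total 0 s with hs | hs
  · rw [intervalIntegral.integral_of_le hs]
    have hsub : Ioc 0 s ⊆ Iic s := fun x hx => hx.2
    refine (setIntegral_eq_of_subset_of_forall_sdiff_eq_zero measurableSet_Iic hsub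
      fun x hx => layerWeight_eq_zero fun h => ?_).symm
    exact hx.2 ⟨by linarith [h.1], hx.1⟩
  · rw [intervalIntegral.integral_zero_ae, setIntegral_eq_zero_of_forall_eq_zero]
    · intro x hx
      exact layerWeight_eq_zero fun h => by linarith [h.1, mem_Iic.1 hx]
    · refine ae_of_all _ fun x hx => layerWeight_eq_zero fun h => ?_
      rw [uIoc_of_ge hs] at hx
      linarith [h.1, hx.2]

theorem ramp_eq_zero {s : ℝ} (hs : s ≤ 1) : ramp s = 0 := by
  rw [ramp_eq]
  refine integral_eq_zero_of_ae ?_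
  -- When `s = 1` the indicator and the interval still meet in the single point `r = 1`, which is
  -- null.
  have hne : ∀ᵐ r ∂(volume.restrict (Icc (1 : ℝ) 2)), r ≠ 1 :=
    ae_restrict_of_ae (Measure.ae_ne volume 1)
  filter_upwards [hne, ae_restrict_mem measurableSet_Icc] with r h1 hr
  have : r ∉ Iic s := fun h => h1 (le_antisymm ((mem_Iic.1 h).trans hs) hr.1)
  simp [indicator_of_notMem this]

theorem ramp_mem_Icc (s : ℝ) : ramp s ∈ Icc (0 : ℝ) 1 := by
  rw [ramp_eq]
  have hint : IntegrableOn layerWeight (Icc (1 : ℝ) 2) :=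
    contDiff_layerWeight.continuous.integrableOn_Icc
  constructor
  · refine integral_nonneg fun r => mul_nonneg (layerWeight_nonneg r) ?_
    exact indicator_nonneg (fun _ _ => zero_le_one) _
  · refine le_of_le_of_eq ?_ setIntegral_layerWeight
    refine integral_mono_of_nonneg (ae_of_all _ fun r => mul_nonneg (layerWeight_nonneg r)
      (indicator_nonneg (fun _ _ => zero_le_one) _)) hint (ae_of_all _ fun r => ?_)
    refine mul_le_of_le_one_right (layerWeight_nonneg r) ?_
    exact indicator_le_self' (fun _ _ => zero_le_one) r

variable {p : ℝ}

/-- Average over `r ∈ [1,2]` of `(b(a) - b(c + δ r))₊`. -/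
noncomputable def entropyLeft (p δ a c : ℝ) : ℝ :=
  ∫ r in Icc (1 : ℝ) 2, layerWeight r * max (b p a - b p (c + δ * r)) 0

/-- Average over `r ∈ [1,2]` of `(b(a - δ r) - b(c))₊`. -/
noncomputable def entropyRight (p δ a c : ℝ) : ℝ :=
  ∫ r in Icc (1 : ℝ) 2, layerWeight r * max (b p (a - δ * r) - b p c) 0

theorem continuous_entropyLeft (hp : 1 < p) :
    Continuous fun z : ℝ × ℝ × ℝ => entropyLeft p z.1 z.2.1 z.2.2 := by
  have hb := continuous_b hp
  have hw := contDiff_layerWeight.continuous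
  refine continuous_parametric_integral_of_continuous (f := fun (z : ℝ × ℝ × ℝ) r =>
    layerWeight r * max (b p z.2.1 - b p (z.2.2 + z.1 * r)) 0) ?_ isCompact_Icc
  unfold Function.uncurry
  fun_prop

theorem continuous_entropyRight (hp : 1 < p) :
    Continuous fun z : ℝ × ℝ × ℝ => entropyRight p z.1 z.2.1 z.2.2 := by
  have hb := continuous_b hp
  have hw := contDiff_layerWeight.continuous
  refine continuous_parametric_integral_of_continuous (f := fun (z : ℝ × ℝ × ℝ) r =>
    layerWeight r * max (b p (z.2.1 - z.1 * r) - b p z.2.2) 0) ?_ isCompact_Icc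
  unfold Function.uncurry
  fun_prop

theorem entropyLeft_zero (a c : ℝ) : entropyLeft p 0 a c = max (b p a - b p c) 0 := by
  simp only [entropyLeft, zero_mul, add_zero]
  rw [integral_mul_const, setIntegral_layerWeight, one_mul]

theorem entropyRight_zero (a c : ℝ) : entropyRight p 0 a c = max (b p a - b p c) 0 := by
  simp only [entropyRight, zero_mul, sub_zero]
  rw [integral_mul_const, setIntegral_layerWeight, one_mul]

theorem integrableOn_layerWeight_mul {f : ℝ → ℝ} (hf : Continuous f) :
    IntegrableOn (fun r => layerWeight r * f r) (Icc (1 : ℝ) 2) :=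
  (contDiff_layerWeight.continuous.mul hf).integrableOn_Icc

theorem setIntegral_layerWeight_mul_le {f : ℝ → ℝ} (hf0 : ∀ r, 0 ≤ f r) {C : ℝ}
    (hf : ∀ r ∈ Icc (1 : ℝ) 2, f r ≤ C) : |∫ r in Icc (1 : ℝ) 2, layerWeight r * f r| ≤ C := by
  rw [abs_of_nonneg (integral_nonneg fun r => mul_nonneg (layerWeight_nonneg r) (hf0 r))]
  calc _ ≤ ∫ r in Icc (1 : ℝ) 2, layerWeight r * C := by
        refine integral_mono_of_nonneg (ae_of_all _ fun r =>
          mul_nonneg (layerWeight_nonneg r) (hf0 r))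
          (integrableOn_layerWeight_mul continuous_const) ?_
        filter_upwards [ae_restrict_mem measurableSet_Icc] with r hr
        exact mul_le_mul_of_nonneg_left (hf r hr) (layerWeight_nonneg r)
    _ = C := by rw [integral_mul_const, setIntegral_layerWeight, one_mul]

/-- The bound is independent of `δ`, which provides the dominating function when `δ → 0`. -/
theorem abs_entropyLeft_le (hp : 1 < p) {δ : ℝ} (hδ : 0 ≤ δ) (a c : ℝ) :
    |entropyLeft p δ a c| ≤ |b p a| + |b p c| := by
  refine setIntegral_layerWeight_mul_le (fun r => le_max_right _ _) fun r hr => ?_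
  have h1 : b p c ≤ b p (c + δ * r) :=
    (strictMono_b hp).monotone (by nlinarith [hr.1])
  refine max_le ?_ (by positivity)
  linarith [le_abs_self (b p a), neg_abs_le (b p c)]

theorem abs_entropyRight_le (hp : 1 < p) {δ : ℝ} (hδ : 0 ≤ δ) (a c : ℝ) :
    |entropyRight p δ a c| ≤ |b p a| + |b p c| := by
  refine setIntegral_layerWeight_mul_le (fun r => le_max_right _ _) fun r hr => ?_
  have h1 : b p (a - δ * r) ≤ b p a :=
    (strictMono_b hp).monotone (by nlinarith [hr.1])
  refine max_le ?_ (by positivity)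
  linarith [le_abs_self (b p a), neg_abs_le (b p c)]

theorem integrableOn_layerWeight_mul_indicator (s : ℝ) :
    IntegrableOn (fun r => layerWeight r * (Iic s).indicator (fun _ => (1 : ℝ)) r)
      (Icc (1 : ℝ) 2) :=
  (contDiff_layerWeight.continuous.integrableOn_Icc).mul_bdd (c := 1)
    ((measurable_const.indicator measurableSet_Iic).aestronglyMeasurable)
    (ae_of_all _ fun r => by
      rw [Real.norm_of_nonneg (indicator_nonneg (fun _ _ => zero_le_one) _)]
      exact indicator_le_self' (fun _ _ => zero_le_one) r)

/-- For each `r` this is the subgradient inequality for the convex function `β ↦ (β - k)₊` with `k =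
b(c + δr)`, whose slope at `b(a)` is the indicator of `r ≤ (a - c)/δ` because `b` is increasing.
Averaging in `r` gives the ramp. -/
theorem entropyLeft_sub_le (hp : 1 < p) {δ : ℝ} (hδ : 0 < δ) (a a' c : ℝ) :
    entropyLeft p δ a c - entropyLeft p δ a' c ≤ (b p a - b p a') * ramp ((a - c) / δ) := by
  have hb := continuous_b hp
  have hi : ∀ a, IntegrableOn (fun r => layerWeight r * max (b p a - b p (c + δ * r)) 0)
      (Icc (1 : ℝ) 2) := fun a => integrableOn_layerWeight_mul (by fun_prop)
  rw [ramp_eq, entropyLeft, entropyLeft, ← integral_sub (hi a) (hi a'), ← integral_const_mul]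
  refine integral_mono ((hi a).sub (hi a'))
    ((integrableOn_layerWeight_mul_indicator _).const_mul _) fun r => ?_
  beta_reduce
  rw [← mul_sub, mul_left_comm]
  refine mul_le_mul_of_nonneg_left ?_ (layerWeight_nonneg r)
  by_cases h : r ∈ Iic ((a - c) / δ)
  · rw [indicator_of_mem h, mul_one]
    rw [mem_Iic, le_div_iff₀ hδ] at h
    have : b p (c + δ * r) ≤ b p a := (strictMono_b hp).monotone (by linarith)
    rw [max_eq_left (by linarith)]
    linarith [le_max_left (b p a' - b p (c + δ * r)) 0]
  · rw [indicator_of_notMem h, mul_zero]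
    rw [mem_Iic, le_div_iff₀ hδ, not_le] at h
    have : b p a ≤ b p (c + δ * r) := (strictMono_b hp).monotone (by linarith)
    rw [max_eq_right (by linarith)]
    linarith [le_max_right (b p a' - b p (c + δ * r)) 0]

/-- The mirror image in the second argument: `γ ↦ (k - γ)₊` with `k = b(a - δr)` is convex with
slope minus the same indicator. Putting the shift on `a` rather than on `c` is what makes the same
truncation serve both equations. -/
theorem entropyRight_sub_le (hp : 1 < p) {δ : ℝ} (hδ : 0 < δ) (a c c' : ℝ) :
    entropyRight p δ a c - entropyRight p δ a c' ≤ -(b p c - b p c') * ramp ((a - c) / δ) := by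
  have hb := continuous_b hp
  have hi : ∀ c, IntegrableOn (fun r => layerWeight r * max (b p (a - δ * r) - b p c) 0)
      (Icc (1 : ℝ) 2) := fun c => integrableOn_layerWeight_mul (by fun_prop)
  rw [ramp_eq, entropyRight, entropyRight, ← integral_sub (hi c) (hi c'), ← integral_const_mul]
  refine integral_mono ((hi c).sub (hi c'))
    ((integrableOn_layerWeight_mul_indicator _).const_mul _) fun r => ?_
  beta_reduce
  rw [← mul_sub, mul_left_comm]
  refine mul_le_mul_of_nonneg_left ?_ (layerWeight_nonneg r)
  by_cases h : r ∈ Iic ((a - c) / δ)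
  · rw [indicator_of_mem h, mul_one]
    rw [mem_Iic, le_div_iff₀ hδ] at h
    have : b p c ≤ b p (a - δ * r) := (strictMono_b hp).monotone (by linarith)
    rw [max_eq_left (by linarith)]
    linarith [le_max_left (b p (a - δ * r) - b p c') 0]
  · rw [indicator_of_notMem h, mul_zero]
    rw [mem_Iic, le_div_iff₀ hδ, not_le] at h
    have : b p (a - δ * r) ≤ b p c := (strictMono_b hp).monotone (by linarith)
    rw [max_eq_right (by linarith)]
    linarith [le_max_right (b p (a - δ * r) - b p c') 0]

end Trudinger

/-! ### The entropy inequality at a fixed pair of times -/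

namespace Trudinger
variable {n : ℕ} {p q T : ℝ} {Ω : Set (Space n)} {ψ u u₁ u₂ : Space n × ℝ → ℝ}
  {G G₁ G₂ : Space n × ℝ → Space n}

theorem HasW1pGradient.sub [IsFiniteMeasure (volume.restrict Ω)] (hp : 1 ≤ p)
    {v w : Space n → ℝ} {K L : Space n → Space n} (hv : HasW1pGradient p Ω v K)
    (hw : HasW1pGradient p Ω w L) :
    HasW1pGradient p Ω (fun x => v x - w x) (fun x => K x - L x) := by
  refine ⟨hv.1.sub hw.1, hv.2.1.sub hw.2.1, fun φ hφ => ?_⟩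
  simp_rw [sub_smul, smul_sub]
  rw [integral_sub (integrable_smul_gradient hp hv.1 hφ) (integrable_smul_gradient hp hw.1 hφ),
    integral_sub (integrable_testFunction_smul hp hv.2.1 hφ)
    (integrable_testFunction_smul hp hw.2.1 hφ), hv.2.2 φ hφ, hw.2.2 φ hφ]
  abel

theorem hasDerivAt_ramp_div {δ : ℝ} (z : ℝ) :
    HasDerivAt (fun z => ramp (z / δ)) (layerWeight (z / δ) * (1 / δ)) z :=
  (hasDerivAt_ramp (z / δ)).comp (h := fun z => z / δ) z ((hasDerivAt_id' z).div_const δ)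

/-- The boundary condition for a representative at a fixed time. -/
def BoundaryAt (p : ℝ) (Ω : Set (Space n)) (ψ u : Space n × ℝ → ℝ) (G : Space n × ℝ → Space n)
    (t : ℝ) : Prop :=
  ∃ v G₀ K, SobolevZero p Ω v G₀ ∧
    HasW1pGradient p Ω (fun x => ψ (x, t)) K ∧
    (fun x => u (x, t)) =ᵐ[volume.restrict Ω] (fun x => v x + ψ (x, t)) ∧
    (fun x => G (x, t)) =ᵐ[volume.restrict Ω] (fun x => G₀ x + K x)

theorem BoundaryAt.memLp {t : ℝ} (h : BoundaryAt p Ω ψ u G t) :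
    MemLp (fun x => u (x, t)) (ENNReal.ofReal p) (volume.restrict Ω) := by
  obtain ⟨v, G₀, K, h1, h2, h3, h4⟩ := h
  exact (h1.1.add h2.1).ae_eq h3.symm

theorem BoundaryAt.memLp_grad {t : ℝ} (h : BoundaryAt p Ω ψ u G t) :
    MemLp (fun x => G (x, t)) (ENNReal.ofReal p) (volume.restrict Ω) := by
  obtain ⟨v, G₀, K, h1, h2, h3, h4⟩ := h
  exact (h1.2.1.add h2.2.1).ae_eq h4.symm

theorem BoundaryAt.memLp_b {t : ℝ} (hp : 1 < p) (hpq : p.HolderConjugate q)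
    (h : BoundaryAt p Ω ψ u G t) :
    MemLp (fun x => b p (u (x, t))) (ENNReal.ofReal q) (volume.restrict Ω) :=
  MemLp.norm_rpow_sub_one hpq h.memLp ((continuous_b hp).comp_aestronglyMeasurable h.memLp.1)
    fun _ => abs_b hp _

theorem BoundaryAt.memLp_flux {t : ℝ} (hp : 1 < p) (hpq : p.HolderConjugate q)
    (h : BoundaryAt p Ω ψ u G t) :
    MemLp (fun x => flux p (G (x, t))) (ENNReal.ofReal q) (volume.restrict Ω) :=
  MemLp.norm_rpow_sub_one hpq h.memLp_grad
    (measurable_flux.comp_aemeasurable h.memLp_grad.1.aemeasurable).aestronglyMeasurable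
    fun _ => norm_flux hp _

theorem IsIncrementSolution.exists_good_times (h : IsIncrementSolution p Ω T ψ u G) :
    ∃ S : Set ℝ, (∀ᵐ t : ℝ, t ∈ S) ∧ (∀ t ∈ S, t ∈ Ioo 0 T → BoundaryAt p Ω ψ u G t) ∧
      ∀ t₁ t₂, t₁ ∈ S → t₂ ∈ S → 0 < t₁ → t₁ < t₂ → t₂ < T → ∀ v K, SobolevZero p Ω v K →
        ∫ x in Ω, (b p (u (x, t₂)) - b p (u (x, t₁))) * v x
          = - ∫ t in Ioc t₁ t₂, ∫ x in Ω, inner ℝ (flux p (G (x, t))) (K x) := by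
  obtain ⟨N, hN0, hN⟩ := h.increment
  have hb := h.boundary
  rw [ae_restrict_iff' measurableSet_Ioo] at hb
  refine ⟨Nᶜ ∩ {t | t ∈ Ioo 0 T → BoundaryAt p Ω ψ u G t}, ?_, fun t ht => ht.2,
    fun t₁ t₂ h₁ h₂ => hN t₁ t₂ h₁.1 h₂.1⟩
  have h1 : ∀ᵐ t : ℝ, t ∈ Nᶜ := by
    rw [ae_iff]; simpa using hN0
  filter_upwards [h1, hb] with t ht1 ht2
  exact ⟨ht1, ht2⟩

/-- The truncated difference of two solutions at times `t < s` vanishes on the boundary. -/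
theorem sobolevZero_ramp_sub (hp : 1 < p) (hΩ : IsOpen Ω) (hΩb : Bornology.IsBounded Ω)
    {t s : ℝ} (hψt : ContinuousOn (fun x => ψ (x, t)) (closure Ω))
    (hψs : ContinuousOn (fun x => ψ (x, s)) (closure Ω))
    (hψ : ∀ x ∈ frontier Ω, ψ (x, t) ≤ ψ (x, s))
    (h₁ : BoundaryAt p Ω ψ u₁ G₁ t) (h₂ : BoundaryAt p Ω ψ u₂ G₂ s) {δ : ℝ} (hδ : 0 < δ) :
    SobolevZero p Ω (fun x => ramp ((u₁ (x, t) - u₂ (x, s)) / δ))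
      (fun x => (layerWeight ((u₁ (x, t) - u₂ (x, s)) / δ) * (1 / δ))
        • (G₁ (x, t) - G₂ (x, s))) := by
  have hfin : IsFiniteMeasure (volume.restrict Ω) := ⟨by
    rw [Measure.restrict_apply_univ]; exact hΩb.measure_lt_top⟩
  obtain ⟨v₁, L₁, K₁, a1, a2, a3, a4⟩ := h₁
  obtain ⟨v₂, L₂, K₂, b1, b2, b3, b4⟩ := h₂
  obtain ⟨C, hC⟩ := exists_layerWeight_le
  have hd : ∀ z, deriv (fun z => ramp (z / δ)) z = layerWeight (z / δ) * (1 / δ) := fun z =>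
    (hasDerivAt_ramp_div z).deriv
  have key := (a1.add hp.le b1.neg).comp_add_of_nonpos_frontier hp hΩ hΩb (a2.sub hp.le b2)
    (hψt.sub hψs) (fun x hx => sub_nonpos.2 (hψ x hx)) (H := fun z => ramp (z / δ))
    (contDiff_ramp.comp (contDiff_id.div_const δ)) hδ
    (fun z hz => ramp_eq_zero ((div_le_one hδ).2 hz)) (L := C * (1 / δ)) (fun z => by
      rw [hd, abs_mul, abs_of_pos (show 0 < 1 / δ by positivity)]
      gcongr
      exact hC _)
  refine key.congr_ae ?_ ?_
  · filter_upwards [a3, b3] with x hx1 hx2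
    rw [hx1, hx2]; ring_nf
  · filter_upwards [a3, b3, a4, b4] with x hx1 hx2 hx3 hx4
    rw [hx1, hx2, hx3, hx4, hd]
    congr 1
    · ring_nf
    · abel

/-- Freezing each integrand at its right endpoint leaves `h(a₂ s - a₁ t) ≤ 0`; what remains is the
oscillation of the two functions over time lags up to `h`. -/
theorem sub_integral_Ioc_le {a₁ a₂ : ℝ → ℝ} {t s h : ℝ} (hh : 0 ≤ h)
    (i₁ : IntegrableOn a₁ (Ioc (t - h) t)) (i₂ : IntegrableOn a₂ (Ioc (s - h) s))
    (hm : a₂ s ≤ a₁ t) :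
    -(∫ τ in Ioc (t - h) t, a₁ τ) + ∫ τ in Ioc (s - h) s, a₂ τ
      ≤ ∫ τ in Ioc 0 h, (|a₁ (t - τ) - a₁ t| + |a₂ (s - τ) - a₂ s|) := by
  have e : ∀ (a : ℝ → ℝ) (t : ℝ), ∫ τ in Ioc (t - h) t, a τ = ∫ τ in (0 : ℝ)..h, a (t - τ) :=
    fun a t => by
      rw [intervalIntegral.integral_comp_sub_left, sub_zero,
        intervalIntegral.integral_of_le (by linarith)]
  have ie : ∀ (a : ℝ → ℝ) (t : ℝ), IntegrableOn a (Ioc (t - h) t) →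
      IntervalIntegrable (fun τ => a (t - τ)) volume 0 h := fun a t ha => by
    have h1 : IntervalIntegrable a volume (t - h) t :=
      (intervalIntegrable_iff_integrableOn_Ioc_of_le (by linarith)).2 ha
    have h2 := h1.comp_sub_left t
    rw [sub_sub_cancel, sub_self] at h2
    exact h2.symm
  have j₁ := ie a₁ t i₁
  have j₂ := ie a₂ s i₂
  have j₁n : IntervalIntegrable (fun τ => -a₁ (t - τ)) volume 0 h := j₁.neg
  rw [e, e, ← intervalIntegral.integral_neg, ← intervalIntegral.integral_add j₁n j₂,
    ← intervalIntegral.integral_of_le hh]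
  refine intervalIntegral.integral_mono hh (j₁.neg.add j₂)
    (((j₁.sub intervalIntegrable_const).abs).add ((j₂.sub intervalIntegrable_const).abs))
    fun τ => ?_
  beta_reduce
  linarith [neg_abs_le (a₁ (t - τ) - a₁ t), le_abs_self (a₂ (s - τ) - a₂ s)]

theorem integrableOn_integral_inner (hpq : p.HolderConjugate q) {A : Space n × ℝ → Space n}
    (hA : MemLp A (ENNReal.ofReal q) volume) {K : Space n → Space n}
    (hK : MemLp K (ENNReal.ofReal p) (volume.restrict Ω)) (c d : ℝ) :
    IntegrableOn (fun τ => ∫ x in Ω, inner ℝ (A (x, τ)) (K x)) (Ioc c d) := by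
  have h1 : MemLp A (ENNReal.ofReal q)
      ((volume.restrict Ω).prod (volume.restrict (Ioc c d))) := by
    rw [Measure.prod_restrict]
    exact hA.restrict _
  exact (integrable_inner_fst hpq h1 hK).integral_prod_right

theorem ofReal_abs_integral_inner_sub_le (hpq : p.HolderConjugate q) {A B K : Space n → Space n}
    (hA : MemLp A (ENNReal.ofReal q) (volume.restrict Ω))
    (hB : MemLp B (ENNReal.ofReal q) (volume.restrict Ω))
    (hK : MemLp K (ENNReal.ofReal p) (volume.restrict Ω)) :
    ENNReal.ofReal |(∫ x in Ω, inner ℝ (A x) (K x)) - ∫ x in Ω, inner ℝ (B x) (K x)|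
      ≤ ∫⁻ x in Ω, ‖A x - B x‖ₑ * ‖K x‖ₑ := by
  rw [← integral_sub (integrable_inner_of_holder hpq hA hK) (integrable_inner_of_holder hpq hB hK),
    ← Real.enorm_eq_ofReal_abs]
  refine (enorm_integral_le_lintegral_enorm _).trans (lintegral_mono fun x => ?_)
  rw [← inner_sub_left, ← enorm_norm (A x - B x), ← enorm_norm (K x), ← enorm_mul]
  refine enorm_le_iff_norm_le.2 ?_
  rw [Real.norm_of_nonneg (mul_nonneg (norm_nonneg (A x - B x)) (norm_nonneg (K x)))]
  exact norm_inner_le_norm _ _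

theorem ae_restrict_Ioc_comp_sub {P : ℝ → Prop} (hP : ∀ᵐ t : ℝ, P t) (t : ℝ) (s : Set ℝ) :
    ∀ᵐ τ ∂(volume.restrict s), P (t - τ) :=
  ae_restrict_of_ae ((Measure.measurePreserving_sub_left volume t).quasiMeasurePreserving.ae hP)

theorem integrable_entropyLeft {X : Type*} [MeasurableSpace X] {μ : Measure X} (hp : 1 < p) {δ : ℝ}
    (hδ : 0 ≤ δ) {w z : X → ℝ} (hw : AEStronglyMeasurable w μ) (hz : AEStronglyMeasurable z μ)
    (hbw : Integrable (fun x => b p (w x)) μ) (hbz : Integrable (fun x => b p (z x)) μ) :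
    Integrable (fun x => entropyLeft p δ (w x) (z x)) μ := by
  have hm : AEStronglyMeasurable (fun x => entropyLeft p δ (w x) (z x)) μ :=
    (continuous_entropyLeft hp).comp_aestronglyMeasurable
      (f := fun x => ((δ, w x, z x) : ℝ × ℝ × ℝ))
      ((aestronglyMeasurable_const (b := δ)).prodMk (hw.prodMk hz))
  exact (hbw.abs.add hbz.abs).mono' hm (ae_of_all _ fun x => abs_entropyLeft_le hp hδ _ _)

theorem integrable_entropyRight {X : Type*} [MeasurableSpace X] {μ : Measure X} (hp : 1 < p) {δ : ℝ}
    (hδ : 0 ≤ δ) {w z : X → ℝ} (hw : AEStronglyMeasurable w μ) (hz : AEStronglyMeasurable z μ)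
    (hbw : Integrable (fun x => b p (w x)) μ) (hbz : Integrable (fun x => b p (z x)) μ) :
    Integrable (fun x => entropyRight p δ (w x) (z x)) μ := by
  have hm : AEStronglyMeasurable (fun x => entropyRight p δ (w x) (z x)) μ :=
    (continuous_entropyRight hp).comp_aestronglyMeasurable
      (f := fun x => ((δ, w x, z x) : ℝ × ℝ × ℝ))
      ((aestronglyMeasurable_const (b := δ)).prodMk (hw.prodMk hz))
  exact (hbw.abs.add hbz.abs).mono' hm (ae_of_all _ fun x => abs_entropyRight_le hp hδ _ _)

/-- Valid without integrability, since the Bochner integral is then zero. Error terms can thus be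
estimated in `ENNReal` with no separate proof that they are finite. -/
theorem ofReal_integral_le_lintegral {X : Type*} [MeasurableSpace X] {μ : Measure X} (f : X → ℝ) :
    ENNReal.ofReal (∫ x, f x ∂μ) ≤ ∫⁻ x, ENNReal.ofReal (f x) ∂μ := by
  by_cases hf : Integrable f μ
  · rw [integral_eq_lintegral_pos_part_sub_lintegral_neg_part hf]
    exact (ENNReal.ofReal_le_ofReal (sub_le_self _ ENNReal.toReal_nonneg)).trans
      ENNReal.ofReal_toReal_le
  · simp [integral_undef hf]

/-- One truncation, frozen at `(t, s)`, is tested in both increment equations. The entropies absorb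
the parabolic terms, the frozen fluxes contribute with the good sign, and the right side collects
the change of the fluxes over lags `τ ≤ h`, paired with the gradient of the truncation. -/
theorem ofReal_integral_entropy_le (hp : 1 < p) (hpq : p.HolderConjugate q) (hΩ : IsOpen Ω)
    (hΩb : Bornology.IsBounded Ω)
    (hψc : ∀ t ∈ Ioo 0 T, ContinuousOn (fun x => ψ (x, t)) (closure Ω))
    (hψm : ∀ x ∈ frontier Ω, ∀ t s : ℝ, 0 < t → t < s → s < T → ψ (x, t) ≤ ψ (x, s))
    (hf₁ : MemLp (fun z => flux p (G₁ z)) (ENNReal.ofReal q) volume)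
    (hf₂ : MemLp (fun z => flux p (G₂ z)) (ENNReal.ofReal q) volume)
    {S₁ S₂ : Set ℝ} (hS₁ : ∀ᵐ t : ℝ, t ∈ S₁) (hS₂ : ∀ᵐ t : ℝ, t ∈ S₂)
    (hb₁ : ∀ t ∈ S₁, t ∈ Ioo 0 T → BoundaryAt p Ω ψ u₁ G₁ t)
    (hb₂ : ∀ t ∈ S₂, t ∈ Ioo 0 T → BoundaryAt p Ω ψ u₂ G₂ t)
    (hi₁ : ∀ t₁ t₂, t₁ ∈ S₁ → t₂ ∈ S₁ → 0 < t₁ → t₁ < t₂ → t₂ < T →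
      ∀ v K, SobolevZero p Ω v K → ∫ x in Ω, (b p (u₁ (x, t₂)) - b p (u₁ (x, t₁))) * v x
        = - ∫ t in Ioc t₁ t₂, ∫ x in Ω, inner ℝ (flux p (G₁ (x, t))) (K x))
    (hi₂ : ∀ t₁ t₂, t₁ ∈ S₂ → t₂ ∈ S₂ → 0 < t₁ → t₁ < t₂ → t₂ < T →
      ∀ v K, SobolevZero p Ω v K → ∫ x in Ω, (b p (u₂ (x, t₂)) - b p (u₂ (x, t₁))) * v x
        = - ∫ t in Ioc t₁ t₂, ∫ x in Ω, inner ℝ (flux p (G₂ (x, t))) (K x))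
    {C δ : ℝ} (hC : ∀ r, |layerWeight r| ≤ C) (hδ : 0 < δ) {t s h : ℝ} (hh : 0 < h)
    (hth : 0 < t - h) (hts : t < s) (hsT : s < T) (ht : t ∈ S₁) (hth' : t - h ∈ S₁)
    (hs : s ∈ S₂) (hsh' : s - h ∈ S₂) :
    ENNReal.ofReal (∫ x in Ω,
        (entropyLeft p δ (u₁ (x, t)) (u₂ (x, s)) - entropyLeft p δ (u₁ (x, t - h)) (u₂ (x, s))
        + (entropyRight p δ (u₁ (x, t)) (u₂ (x, s))
          - entropyRight p δ (u₁ (x, t)) (u₂ (x, s - h)))))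
      ≤ ∫⁻ τ in Ioc 0 h, ∫⁻ x in Ω,
        (‖flux p (G₁ (x, t - τ)) - flux p (G₁ (x, t))‖ₑ
          + ‖flux p (G₂ (x, s - τ)) - flux p (G₂ (x, s))‖ₑ)
        * (ENNReal.ofReal (C * (1 / δ)) * (‖G₁ (x, t)‖ₑ + ‖G₂ (x, s)‖ₑ)) := by
  have hfin : IsFiniteMeasure (volume.restrict Ω) := ⟨by
    rw [Measure.restrict_apply_univ]; exact hΩb.measure_lt_top⟩
  have htJ : t ∈ Ioo 0 T := ⟨by linarith, by linarith⟩
  have hsJ : s ∈ Ioo 0 T := ⟨by linarith, by linarith⟩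
  have B₁ := hb₁ t ht htJ
  have B₁' := hb₁ (t - h) hth' ⟨hth, by linarith⟩
  have B₂ := hb₂ s hs hsJ
  have B₂' := hb₂ (s - h) hsh' ⟨by linarith, by linarith⟩
  have hS := sobolevZero_ramp_sub hp hΩ hΩb (hψc t htJ) (hψc s hsJ)
    (fun x hx => hψm x hx t s htJ.1 hts hsT) B₁ B₂ hδ
  set v : Space n → ℝ := fun x => ramp ((u₁ (x, t) - u₂ (x, s)) / δ) with hv
  set K : Space n → Space n := fun x => (layerWeight ((u₁ (x, t) - u₂ (x, s)) / δ) * (1 / δ))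
        • (G₁ (x, t) - G₂ (x, s)) with hK
  have hqE : (1 : ENNReal) ≤ ENNReal.ofReal q := by simpa using hpq.symm.lt.le
  have hvb : ∀ x, ‖v x‖ ≤ 1 := fun x => by
    rw [Real.norm_of_nonneg (ramp_mem_Icc _).1]; exact (ramp_mem_Icc _).2
  have ib₁ := (B₁.memLp_b hp hpq).integrable hqE
  have ib₁' := (B₁'.memLp_b hp hpq).integrable hqE
  have ib₂ := (B₂.memLp_b hp hpq).integrable hqE
  have ib₂' := (B₂'.memLp_b hp hpq).integrable hqE
  have m₁ := B₁.memLp.1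
  have m₁' := B₁'.memLp.1
  have m₂ := B₂.memLp.1
  have m₂' := B₂'.memLp.1
  have iv₁ : Integrable (fun x => (b p (u₁ (x, t)) - b p (u₁ (x, t - h))) * v x)
      (volume.restrict Ω) := (ib₁.sub ib₁').mul_bdd (c := 1) hS.1.1 (ae_of_all _ hvb)
  have iv₂ : Integrable (fun x => (b p (u₂ (x, s)) - b p (u₂ (x, s - h))) * v x)
      (volume.restrict Ω) := (ib₂.sub ib₂').mul_bdd (c := 1) hS.1.1 (ae_of_all _ hvb)
  let a₁ : ℝ → ℝ := fun τ => ∫ x in Ω, inner ℝ (flux p (G₁ (x, τ))) (K x)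
  let a₂ : ℝ → ℝ := fun τ => ∫ x in Ω, inner ℝ (flux p (G₂ (x, τ))) (K x)
  have hstep : ∫ x in Ω,
        (entropyLeft p δ (u₁ (x, t)) (u₂ (x, s)) - entropyLeft p δ (u₁ (x, t - h)) (u₂ (x, s))
        + (entropyRight p δ (u₁ (x, t)) (u₂ (x, s))
          - entropyRight p δ (u₁ (x, t)) (u₂ (x, s - h))))
      ≤ -(∫ τ in Ioc (t - h) t, a₁ τ) + ∫ τ in Ioc (s - h) s, a₂ τ := by
    have e₁ := hi₁ (t - h) t hth' ht hth (by linarith) htJ.2 v K hS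
    have e₂ := hi₂ (s - h) s hsh' hs (by linarith) (by linarith) hsT v K hS
    have e₂' : ∫ τ in Ioc (s - h) s, a₂ τ
        = - ∫ x in Ω, (b p (u₂ (x, s)) - b p (u₂ (x, s - h))) * v x := by
      rw [e₂, neg_neg]
    rw [← e₁, e₂', ← integral_neg]
    have iv₂n : Integrable (fun x => -((b p (u₂ (x, s)) - b p (u₂ (x, s - h))) * v x))
      (volume.restrict Ω) := iv₂.neg
    rw [← integral_add iv₁ iv₂n]
    refine integral_mono (((integrable_entropyLeft hp hδ.le m₁ m₂ ib₁ ib₂).sub (integrable_entropyLeft hp hδ.le m₁' m₂ ib₁' ib₂)).add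
      ((integrable_entropyRight hp hδ.le m₁ m₂ ib₁ ib₂).sub (integrable_entropyRight hp hδ.le m₁ m₂' ib₁ ib₂'))) (iv₁.add iv₂n) fun x => ?_
    have h1 := entropyLeft_sub_le hp hδ (u₁ (x, t)) (u₁ (x, t - h)) (u₂ (x, s))
    have h2 := entropyRight_sub_le hp hδ (u₁ (x, t)) (u₂ (x, s)) (u₂ (x, s - h))
    rw [neg_mul] at h2
    exact add_le_add h1 h2
  -- `K` is a nonnegative multiple of `G₁(·,t) - G₂(·,s)`, so this is monotonicity of the flux. It
  -- is available only because the fluxes are evaluated at the same times as `K`.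
  have hmono : a₂ s ≤ a₁ t := by
    rw [← sub_nonneg]
    simp only [a₁, a₂]
    rw [← integral_sub (integrable_inner_of_holder hpq (B₁.memLp_flux hp hpq) hS.2.1)
      (integrable_inner_of_holder hpq (B₂.memLp_flux hp hpq) hS.2.1)]
    refine integral_nonneg fun x => ?_
    beta_reduce
    rw [← inner_sub_left, hK, inner_smul_right]
    exact mul_nonneg (mul_nonneg (layerWeight_nonneg _) (by positivity))
      (inner_flux_sub_nonneg hp _ _)
  have hstep2 := hstep.trans (sub_integral_Ioc_le hh.le
    (integrableOn_integral_inner hpq hf₁ hS.2.1 (t - h) t)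
    (integrableOn_integral_inner hpq hf₂ hS.2.1 (s - h) s) hmono)
  refine (ENNReal.ofReal_le_ofReal hstep2).trans ?_
  refine (ofReal_integral_le_lintegral _).trans ?_
  refine lintegral_mono_ae ?_
  filter_upwards [ae_restrict_Ioc_comp_sub hS₁ t (Ioc 0 h), ae_restrict_Ioc_comp_sub hS₂ s (Ioc 0 h),
    ae_restrict_mem measurableSet_Ioc] with τ hτ₁ hτ₂ hτ
  have D₁ := hb₁ (t - τ) hτ₁ ⟨by linarith [hτ.2], by linarith [hτ.1]⟩
  have D₂ := hb₂ (s - τ) hτ₂ ⟨by linarith [hτ.2], by linarith [hτ.1]⟩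
  rw [ENNReal.ofReal_add (abs_nonneg _) (abs_nonneg _)]
  refine (add_le_add
    (ofReal_abs_integral_inner_sub_le hpq (D₁.memLp_flux hp hpq) (B₁.memLp_flux hp hpq) hS.2.1)
    (ofReal_abs_integral_inner_sub_le hpq (D₂.memLp_flux hp hpq) (B₂.memLp_flux hp hpq) hS.2.1)).trans
    ?_
  rw [← lintegral_add_left']
  · refine lintegral_mono fun x => ?_
    rw [← add_mul]
    gcongr
    rw [hK, enorm_smul]
    gcongr
    · rw [← ofReal_norm]
      refine ENNReal.ofReal_le_ofReal ?_
      rw [norm_mul, Real.norm_of_nonneg (show 0 ≤ 1 / δ by positivity)]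
      gcongr
      exact hC _
    · exact enorm_sub_le
  · exact (((D₁.memLp_flux hp hpq).1.sub (B₁.memLp_flux hp hpq).1).enorm).mul hS.2.1.1.enorm

end Trudinger

/-! ### Hölder estimates with two time variables -/

namespace Trudinger

section Projections
variable {X Y Z F : Type*} [MeasurableSpace X] [MeasurableSpace Y] [MeasurableSpace Z]
  {μ : Measure X} {ν : Measure Y} {ρ : Measure Z} [SFinite μ] [SFinite ν] [NormedAddCommGroup F]
  {p : ℝ} {f : X × Y → F}

theorem eLpNorm_comp_prodAssoc [IsFiniteMeasure ρ] (hp : 0 < p) (hf : StronglyMeasurable f) :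
    eLpNorm (fun z : X × Y × Z => f (z.1, z.2.1)) (ENNReal.ofReal p) (μ.prod (ν.prod ρ))
      = ρ univ ^ (1 / p) * eLpNorm f (ENNReal.ofReal p) (μ.prod ν) := by
  rw [← eLpNorm_comp_fst (ρ := ρ) hp hf.aestronglyMeasurable]
  have hmp : MeasurePreserving MeasurableEquiv.prodAssoc ((μ.prod ν).prod ρ)
      (μ.prod (ν.prod ρ)) := ⟨MeasurableEquiv.prodAssoc.measurable, Measure.prodAssoc_prod⟩
  have hm : StronglyMeasurable (fun z : X × Y × Z => f (z.1, z.2.1)) :=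
    hf.comp_measurable (by fun_prop)
  rw [← eLpNorm_comp_measurePreserving hm.aestronglyMeasurable hmp]
  rfl

theorem eLpNorm_comp_prodAssoc_swap [IsFiniteMeasure ρ] (hp : 0 < p) (hf : StronglyMeasurable f) :
    eLpNorm (fun z : X × Z × Y => f (z.1, z.2.2)) (ENNReal.ofReal p) (μ.prod (ρ.prod ν))
      = ρ univ ^ (1 / p) * eLpNorm f (ENNReal.ofReal p) (μ.prod ν) := by
  rw [← eLpNorm_comp_prodAssoc (ρ := ρ) hp hf]
  have hmp : MeasurePreserving (Prod.map id Prod.swap) (μ.prod (ρ.prod ν)) (μ.prod (ν.prod ρ)) :=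
    (MeasurePreserving.id μ).prod Measure.measurePreserving_swap
  have hm : StronglyMeasurable (fun z : X × Y × Z => f (z.1, z.2.1)) :=
    hf.comp_measurable (by fun_prop)
  rw [← eLpNorm_comp_measurePreserving hm.aestronglyMeasurable hmp]
  rfl

theorem MemLp.comp_prodAssoc [IsFiniteMeasure ρ] (hp : 0 < p) (hf : StronglyMeasurable f)
    (h : MemLp f (ENNReal.ofReal p) (μ.prod ν)) :
    MemLp (fun z : X × Y × Z => f (z.1, z.2.1)) (ENNReal.ofReal p) (μ.prod (ν.prod ρ)) := by
  refine ⟨(hf.comp_measurable (by fun_prop)).aestronglyMeasurable, ?_⟩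
  rw [eLpNorm_comp_prodAssoc hp hf]
  exact ENNReal.mul_lt_top (ENNReal.rpow_lt_top_of_nonneg (by positivity) (measure_ne_top _ _)) h.2

theorem MemLp.comp_prodAssoc_swap [IsFiniteMeasure ρ] (hp : 0 < p) (hf : StronglyMeasurable f)
    (h : MemLp f (ENNReal.ofReal p) (μ.prod ν)) :
    MemLp (fun z : X × Z × Y => f (z.1, z.2.2)) (ENNReal.ofReal p) (μ.prod (ρ.prod ν)) := by
  refine ⟨(hf.comp_measurable (by fun_prop)).aestronglyMeasurable, ?_⟩
  rw [eLpNorm_comp_prodAssoc_swap hp hf]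
  exact ENNReal.mul_lt_top (ENNReal.rpow_lt_top_of_nonneg (by positivity) (measure_ne_top _ _)) h.2

/-- Each factor depends on only one of the two times, so its norm over the doubled cylinder is its
norm over the single cylinder times a power of the length of the unused time interval. -/
theorem lintegral_mul_le_of_holder {q : ℝ} {κ : Measure X} [SFinite κ] {lam : Measure ℝ}
    [IsFiniteMeasure lam]
    (hpq : p.HolderConjugate q) {A₁ A₂ B₁ B₂ : X × ℝ → F} (hA₁ : StronglyMeasurable A₁)
    (hA₂ : StronglyMeasurable A₂) (hB₁ : StronglyMeasurable B₁) (hB₂ : StronglyMeasurable B₂)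
    (c : ENNReal) :
    ∫⁻ z, (‖A₁ (z.1, z.2.1)‖ₑ + ‖A₂ (z.1, z.2.2)‖ₑ)
        * (c * (‖B₁ (z.1, z.2.1)‖ₑ + ‖B₂ (z.1, z.2.2)‖ₑ)) ∂(κ.prod (lam.prod lam))
      ≤ (c * (lam univ ^ (1 / q) * (lam univ ^ (1 / p) *
        (eLpNorm B₁ (ENNReal.ofReal p) (κ.prod lam) + eLpNorm B₂ (ENNReal.ofReal p) (κ.prod lam)))))
        * (eLpNorm A₁ (ENNReal.ofReal q) (κ.prod lam)
          + eLpNorm A₂ (ENNReal.ofReal q) (κ.prod lam)) := by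
  have m : ∀ {A : X × ℝ → F}, StronglyMeasurable A →
      StronglyMeasurable (fun z : X × ℝ × ℝ => ‖A (z.1, z.2.1)‖) ∧
      StronglyMeasurable (fun z : X × ℝ × ℝ => ‖A (z.1, z.2.2)‖) := fun h =>
    ⟨(h.comp_measurable (by fun_prop)).norm, (h.comp_measurable (by fun_prop)).norm⟩
  have hle : ∀ {r : ℝ}, 1 ≤ r → ∀ {A B : X × ℝ → F}, StronglyMeasurable A → StronglyMeasurable B →
      eLpNorm (fun z : X × ℝ × ℝ => ‖A (z.1, z.2.1)‖ + ‖B (z.1, z.2.2)‖) (ENNReal.ofReal r)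
        (κ.prod (lam.prod lam)) ≤ lam univ ^ (1 / r) *
        (eLpNorm A (ENNReal.ofReal r) (κ.prod lam) + eLpNorm B (ENNReal.ofReal r) (κ.prod lam)) := by
    intro r hr A B hA hB
    refine (eLpNorm_add_le (m hA).1.aestronglyMeasurable (m hB).2.aestronglyMeasurable
      (by simpa using hr)).trans ?_
    rw [eLpNorm_norm (fun z : X × ℝ × ℝ => A (z.1, z.2.1)),
      eLpNorm_norm (fun z : X × ℝ × ℝ => B (z.1, z.2.2)),
      eLpNorm_comp_prodAssoc (by linarith) hA, eLpNorm_comp_prodAssoc_swap (by linarith) hB, mul_add]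
  have h := eLpNorm_inner_le hpq (ν := κ.prod (lam.prod lam))
    ((m hA₁).1.add (m hA₂).2).aestronglyMeasurable ((m hB₁).1.add (m hB₂).2).aestronglyMeasurable
  have h2 := mul_le_mul' (hle hpq.symm.lt.le hA₁ hA₂) (hle hpq.lt.le hB₁ hB₂)
  calc _ = ∫⁻ z, c * ((‖A₁ (z.1, z.2.1)‖ₑ + ‖A₂ (z.1, z.2.2)‖ₑ)
        * (‖B₁ (z.1, z.2.1)‖ₑ + ‖B₂ (z.1, z.2.2)‖ₑ)) ∂(κ.prod (lam.prod lam)) :=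
        lintegral_congr fun z => by ring
    _ ≤ c * ((lam univ ^ (1 / q) * (eLpNorm A₁ (ENNReal.ofReal q) (κ.prod lam)
          + eLpNorm A₂ (ENNReal.ofReal q) (κ.prod lam))) * (lam univ ^ (1 / p) *
        (eLpNorm B₁ (ENNReal.ofReal p) (κ.prod lam)
          + eLpNorm B₂ (ENNReal.ofReal p) (κ.prod lam)))) := by
        have hme : ∀ {A B : X × ℝ → F}, StronglyMeasurable A → StronglyMeasurable B →
            Measurable fun z : X × ℝ × ℝ => ‖A (z.1, z.2.1)‖ₑ + ‖B (z.1, z.2.2)‖ₑ :=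
          fun hA hB => (hA.comp_measurable (by fun_prop)).enorm.add
            (hB.comp_measurable (by fun_prop)).enorm
        have hprod : Measurable fun z : X × ℝ × ℝ => (‖A₁ (z.1, z.2.1)‖ₑ + ‖A₂ (z.1, z.2.2)‖ₑ)
            * (‖B₁ (z.1, z.2.1)‖ₑ + ‖B₂ (z.1, z.2.2)‖ₑ) := (hme hA₁ hA₂).mul (hme hB₁ hB₂)
        rw [lintegral_const_mul _ hprod]
        gcongr
        refine le_trans (le_of_eq ?_) (h.trans h2)
        rw [eLpNorm_one_eq_lintegral_enorm]
        refine lintegral_congr fun z => ?_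
        have e : ∀ a a' : F, ‖a‖ₑ + ‖a'‖ₑ = ‖‖a‖ + ‖a'‖‖ₑ := fun a a' => by
          rw [Real.enorm_of_nonneg (by positivity), ENNReal.ofReal_add (norm_nonneg _) (norm_nonneg _),
            ofReal_norm, ofReal_norm]
        rw [e, e, ← enorm_mul, RCLike.inner_apply, conj_trivial, mul_comm]
        rfl
    _ = _ := by ring

theorem integral_prod_snd_add {E : Type*} [NormedAddCommGroup E] [NormedSpace ℝ E]
    (f : X × ℝ × ℝ → E) (w : ℝ × ℝ) :
    ∫ z, f (z.1, z.2 + w) ∂(μ.prod volume) = ∫ z, f z ∂(μ.prod volume) := by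
  have hmp : MeasurePreserving ((MeasurableEquiv.refl X).prodCongr (MeasurableEquiv.addRight w))
      (μ.prod (volume : Measure (ℝ × ℝ))) (μ.prod volume) :=
    (MeasurePreserving.id μ).prod (measurePreserving_add_right volume w)
  exact hmp.integral_comp' f

theorem Integrable.prod_snd_add {E : Type*} [NormedAddCommGroup E] 
    {f : X × ℝ × ℝ → E} (hf : Integrable f (μ.prod volume)) (w : ℝ × ℝ) :
    Integrable (fun z : X × ℝ × ℝ => f (z.1, z.2 + w)) (μ.prod volume) :=
  ((MeasurePreserving.id μ).prod (measurePreserving_add_right volume w)).integrable_comp_of_integrable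
    hf

end Projections
end Trudinger

/-! ### The flux error is of lower order in the time step -/

namespace Trudinger
variable {n : ℕ} {p q T : ℝ} {Ω : Set (Space n)} {ψ u u₁ u₂ : Space n × ℝ → ℝ}
  {G G₁ G₂ : Space n × ℝ → Space n}

/-- For a fixed lag `τ`, Hölder bounds the integral by a constant times the `L^q` moduli of
translation of the fluxes, which tend to zero with `τ`. Integrating over `τ ≤ h` yields `o(h)`,
enough to survive division by `h`. -/
theorem eventually_lintegral_flux_increment_le [IsFiniteMeasure (volume.restrict Ω)]
    (hpq : p.HolderConjugate q)
    (hm₁ : Measurable G₁) (hm₂ : Measurable G₂) (hG₁ : MemLp G₁ (ENNReal.ofReal p) volume)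
    (hG₂ : MemLp G₂ (ENNReal.ofReal p) volume)
    (hf₁ : MemLp (fun z => flux p (G₁ z)) (ENNReal.ofReal q) volume)
    (hf₂ : MemLp (fun z => flux p (G₂ z)) (ENNReal.ofReal q) volume) {c : ENNReal} (hc : c ≠ ⊤)
    {η : ℝ} (hη : 0 < η) (T : ℝ) :
    ∀ᶠ h in 𝓝[>] (0 : ℝ),
      ∫⁻ y, (∫⁻ τ in Ioc 0 h, ∫⁻ x in Ω,
        (‖flux p (G₁ (x, y.1 - τ)) - flux p (G₁ (x, y.1))‖ₑ
          + ‖flux p (G₂ (x, y.2 - τ)) - flux p (G₂ (x, y.2))‖ₑ)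
        * (c * (‖G₁ (x, y.1)‖ₑ + ‖G₂ (x, y.2)‖ₑ)))
        ∂((volume.restrict (Icc 0 T)).prod (volume.restrict (Icc 0 T)))
      ≤ ENNReal.ofReal η * ENNReal.ofReal h := by
  set lam : Measure ℝ := volume.restrict (Icc 0 T)
  set κ : Measure (Space n) := volume.restrict Ω
  have hfl := measurable_flux (E := Space n) (p := p)
  have hqE : (1 : ENNReal) ≤ ENNReal.ofReal q := by simpa using hpq.symm.lt.le
  set K : ENNReal := c * (lam univ ^ (1 / q) * (lam univ ^ (1 / p) *
        (eLpNorm G₁ (ENNReal.ofReal p) (κ.prod lam) + eLpNorm G₂ (ENNReal.ofReal p) (κ.prod lam))))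
    with hK
  have hle : κ.prod lam ≤ (volume : Measure (Space n × ℝ)) := by
    rw [Measure.prod_restrict, Measure.volume_eq_prod]; exact Measure.restrict_le_self
  have hKtop : K ≠ ⊤ := by
    refine ENNReal.mul_ne_top hc (ENNReal.mul_ne_top ?_ (ENNReal.mul_ne_top ?_ ?_))
    · exact (ENNReal.rpow_lt_top_of_nonneg (one_div_nonneg.2 hpq.symm.pos.le)
        (measure_ne_top _ _)).ne
    · exact (ENNReal.rpow_lt_top_of_nonneg (one_div_nonneg.2 hpq.pos.le) (measure_ne_top _ _)).ne
    · exact ENNReal.add_ne_top.2 ⟨(hG₁.mono_measure hle).2.ne, (hG₂.mono_measure hle).2.ne⟩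
  have hlim : Tendsto (fun τ : ℝ => K *
      (eLpNorm (fun z => flux p (G₁ ((0, -τ) + z)) - flux p (G₁ z)) (ENNReal.ofReal q) volume
      + eLpNorm (fun z => flux p (G₂ ((0, -τ) + z)) - flux p (G₂ z)) (ENNReal.ofReal q) volume))
      (𝓝 0) (𝓝 0) := by
    have hHaar : (volume : Measure (Space n × ℝ)).IsAddHaarMeasure := by
      rw [Measure.volume_eq_prod]; infer_instance
    have hy : Tendsto (fun τ : ℝ => ((0, -τ) : Space n × ℝ)) (𝓝 0) (𝓝 0) := by
      have : Continuous fun τ : ℝ => ((0, -τ) : Space n × ℝ) := by fun_prop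
      simpa [Prod.mk_zero_zero] using this.tendsto 0
    have l₁ := (tendsto_eLpNorm_translate hqE ENNReal.ofReal_ne_top hf₁).comp hy
    have l₂ := (tendsto_eLpNorm_translate hqE ENNReal.ofReal_ne_top hf₂).comp hy
    simpa using ENNReal.Tendsto.const_mul (l₁.add l₂) (Or.inr hKtop)
  have hev := hlim.eventually_le_const (ENNReal.ofReal_pos.2 hη)
  obtain ⟨r, hr, hrb⟩ := Metric.eventually_nhds_iff.1 hev
  filter_upwards [Ioo_mem_nhdsGT hr] with h hh
  have hmeas : Measurable fun w : ((ℝ × ℝ) × ℝ) × Space n =>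
      (‖flux p (G₁ (w.2, w.1.1.1 - w.1.2)) - flux p (G₁ (w.2, w.1.1.1))‖ₑ
          + ‖flux p (G₂ (w.2, w.1.1.2 - w.1.2)) - flux p (G₂ (w.2, w.1.1.2))‖ₑ)
        * (c * (‖G₁ (w.2, w.1.1.1)‖ₑ + ‖G₂ (w.2, w.1.1.2)‖ₑ)) := by
    have a : ∀ {G : Space n × ℝ → Space n}, Measurable G → ∀ {g : ((ℝ × ℝ) × ℝ) × Space n → ℝ},
        Measurable g → Measurable fun w => G (w.2, g w) := fun hG _ hg =>
      hG.comp (measurable_snd.prodMk hg)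
    exact (((hfl.comp (a hm₁ (by fun_prop))).sub (hfl.comp (a hm₁ (by fun_prop)))).enorm.add
      ((hfl.comp (a hm₂ (by fun_prop))).sub (hfl.comp (a hm₂ (by fun_prop)))).enorm).mul
      (((a hm₁ (by fun_prop)).enorm.add (a hm₂ (by fun_prop)).enorm).const_mul c)
  have hm2 := hmeas.lintegral_prod_right' (ν := κ)
  -- Tonelli puts the lag outermost, so the modulus estimate can be applied for one `τ` at a time.
  rw [lintegral_lintegral_swap (f := fun (y : ℝ × ℝ) (τ : ℝ) => ∫⁻ x, 
        (‖flux p (G₁ (x, y.1 - τ)) - flux p (G₁ (x, y.1))‖ₑ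
          + ‖flux p (G₂ (x, y.2 - τ)) - flux p (G₂ (x, y.2))‖ₑ)
        * (c * (‖G₁ (x, y.1)‖ₑ + ‖G₂ (x, y.2)‖ₑ)) ∂κ) hm2.aemeasurable]
  have hτ : ∀ τ ∈ Ioc 0 h, ∫⁻ y, (∫⁻ x,
        (‖flux p (G₁ (x, y.1 - τ)) - flux p (G₁ (x, y.1))‖ₑ
          + ‖flux p (G₂ (x, y.2 - τ)) - flux p (G₂ (x, y.2))‖ₑ)
        * (c * (‖G₁ (x, y.1)‖ₑ + ‖G₂ (x, y.2)‖ₑ)) ∂κ) ∂(lam.prod lam) ≤ ENNReal.ofReal η := by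
    intro τ hτ
    have hms : Measurable fun z : Space n × ℝ × ℝ =>
        (‖flux p (G₁ (z.1, z.2.1 - τ)) - flux p (G₁ (z.1, z.2.1))‖ₑ
          + ‖flux p (G₂ (z.1, z.2.2 - τ)) - flux p (G₂ (z.1, z.2.2))‖ₑ)
        * (c * (‖G₁ (z.1, z.2.1)‖ₑ + ‖G₂ (z.1, z.2.2)‖ₑ)) :=
      hmeas.comp (g := fun w : ((ℝ × ℝ) × ℝ) × Space n => _)
        (f := fun z : Space n × ℝ × ℝ => ((z.2, τ), z.1)) (by fun_prop)
    rw [← lintegral_prod_symm _ hms.aemeasurable]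
    have hA : ∀ {G : Space n × ℝ → Space n}, Measurable G →
        StronglyMeasurable fun z => flux p (G ((0, -τ) + z)) - flux p (G z) := fun hG =>
      ((hfl.comp (hG.comp (by fun_prop))).sub (hfl.comp hG)).stronglyMeasurable
    have key := lintegral_mul_le_of_holder (κ := κ) (lam := lam) hpq (hA hm₁) (hA hm₂)
      hm₁.stronglyMeasurable hm₂.stronglyMeasurable c
    have hrτ := @hrb τ (by rw [Real.dist_eq, sub_zero, abs_of_pos hτ.1]; exact hτ.2.trans_lt hh.2)
    refine le_trans (le_of_eq (lintegral_congr fun z => ?_)) (key.trans (le_trans ?_ hrτ))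
    · simp only [Prod.mk_add_mk, zero_add, neg_add_eq_sub]
    · gcongr
  refine (setLIntegral_mono' measurableSet_Ioc hτ).trans ?_
  rw [setLIntegral_const, Real.volume_Ioc, sub_zero]

end Trudinger

/-! ### The entropy inequality integrated against a doubled cutoff -/

namespace Trudinger
variable {n : ℕ} {p q T : ℝ} {Ω : Set (Space n)} {ψ u u₁ u₂ : Space n × ℝ → ℝ}
  {G G₁ G₂ : Space n × ℝ → Space n}

/-- A cutoff in two time variables `(t, s)` supported in `0 < t < s < T`. -/
structure IsDoubledCutoff (T : ℝ) (θ : ℝ × ℝ → ℝ) : Prop where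
  contDiff : ContDiff ℝ ∞ θ
  hasCompactSupport : HasCompactSupport θ
  nonneg : ∀ y, 0 ≤ θ y
  support : ∃ a > 0, ∀ y, θ y ≠ 0 → a < y.1 ∧ y.1 < y.2 ∧ y.2 < T

section Abstract
variable {X : Type*} [MeasurableSpace X] {μ : Measure X} [SFinite μ]

theorem integrable_mul_of_support_subset {E : X × ℝ × ℝ → ℝ}
    (hE : Integrable E (μ.prod ((volume.restrict (Icc 0 T)).prod (volume.restrict (Icc 0 T)))))
    {k : ℝ × ℝ → ℝ} {C : ℝ} (hk : Measurable k) (hkC : ∀ y, ‖k y‖ ≤ C)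
    (hks : ∀ y, k y ≠ 0 → y ∈ Icc 0 T ×ˢ Icc 0 T) :
    Integrable (fun z => E z * k z.2) (μ.prod volume) := by
  have hme : μ.prod ((volume.restrict (Icc 0 T)).prod (volume.restrict (Icc 0 T)))
      = (μ.prod (volume : Measure (ℝ × ℝ))).restrict (univ ×ˢ (Icc 0 T ×ˢ Icc 0 T)) := by
    rw [Measure.prod_restrict, ← Measure.prod_restrict univ, Measure.restrict_univ,
      Measure.volume_eq_prod]
  have h1 : Integrable (fun z => E z * k z.2)
      (μ.prod ((volume.restrict (Icc 0 T)).prod (volume.restrict (Icc 0 T)))) :=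
    hE.mul_bdd (c := C) (hk.comp measurable_snd).aestronglyMeasurable (ae_of_all _ fun z => hkC _)
  rw [hme] at h1
  refine (integrableOn_iff_integrable_of_support_subset fun z hz => ?_).1 h1
  exact ⟨mem_univ _, hks _ (right_ne_zero_of_mul hz)⟩

/-- Discrete integration by parts: translation invariance of Lebesgue measure in the time plane
moves the shift from `θ` onto `E` and `F`. -/
theorem integral_shift_eq {E F : X × ℝ × ℝ → ℝ} {θ : ℝ × ℝ → ℝ} {w₁ w₂ : ℝ × ℝ}
    (hE : Integrable (fun z => E z * θ z.2) (μ.prod volume))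
    (hF : Integrable (fun z => F z * θ z.2) (μ.prod volume))
    (hE' : Integrable (fun z => E z * θ (z.2 + w₁)) (μ.prod volume))
    (hF' : Integrable (fun z => F z * θ (z.2 + w₂)) (μ.prod volume)) :
    ∫ z, E z * (θ z.2 - θ (z.2 + w₁)) ∂(μ.prod volume)
      + ∫ z, F z * (θ z.2 - θ (z.2 + w₂)) ∂(μ.prod volume)
      = ∫ y, (∫ x, (E (x, y) - E (x, y - w₁) + (F (x, y) - F (x, y - w₂))) ∂μ) * θ y := by
  have hs : ∀ {E : X × ℝ × ℝ → ℝ} {w : ℝ × ℝ},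
      Integrable (fun z => E z * θ (z.2 + w)) (μ.prod volume) →
      Integrable (fun z => E (z.1, z.2 - w) * θ z.2) (μ.prod volume) := fun {E w} h => by
    simpa [sub_eq_add_neg] using Integrable.prod_snd_add h (-w)
  have hi : ∀ (E : X × ℝ × ℝ → ℝ) (w : ℝ × ℝ), ∫ z, E z * θ (z.2 + w) ∂(μ.prod volume)
      = ∫ z, E (z.1, z.2 - w) * θ z.2 ∂(μ.prod volume) := fun E w => by
    simpa using integral_prod_snd_add (μ := μ) (fun z => E (z.1, z.2 - w) * θ z.2) w
  have hdE : Integrable (fun z => E z * θ z.2 - E (z.1, z.2 - w₁) * θ z.2) (μ.prod volume) :=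
    hE.sub (hs hE')
  have hdF : Integrable (fun z => F z * θ z.2 - F (z.1, z.2 - w₂) * θ z.2) (μ.prod volume) :=
    hF.sub (hs hF')
  simp_rw [mul_sub]
  rw [integral_sub hE hE', integral_sub hF hF', hi E, hi F, ← integral_sub hE (hs hE'),
    ← integral_sub hF (hs hF'), ← integral_add hdE hdF]
  refine (integral_prod_symm _ (hdE.add hdF)).trans ?_
  refine integral_congr_ae (ae_of_all _ fun y => ?_)
  beta_reduce
  rw [← integral_mul_const]
  refine integral_congr_ae (ae_of_all _ fun x => ?_)
  simp only [Pi.add_apply]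
  ring

end Abstract

theorem IsIncrementSolution.memLp_b (hp : 1 < p) (hpq : p.HolderConjugate q)
    (h : IsIncrementSolution p Ω T ψ u G) :
    MemLp (fun z => b p (u z)) (ENNReal.ofReal q) volume :=
  MemLp.norm_rpow_sub_one hpq h.memLp
    ((continuous_b hp).measurable.comp h.measurable).aestronglyMeasurable fun _ => abs_b hp _

theorem IsIncrementSolution.memLp_flux (hp : 1 < p) (hpq : p.HolderConjugate q)
    (h : IsIncrementSolution p Ω T ψ u G) :
    MemLp (fun z => flux p (G z)) (ENNReal.ofReal q) volume :=
  MemLp.norm_rpow_sub_one hpq h.memLp_grad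
    (measurable_flux.comp h.measurable_grad).aestronglyMeasurable fun _ => norm_flux hp _

section Entropy
variable [IsFiniteMeasure (volume.restrict Ω)]

theorem IsIncrementSolution.integrable_b_fst (hp : 1 < p) (hpq : p.HolderConjugate q)
    (h : IsIncrementSolution p Ω T ψ u G) :
    Integrable (fun z : Space n × ℝ × ℝ => b p (u (z.1, z.2.1)))
      ((volume.restrict Ω).prod ((volume.restrict (Icc 0 T)).prod (volume.restrict (Icc 0 T)))) := by
  refine MemLp.integrable (q := ENNReal.ofReal q) (by simpa using hpq.symm.lt.le)
    (MemLp.comp_prodAssoc (f := fun z => b p (u z)) hpq.symm.pos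
    ((continuous_b hp).measurable.comp h.measurable).stronglyMeasurable ?_)
  rw [Measure.prod_restrict]
  exact (h.memLp_b hp hpq).restrict _

theorem IsIncrementSolution.integrable_b_snd (hp : 1 < p) (hpq : p.HolderConjugate q)
    (h : IsIncrementSolution p Ω T ψ u G) :
    Integrable (fun z : Space n × ℝ × ℝ => b p (u (z.1, z.2.2)))
      ((volume.restrict Ω).prod ((volume.restrict (Icc 0 T)).prod (volume.restrict (Icc 0 T)))) := by
  refine MemLp.integrable (q := ENNReal.ofReal q) (by simpa using hpq.symm.lt.le)
    (MemLp.comp_prodAssoc_swap (f := fun z => b p (u z)) hpq.symm.pos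
    ((continuous_b hp).measurable.comp h.measurable).stronglyMeasurable ?_)
  rw [Measure.prod_restrict]
  exact (h.memLp_b hp hpq).restrict _

theorem integrable_doubled_entropyLeft (hp : 1 < p) (hpq : p.HolderConjugate q)
    (h₁ : IsIncrementSolution p Ω T ψ u₁ G₁) (h₂ : IsIncrementSolution p Ω T ψ u₂ G₂)
    {δ : ℝ} (hδ : 0 ≤ δ) :
    Integrable (fun z : Space n × ℝ × ℝ => entropyLeft p δ (u₁ (z.1, z.2.1)) (u₂ (z.1, z.2.2)))
      ((volume.restrict Ω).prod ((volume.restrict (Icc 0 T)).prod (volume.restrict (Icc 0 T)))) :=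
  integrable_entropyLeft hp hδ (h₁.measurable.comp (by fun_prop)).aestronglyMeasurable
    (h₂.measurable.comp (by fun_prop)).aestronglyMeasurable (h₁.integrable_b_fst hp hpq)
    (h₂.integrable_b_snd hp hpq)

theorem integrable_doubled_entropyRight (hp : 1 < p) (hpq : p.HolderConjugate q)
    (h₁ : IsIncrementSolution p Ω T ψ u₁ G₁) (h₂ : IsIncrementSolution p Ω T ψ u₂ G₂)
    {δ : ℝ} (hδ : 0 ≤ δ) :
    Integrable (fun z : Space n × ℝ × ℝ => entropyRight p δ (u₁ (z.1, z.2.1)) (u₂ (z.1, z.2.2)))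
      ((volume.restrict Ω).prod ((volume.restrict (Icc 0 T)).prod (volume.restrict (Icc 0 T)))) :=
  integrable_entropyRight hp hδ (h₁.measurable.comp (by fun_prop)).aestronglyMeasurable
    (h₂.measurable.comp (by fun_prop)).aestronglyMeasurable (h₁.integrable_b_fst hp hpq)
    (h₂.integrable_b_snd hp hpq)

/-- After summation by parts the inner integral is the increment handled by
`ofReal_integral_entropy_le`. It is applied only where `θ ≠ 0`, which guarantees `t < s`; there
almost every pair consists of admissible times. -/
theorem eventually_integral_entropy_shift_le (hp : 1 < p) (hpq : p.HolderConjugate q)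
    (hΩ : IsOpen Ω) (hΩb : Bornology.IsBounded Ω)
    (hψc : ∀ t ∈ Ioo 0 T, ContinuousOn (fun x => ψ (x, t)) (closure Ω))
    (hψm : ∀ x ∈ frontier Ω, ∀ t s : ℝ, 0 < t → t < s → s < T → ψ (x, t) ≤ ψ (x, s))
    (h₁ : IsIncrementSolution p Ω T ψ u₁ G₁) (h₂ : IsIncrementSolution p Ω T ψ u₂ G₂)
    {θ : ℝ × ℝ → ℝ} (hθ : IsDoubledCutoff T θ) {δ η : ℝ} (hδ : 0 < δ) (hη : 0 < η) :
    ∀ᶠ h in 𝓝[>] (0 : ℝ),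
      ∫ z : Space n × ℝ × ℝ, entropyLeft p δ (u₁ (z.1, z.2.1)) (u₂ (z.1, z.2.2))
        * (θ z.2 - θ (z.2 + (h, 0))) ∂((volume.restrict Ω).prod volume)
      + ∫ z : Space n × ℝ × ℝ, entropyRight p δ (u₁ (z.1, z.2.1)) (u₂ (z.1, z.2.2))
        * (θ z.2 - θ (z.2 + (0, h))) ∂((volume.restrict Ω).prod volume) ≤ η * h := by
  obtain ⟨S₁, hS₁, hb₁, hi₁⟩ := h₁.exists_good_times
  obtain ⟨S₂, hS₂, hb₂, hi₂⟩ := h₂.exists_good_times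
  obtain ⟨a, ha, hsupp⟩ := hθ.support
  obtain ⟨B, hB⟩ := hθ.hasCompactSupport.exists_bound_of_continuous hθ.contDiff.continuous
  obtain ⟨C, hC⟩ := exists_layerWeight_le
  have hB1 : 0 < |B| + 1 := by positivity
  have hθm : Measurable θ := hθ.contDiff.continuous.measurable
  have hf₁ := h₁.memLp_flux hp hpq
  have hf₂ := h₂.memLp_flux hp hpq
  -- The cutoff is bounded by `|B| + 1`, so the rate `η / (|B| + 1)` becomes `η` after
  -- multiplication. Requiring `h < a` keeps the backward shifts inside the time interval.
  filter_upwards [eventually_lintegral_flux_increment_le hpq h₁.measurable_grad h₂.measurable_grad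
    h₁.memLp_grad h₂.memLp_grad hf₁ hf₂ (Ω := Ω)
    (c := ENNReal.ofReal (C * (1 / δ))) ENNReal.ofReal_ne_top
    (div_pos hη hB1) T, Ioo_mem_nhdsGT ha] with h hh hha
  have iE := integrable_doubled_entropyLeft hp hpq h₁ h₂ hδ.le
  have iF := integrable_doubled_entropyRight hp hpq h₁ h₂ hδ.le
  have hbox : ∀ y, θ y ≠ 0 → y ∈ Icc 0 T ×ˢ Icc 0 T := fun y hy => by
    obtain ⟨k1, k2, k3⟩ := hsupp y hy
    exact ⟨⟨by linarith, by linarith⟩, ⟨by linarith, by linarith⟩⟩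
  have hbox₁ : ∀ y : ℝ × ℝ, θ (y + (h, 0)) ≠ 0 → y ∈ Icc 0 T ×ˢ Icc 0 T := fun y hy => by
    obtain ⟨k1, k2, k3⟩ := hsupp _ hy
    simp only [Prod.fst_add, Prod.snd_add, add_zero] at k1 k2 k3
    exact ⟨⟨by linarith [hha.2], by linarith [hha.1]⟩, ⟨by linarith [hha.1], by linarith⟩⟩
  have hbox₂ : ∀ y : ℝ × ℝ, θ (y + (0, h)) ≠ 0 → y ∈ Icc 0 T ×ˢ Icc 0 T := fun y hy => by
    obtain ⟨k1, k2, k3⟩ := hsupp _ hy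
    simp only [Prod.fst_add, Prod.snd_add, add_zero] at k1 k2 k3
    exact ⟨⟨by linarith, by linarith [hha.1]⟩, ⟨by linarith [hha.2], by linarith [hha.1]⟩⟩
  rw [integral_shift_eq (integrable_mul_of_support_subset iE hθm hB hbox)
    (integrable_mul_of_support_subset iF hθm hB hbox)
    (integrable_mul_of_support_subset iE (hθm.comp (by fun_prop)) (fun y => hB _) hbox₁)
    (integrable_mul_of_support_subset iF (hθm.comp (by fun_prop)) (fun y => hB _) hbox₂)]
  refine (ENNReal.ofReal_le_ofReal_iff (mul_nonneg hη.le hha.1.le)).1 ?_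
  refine (ofReal_integral_le_lintegral _).trans ?_
  have hfst : ∀ {P : ℝ → Prop}, (∀ᵐ t : ℝ, P t) → ∀ᵐ y : ℝ × ℝ, P y.1 :=
    fun hP => Measure.quasiMeasurePreserving_fst.ae hP
  have hsnd : ∀ {P : ℝ → Prop}, (∀ᵐ t : ℝ, P t) → ∀ᵐ y : ℝ × ℝ, P y.2 :=
    fun hP => Measure.quasiMeasurePreserving_snd.ae hP
  have hsh : ∀ {P : ℝ → Prop}, (∀ᵐ t : ℝ, P t) → ∀ᵐ t : ℝ, P (t - h) :=
    fun hP => (measurePreserving_sub_right volume h).quasiMeasurePreserving.ae hP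
  set R : ℝ × ℝ → ENNReal := fun y => ∫⁻ τ in Ioc 0 h, ∫⁻ x in Ω,
        (‖flux p (G₁ (x, y.1 - τ)) - flux p (G₁ (x, y.1))‖ₑ
          + ‖flux p (G₂ (x, y.2 - τ)) - flux p (G₂ (x, y.2))‖ₑ)
        * (ENNReal.ofReal (C * (1 / δ)) * (‖G₁ (x, y.1)‖ₑ + ‖G₂ (x, y.2)‖ₑ)) with hR
  calc _ ≤ ∫⁻ y, (Icc 0 T ×ˢ Icc 0 T).indicator (fun y => ENNReal.ofReal (|B| + 1) * R y) y := by
        refine lintegral_mono_ae ?_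
        filter_upwards [hfst hS₁, hfst (hsh hS₁), hsnd hS₂, hsnd (hsh hS₂)] with y m₁ m₁' m₂ m₂'
        by_cases hy : θ y = 0
        · simp [hy]
        rw [indicator_of_mem (hbox y hy), ENNReal.ofReal_mul' (hθ.nonneg y), mul_comm]
        obtain ⟨k1, k2, k3⟩ := hsupp y hy
        refine mul_le_mul' (ENNReal.ofReal_le_ofReal ?_) ?_
        · linarith [le_abs_self B, (le_abs_self _).trans (hB y)]
        · have := ofReal_integral_entropy_le hp hpq hΩ hΩb hψc hψm hf₁ hf₂ hS₁ hS₂ hb₁ hb₂ hi₁ hi₂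
            hC hδ (t := y.1) (s := y.2) hha.1 (by linarith [hha.2]) k2 k3 m₁ m₁' m₂ m₂'
          simpa only [Prod.fst_sub, Prod.snd_sub, sub_zero] using this
    _ = ENNReal.ofReal (|B| + 1) * ∫⁻ y, R y
        ∂((volume.restrict (Icc 0 T)).prod (volume.restrict (Icc 0 T))) := by
        rw [lintegral_indicator (measurableSet_Icc.prod measurableSet_Icc),
          lintegral_const_mul' _ _ ENNReal.ofReal_ne_top, Measure.volume_eq_prod,
          Measure.prod_restrict]
    _ ≤ ENNReal.ofReal (|B| + 1) * (ENNReal.ofReal (η / (|B| + 1)) * ENNReal.ofReal h) := by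
        gcongr
    _ = ENNReal.ofReal (η * h) := by
        rw [← mul_assoc, ← ENNReal.ofReal_mul hB1.le, mul_div_cancel₀ _ hB1.ne',
          ENNReal.ofReal_mul hη.le]

end Entropy
end Trudinger

/-! ### Limits in the time step and in the truncation level -/

namespace Trudinger
variable {n : ℕ} {p q T : ℝ} {Ω : Set (Space n)} {ψ u u₁ u₂ : Space n × ℝ → ℝ}
  {G G₁ G₂ : Space n × ℝ → Space n}

/-- The Lipschitz constant of `θ` bounds its difference quotients uniformly, and they are supported
in a fixed box, so dominated convergence applies. -/
theorem tendsto_integral_mul_slope {X : Type*} [MeasurableSpace X] {μ : Measure X} [SFinite μ]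
    {g : X × ℝ × ℝ → ℝ}
    (hg : Integrable g (μ.prod ((volume.restrict (Icc 0 T)).prod (volume.restrict (Icc 0 T)))))
    (hgm : Measurable g) {θ : ℝ × ℝ → ℝ} (hθ : ContDiff ℝ ∞ θ) (hθc : HasCompactSupport θ)
    (hbox : ∀ y, θ y ≠ 0 → y ∈ Icc 0 T ×ˢ Icc 0 T) {w : ℝ × ℝ}
    (hw : ∀ᶠ h in 𝓝[>] (0 : ℝ), ∀ y, θ (y + h • w) ≠ 0 → y ∈ Icc 0 T ×ˢ Icc 0 T) :
    Tendsto (fun h => h⁻¹ * ∫ z, g z * (θ z.2 - θ (z.2 + h • w)) ∂(μ.prod volume))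
      (𝓝[>] (0 : ℝ)) (𝓝 (-∫ z, g z * fderiv ℝ θ z.2 w ∂(μ.prod volume))) := by
  obtain ⟨L, hL⟩ := hθ.lipschitzWith_of_hasCompactSupport hθc (by simp)
  simp_rw [← integral_const_mul]
  rw [← integral_neg]
  have hbd : Integrable (fun z => ‖g z‖ *
      (Icc 0 T ×ˢ Icc 0 T : Set (ℝ × ℝ)).indicator (fun _ => (L : ℝ) * ‖w‖) z.2)
      (μ.prod volume) := by
    refine integrable_mul_of_support_subset (C := L * ‖w‖) hg.norm
      (measurable_const.indicator (measurableSet_Icc.prod measurableSet_Icc)) (fun y => ?_)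
      fun y hy => mem_of_indicator_ne_zero hy
    refine (norm_indicator_le_norm_self _ _).trans_eq ?_
    rw [Real.norm_of_nonneg (by positivity)]
  refine tendsto_integral_filter_of_dominated_convergence _ (Eventually.of_forall fun h => ?_) ?_
    hbd (ae_of_all _ fun z => ?_)
  · have hθm : Measurable θ := hθ.continuous.measurable
    have : Measurable fun z : X × ℝ × ℝ => h⁻¹ * (g z * (θ z.2 - θ (z.2 + h • w))) :=
      (hgm.mul ((hθm.comp measurable_snd).sub (hθm.comp (by fun_prop)))).const_mul _
    exact this.aestronglyMeasurable
  · filter_upwards [hw, self_mem_nhdsWithin] with h hh hpos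
    refine ae_of_all _ fun z => ?_
    have hpos' : 0 < h := hpos
    by_cases hz : z.2 ∈ (Icc 0 T ×ˢ Icc 0 T : Set (ℝ × ℝ))
    · rw [indicator_of_mem hz, norm_mul, norm_mul, Real.norm_of_nonneg (inv_nonneg.2 hpos'.le),
        mul_left_comm]
      refine mul_le_mul_of_nonneg_left ?_ (norm_nonneg _)
      rw [inv_mul_le_iff₀ hpos', ← dist_eq_norm]
      refine (hL.dist_le_mul _ _).trans_eq ?_
      rw [dist_self_add_right, norm_smul, Real.norm_of_nonneg hpos'.le]
      ring
    · have e1 : θ z.2 = 0 := by_contra fun h => hz (hbox _ h)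
      have e2 : θ (z.2 + h • w) = 0 := by_contra fun h => hz (hh _ h)
      rw [indicator_of_notMem hz, e1, e2]
      simp
  · have hd := ((hθ.differentiable (by simp)).differentiableAt
      (x := z.2)).hasFDerivAt.hasLineDerivAt w
    have h1 := (hd.tendsto_slope_zero_right.neg).const_mul (g z)
    rw [← mul_neg]
    refine h1.congr fun h => ?_
    rw [smul_eq_mul]
    ring

theorem IsDoubledCutoff.mem_box {θ : ℝ × ℝ → ℝ} (hθ : IsDoubledCutoff T θ) {y : ℝ × ℝ}
    (hy : θ y ≠ 0) : y ∈ Icc 0 T ×ˢ Icc 0 T := by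
  obtain ⟨a, ha, h⟩ := hθ.support
  obtain ⟨k1, k2, k3⟩ := h y hy
  exact ⟨⟨by linarith, by linarith⟩, ⟨by linarith, by linarith⟩⟩

theorem IsDoubledCutoff.mem_box_of_fderiv {θ : ℝ × ℝ → ℝ} (hθ : IsDoubledCutoff T θ)
    {y w : ℝ × ℝ} (hy : fderiv ℝ θ y w ≠ 0) : y ∈ Icc 0 T ×ˢ Icc 0 T := by
  have h1 : y ∈ tsupport θ := support_fderiv_subset ℝ fun h => hy (by rw [h]; rfl)
  exact closure_minimal (fun y hy => hθ.mem_box hy) (isClosed_Icc.prod isClosed_Icc) h1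

theorem measurable_entropyLeft {X : Type*} [MeasurableSpace X] (hp : 1 < p) (δ : ℝ) {w z : X → ℝ}
    (hw : Measurable w) (hz : Measurable z) :
    Measurable fun x => entropyLeft p δ (w x) (z x) :=
  (continuous_entropyLeft hp).measurable.comp (f := fun x => ((δ, w x, z x) : ℝ × ℝ × ℝ))
    (measurable_const.prodMk (hw.prodMk hz))

theorem measurable_entropyRight {X : Type*} [MeasurableSpace X] (hp : 1 < p) (δ : ℝ) {w z : X → ℝ}
    (hw : Measurable w) (hz : Measurable z) :
    Measurable fun x => entropyRight p δ (w x) (z x) :=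
  (continuous_entropyRight hp).measurable.comp (f := fun x => ((δ, w x, z x) : ℝ × ℝ × ℝ))
    (measurable_const.prodMk (hw.prodMk hz))

section Entropy
variable [IsFiniteMeasure (volume.restrict Ω)]

theorem integral_entropy_nonneg (hp : 1 < p) (hpq : p.HolderConjugate q)
    (hΩ : IsOpen Ω) (hΩb : Bornology.IsBounded Ω)
    (hψc : ∀ t ∈ Ioo 0 T, ContinuousOn (fun x => ψ (x, t)) (closure Ω))
    (hψm : ∀ x ∈ frontier Ω, ∀ t s : ℝ, 0 < t → t < s → s < T → ψ (x, t) ≤ ψ (x, s))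
    (h₁ : IsIncrementSolution p Ω T ψ u₁ G₁) (h₂ : IsIncrementSolution p Ω T ψ u₂ G₂)
    {θ : ℝ × ℝ → ℝ} (hθ : IsDoubledCutoff T θ) {δ : ℝ} (hδ : 0 < δ) :
    0 ≤ ∫ z : Space n × ℝ × ℝ, entropyLeft p δ (u₁ (z.1, z.2.1)) (u₂ (z.1, z.2.2))
        * fderiv ℝ θ z.2 (1, 0) ∂((volume.restrict Ω).prod volume)
      + ∫ z : Space n × ℝ × ℝ, entropyRight p δ (u₁ (z.1, z.2.1)) (u₂ (z.1, z.2.2))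
        * fderiv ℝ θ z.2 (0, 1) ∂((volume.restrict Ω).prod volume) := by
  obtain ⟨a, ha, hsupp⟩ := hθ.support
  have l₁ := tendsto_integral_mul_slope (integrable_doubled_entropyLeft hp hpq h₁ h₂ hδ.le)
    (measurable_entropyLeft hp δ (h₁.measurable.comp (by fun_prop)) (h₂.measurable.comp (by fun_prop)))
    hθ.contDiff hθ.hasCompactSupport
    (fun y => hθ.mem_box) (w := (1, 0)) (by
      filter_upwards [Ioo_mem_nhdsGT ha] with h hh y hy
      obtain ⟨k1, k2, k3⟩ := hsupp _ hy
      simp only [Prod.fst_add, Prod.snd_add, Prod.smul_mk, smul_eq_mul, mul_one, mul_zero,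
        add_zero] at k1 k2 k3
      exact ⟨⟨by linarith [hh.2], by linarith [hh.1]⟩, ⟨by linarith [hh.1], by linarith⟩⟩)
  have l₂ := tendsto_integral_mul_slope (integrable_doubled_entropyRight hp hpq h₁ h₂ hδ.le)
    (measurable_entropyRight hp δ (h₁.measurable.comp (by fun_prop)) (h₂.measurable.comp (by fun_prop)))
    hθ.contDiff hθ.hasCompactSupport
    (fun y => hθ.mem_box) (w := (0, 1)) (by
      filter_upwards [Ioo_mem_nhdsGT ha] with h hh y hy
      obtain ⟨k1, k2, k3⟩ := hsupp _ hy
      simp only [Prod.fst_add, Prod.snd_add, Prod.smul_mk, smul_eq_mul, mul_one, mul_zero,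
        add_zero] at k1 k2 k3
      exact ⟨⟨by linarith, by linarith [hh.1]⟩, ⟨by linarith [hh.2], by linarith [hh.1]⟩⟩)
  -- Dividing the shift inequality by `h` leaves the arbitrary constant `η`; the sign reverses
  -- because the quotients converge to minus the derivatives of `θ`.
  refine le_of_forall_pos_le_add fun η hη => ?_
  have hle := le_of_tendsto (l₁.add l₂) (b := η) (by
    filter_upwards [eventually_integral_entropy_shift_le hp hpq hΩ hΩb hψc hψm h₁ h₂ hθ hδ hη,
      self_mem_nhdsWithin] with h hh hpos
    rw [← mul_add, inv_mul_le_iff₀ hpos, mul_comm h]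
    simpa only [Prod.smul_mk, smul_eq_mul, mul_one, mul_zero] using hh)
  rwa [← neg_add, neg_le_iff_add_nonneg, add_comm] at hle

/-- At `δ = 0` both entropies reduce to the same positive part, so the two partial derivatives of
`θ` combine into its derivative along the diagonal direction. -/
theorem integral_max_sub_nonneg (hp : 1 < p) (hpq : p.HolderConjugate q)
    (hΩ : IsOpen Ω) (hΩb : Bornology.IsBounded Ω)
    (hψc : ∀ t ∈ Ioo 0 T, ContinuousOn (fun x => ψ (x, t)) (closure Ω))
    (hψm : ∀ x ∈ frontier Ω, ∀ t s : ℝ, 0 < t → t < s → s < T → ψ (x, t) ≤ ψ (x, s))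
    (h₁ : IsIncrementSolution p Ω T ψ u₁ G₁) (h₂ : IsIncrementSolution p Ω T ψ u₂ G₂)
    {θ : ℝ × ℝ → ℝ} (hθ : IsDoubledCutoff T θ) :
    0 ≤ ∫ z : Space n × ℝ × ℝ, max (b p (u₁ (z.1, z.2.1)) - b p (u₂ (z.1, z.2.2))) 0
        * fderiv ℝ θ z.2 (1, 1) ∂((volume.restrict Ω).prod volume) := by
  have hcw : ∀ w, Continuous fun y => fderiv ℝ θ y w := fun w =>
    (hθ.contDiff.continuous_fderiv (by simp)).clm_apply continuous_const
  have hcb : ∀ w, ∃ C, ∀ y, ‖fderiv ℝ θ y w‖ ≤ C := fun w =>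
    (hθ.hasCompactSupport.fderiv_apply (𝕜 := ℝ) w).exists_bound_of_continuous (hcw w)
  have hint : ∀ {E : Space n × ℝ × ℝ → ℝ} (w : ℝ × ℝ), Integrable E
      ((volume.restrict Ω).prod ((volume.restrict (Icc 0 T)).prod (volume.restrict (Icc 0 T)))) →
      Integrable (fun z => E z * fderiv ℝ θ z.2 w) ((volume.restrict Ω).prod volume) :=
    fun w hE => by
      obtain ⟨C, hC⟩ := hcb w
      exact integrable_mul_of_support_subset hE (hcw w).measurable hC
        fun y hy => hθ.mem_box_of_fderiv hy
  have hD := (h₁.integrable_b_fst hp hpq).norm.add (h₂.integrable_b_snd hp hpq).norm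
  have hm : ∀ δ : ℝ, Measurable fun z : Space n × ℝ × ℝ =>
      ((δ, u₁ (z.1, z.2.1), u₂ (z.1, z.2.2)) : ℝ × ℝ × ℝ) := fun δ =>
    measurable_const.prodMk ((h₁.measurable.comp (by fun_prop)).prodMk
      (h₂.measurable.comp (by fun_prop)))
  have hlim : ∀ (e : ℝ → ℝ → ℝ → ℝ), (Continuous fun z : ℝ × ℝ × ℝ => e z.1 z.2.1 z.2.2) →
      (∀ a c, e 0 a c = max (b p a - b p c) 0) →
      (∀ {δ : ℝ}, 0 ≤ δ → ∀ a c, |e δ a c| ≤ |b p a| + |b p c|) → ∀ w : ℝ × ℝ,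
      Tendsto (fun δ => ∫ z : Space n × ℝ × ℝ, e δ (u₁ (z.1, z.2.1)) (u₂ (z.1, z.2.2))
        * fderiv ℝ θ z.2 w ∂((volume.restrict Ω).prod volume)) (𝓝[>] 0)
        (𝓝 (∫ z : Space n × ℝ × ℝ, max (b p (u₁ (z.1, z.2.1)) - b p (u₂ (z.1, z.2.2))) 0
          * fderiv ℝ θ z.2 w ∂((volume.restrict Ω).prod volume))) := by
    intro e hec he0 heb w
    refine tendsto_integral_filter_of_dominated_convergence _ (Eventually.of_forall fun δ => ?_) ?_
      (hint w hD).norm (ae_of_all _ fun z => ?_)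
    · exact ((hec.measurable.comp (hm δ)).mul
        ((hcw w).measurable.comp measurable_snd)).aestronglyMeasurable
    · filter_upwards [self_mem_nhdsWithin] with δ hδ
      refine ae_of_all _ fun z => ?_
      rw [norm_mul, norm_mul]
      gcongr
      refine (heb (le_of_lt hδ) _ _).trans (le_abs_self _)
    · rw [← he0]
      have : Continuous fun δ : ℝ => e δ (u₁ (z.1, z.2.1)) (u₂ (z.1, z.2.2)) :=
        hec.comp (f := fun δ : ℝ => ((δ, u₁ (z.1, z.2.1), u₂ (z.1, z.2.2)) : ℝ × ℝ × ℝ))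
          (by fun_prop)
      exact ((this.tendsto 0).mono_left nhdsWithin_le_nhds).mul_const _
  have l₁ := hlim (entropyLeft p) (continuous_entropyLeft hp) entropyLeft_zero
    (abs_entropyLeft_le hp) (1, 0)
  have l₂ := hlim (entropyRight p) (continuous_entropyRight hp) entropyRight_zero
    (abs_entropyRight_le hp) (0, 1)
  have h0 := ge_of_tendsto (l₁.add l₂) (by
    filter_upwards [self_mem_nhdsWithin] with δ hδ
    exact integral_entropy_nonneg hp hpq hΩ hΩb hψc hψm h₁ h₂ hθ hδ)
  have hmax : Integrable (fun z : Space n × ℝ × ℝ =>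
      max (b p (u₁ (z.1, z.2.1)) - b p (u₂ (z.1, z.2.2))) 0) ((volume.restrict Ω).prod
        ((volume.restrict (Icc 0 T)).prod (volume.restrict (Icc 0 T)))) :=
    ((h₁.integrable_b_fst hp hpq).sub (h₂.integrable_b_snd hp hpq)).pos_part
  rw [← integral_add (hint _ hmax) (hint _ hmax)] at h0
  refine h0.trans_eq (integral_congr_ae (ae_of_all _ fun z => ?_))
  beta_reduce
  rw [← mul_add, ← map_add]
  simp

end Entropy
end Trudinger

/-! ### Return to a single time variable -/

namespace Trudinger
variable {n : ℕ} {p q T : ℝ} {Ω : Set (Space n)} {ψ u u₁ u₂ : Space n × ℝ → ℝ}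
  {G G₁ G₂ : Space n × ℝ → Space n}

/-- The support lies strictly to the right of `0`: the kernel in `s - t` must respect the order `t <
s` imposed by the boundary monotonicity. -/
theorem exists_bump_lt {ε : ℝ} (hε : 0 < ε) :
    ∃ k : ℝ → ℝ, ContDiff ℝ ∞ k ∧ HasCompactSupport k ∧ (∀ s, 0 ≤ k s) ∧ ∫ s, k s = 1 ∧
      ∀ s, k s ≠ 0 → s ∈ Ioo 0 ε := by
  let β : ContDiffBump (ε / 2) := ⟨ε / 8, ε / 4, by positivity, by linarith⟩
  refine ⟨β.normed volume, β.contDiff_normed, β.hasCompactSupport_normed,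
    fun s => β.nonneg_normed s, β.integral_normed, fun s hs => ?_⟩
  have h : s ∈ Metric.ball (ε / 2) (ε / 4) := by
    have : s ∈ Function.support (β.normed volume) := hs
    rwa [β.support_normed_eq] at this
  rw [Real.ball_eq_Ioo] at h
  exact ⟨by linarith [h.1], by linarith [h.2]⟩

theorem IsTestFunction.exists_margin {η : ℝ → ℝ} (hη : IsTestFunction (Ioo 0 T) η) :
    ∃ a > 0, ∀ t, η t ≠ 0 → a < t ∧ t + a < T := by
  obtain ⟨δ, hδ, h⟩ := hη.2.1.exists_cthickening_subset_open isOpen_Ioo hη.2.2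
  refine ⟨δ / 2, by positivity, fun t ht => ?_⟩
  have hm : ∀ s, |s - t| ≤ δ → s ∈ Ioo 0 T := fun s hs =>
    h (Metric.mem_cthickening_of_dist_le s t δ _ (subset_tsupport _ ht) (by rwa [Real.dist_eq]))
  have h1 := hm (t - δ) (by rw [sub_sub_cancel_left, abs_neg, abs_of_pos hδ])
  have h2 := hm (t + δ) (by rw [add_sub_cancel_left, abs_of_pos hδ])
  exact ⟨by linarith [h1.1], by linarith [h2.2]⟩

/-- The margin `a` of `η` serves twice: it keeps `t` away from `0`, and it leaves room for `s = t +
σ < T` when `σ < a`. -/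
theorem isDoubledCutoff_mul {η k : ℝ → ℝ} {a : ℝ} (ha : 0 < a) (hη : ContDiff ℝ ∞ η)
    (hηc : HasCompactSupport η) (hη0 : ∀ t, 0 ≤ η t) (hηa : ∀ t, η t ≠ 0 → a < t ∧ t + a < T)
    (hk : ContDiff ℝ ∞ k) (hkc : HasCompactSupport k) (hk0 : ∀ s, 0 ≤ k s)
    (hka : ∀ s, k s ≠ 0 → s ∈ Ioo 0 a) :
    IsDoubledCutoff T fun y => η y.1 * k (y.2 - y.1) where
  contDiff := (hη.comp contDiff_fst).mul (hk.comp (contDiff_snd.sub contDiff_fst))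
  hasCompactSupport := by
    refine HasCompactSupport.intro ((hηc.isCompact.prod hkc.isCompact).image
      (f := fun y : ℝ × ℝ => (y.1, y.1 + y.2)) (by fun_prop)) fun y hy => ?_
    by_contra h
    exact hy ⟨(y.1, y.2 - y.1), ⟨subset_tsupport _ (left_ne_zero_of_mul h),
      subset_tsupport _ (right_ne_zero_of_mul h)⟩, by simp⟩
  nonneg y := mul_nonneg (hη0 _) (hk0 _)
  support := by
    refine ⟨a, ha, fun y hy => ?_⟩
    have h1 := hηa _ (left_ne_zero_of_mul hy)
    have h2 := hka _ (right_ne_zero_of_mul hy)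
    exact ⟨h1.1, by linarith [h2.1], by linarith [h2.2]⟩

/-- Along the diagonal direction `s - t` is constant, so the concentrating factor is never
differentiated and the kernel may be shrunk. -/
theorem fderiv_mul_comp_sub {η k : ℝ → ℝ} (hη : ContDiff ℝ ∞ η) (hk : ContDiff ℝ ∞ k) (y : ℝ × ℝ) :
    fderiv ℝ (fun y : ℝ × ℝ => η y.1 * k (y.2 - y.1)) y (1, 1) = deriv η y.1 * k (y.2 - y.1) := by
  have hd : ContDiff ℝ ∞ fun y : ℝ × ℝ => η y.1 * k (y.2 - y.1) :=
    (hη.comp contDiff_fst).mul (hk.comp (contDiff_snd.sub contDiff_fst))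
  have h1 := ((hd.differentiable (by simp)).differentiableAt
    (x := y)).hasFDerivAt.hasLineDerivAt (1, 1)
  have h2 : HasDerivAt (fun r : ℝ => η (y.1 + r) * k (y.2 - y.1))
      (deriv η y.1 * k (y.2 - y.1)) 0 := by
    have h3 : HasDerivAt η (deriv η (y.1 + 0)) (y.1 + 0) :=
      ((hη.differentiable (by simp)).differentiableAt).hasDerivAt
    have h4 := (h3.comp_const_add y.1 0).mul_const (k (y.2 - y.1))
    rwa [add_zero] at h4
  refine HasDerivAt.unique h1 (h2.congr_of_eventuallyEq (Eventually.of_forall fun r => ?_))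
  simp

theorem integral_shear_eq {X : Type*} [MeasurableSpace X] {μ : Measure X} [SFinite μ]
    {F : X × ℝ × ℝ → ℝ} (hF : Measurable F) :
    ∫ z, F z ∂(μ.prod volume) = ∫ w : (X × ℝ) × ℝ, F (w.1.1, w.1.2, w.1.2 + w.2)
      ∂((μ.prod volume).prod volume) ∧
    (Integrable F (μ.prod volume) → Integrable (fun w : (X × ℝ) × ℝ =>
      F (w.1.1, w.1.2, w.1.2 + w.2)) ((μ.prod volume).prod volume)) := by
  have h1 : MeasurePreserving MeasurableEquiv.prodAssoc
      ((μ.prod (volume : Measure ℝ)).prod (volume : Measure ℝ)) (μ.prod (volume.prod volume)) :=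
    ⟨MeasurableEquiv.prodAssoc.measurable, Measure.prodAssoc_prod⟩
  have h2 : MeasurePreserving (Prod.map id fun y : ℝ × ℝ => (y.1, y.1 + y.2))
      (μ.prod (volume.prod volume)) (μ.prod (volume.prod volume)) :=
    (MeasurePreserving.id μ).prod (measurePreserving_prod_add volume volume)
  have h3 := h2.comp h1
  refine ⟨?_, fun h => h3.integrable_comp_of_integrable h⟩
  rw [Measure.volume_eq_prod ℝ ℝ]
  conv_lhs => rw [← h3.map_eq]
  rw [integral_map h3.measurable.aemeasurable hF.aestronglyMeasurable]
  rfl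

section Entropy
variable [IsFiniteMeasure (volume.restrict Ω)]

theorem IsIncrementSolution.integrable_b (hp : 1 < p) (hpq : p.HolderConjugate q)
    (h : IsIncrementSolution p Ω T ψ u G) : Integrable (fun z => b p (u z)) volume := by
  have hfin : IsFiniteMeasure ((volume : Measure (Space n × ℝ)).restrict (cylinder Ω T)) := by
    rw [volume_restrict_cylinder]; infer_instance
  have h1 : IntegrableOn (fun z => b p (u z)) (cylinder Ω T) :=
    ((h.memLp_b hp hpq).restrict _).integrable (by simpa using hpq.symm.lt.le)
  refine (integrableOn_iff_integrable_of_support_subset fun z hz => ?_).1 h1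
  by_contra hz'
  exact hz (by simp only [h.eq_zero z hz', b_zero])

/-- In the variable `σ = s - t`, the doubled inequality says that the `k`-average of `σ ↦ ∫
(b(u₁(x,t)) - b(u₂(x,t+σ)))₊ η'(t)` is nonnegative. This function is continuous at `0` by `L¹`
continuity of translations, so its value there is nonnegative too. -/
theorem integral_pos_part_mul_deriv_nonneg (hp : 1 < p) (hpq : p.HolderConjugate q)
    (hΩ : IsOpen Ω) (hΩb : Bornology.IsBounded Ω)
    (hψc : ∀ t ∈ Ioo 0 T, ContinuousOn (fun x => ψ (x, t)) (closure Ω))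
    (hψm : ∀ x ∈ frontier Ω, ∀ t s : ℝ, 0 < t → t < s → s < T → ψ (x, t) ≤ ψ (x, s))
    (h₁ : IsIncrementSolution p Ω T ψ u₁ G₁) (h₂ : IsIncrementSolution p Ω T ψ u₂ G₂)
    {η : ℝ → ℝ} (hη : IsTestFunction (Ioo 0 T) η) (hη0 : ∀ t, 0 ≤ η t) :
    0 ≤ ∫ z : Space n × ℝ, max (b p (u₁ z) - b p (u₂ z)) 0 * deriv η z.2
      ∂((volume.restrict Ω).prod volume) := by
  have hηc : Continuous (deriv η) := hη.1.continuous_deriv (by simp)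
  obtain ⟨C, hC⟩ := hη.2.1.deriv.exists_bound_of_continuous hηc
  obtain ⟨a, ha, hηa⟩ := hη.exists_margin
  have hle : (volume.restrict Ω).prod volume ≤ (volume : Measure (Space n × ℝ)) := by
    rw [Measure.volume_eq_prod, ← Measure.restrict_univ (μ := (volume : Measure ℝ)),
      Measure.prod_restrict, Measure.restrict_univ]
    exact Measure.restrict_le_self
  have ib₁ := h₁.integrable_b hp hpq
  have ib₂ := h₂.integrable_b hp hpq
  have hbm := (continuous_b hp).measurable
  have hHaar : (volume : Measure (Space n × ℝ)).IsAddHaarMeasure := by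
    rw [Measure.volume_eq_prod]; infer_instance
  set F : ℝ → Space n × ℝ → ℝ := fun σ z =>
    max (b p (u₁ z) - b p (u₂ ((0, σ) + z))) 0 * deriv η z.2 with hF
  have hFi : ∀ σ, Integrable (F σ) ((volume.restrict Ω).prod volume) := fun σ =>
    (((ib₁.sub (ib₂.comp_add_left (0, σ))).mono_measure hle).pos_part).mul_bdd (c := C)
      (hηc.measurable.comp measurable_snd).aestronglyMeasurable (ae_of_all _ fun z => hC _)
  have hlim : Tendsto (fun σ => ∫ z, F σ z ∂((volume.restrict Ω).prod volume)) (𝓝 0)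
      (𝓝 (∫ z, F 0 z ∂((volume.restrict Ω).prod volume))) := by
    refine tendsto_integral_of_L1' _ (hFi 0).1 (Eventually.of_forall hFi) ?_
    have hy : Tendsto (fun σ : ℝ => ((0, σ) : Space n × ℝ)) (𝓝 0) (𝓝 0) := by
      have : Continuous fun τ : ℝ => ((0, τ) : Space n × ℝ) := by fun_prop
      simpa [Prod.mk_zero_zero] using this.tendsto 0
    have l := (tendsto_eLpNorm_translate le_rfl ENNReal.one_ne_top
      (memLp_one_iff_integrable.2 ib₂)).comp hy
    have l2 := ENNReal.Tendsto.const_mul (a := ENNReal.ofReal C) l (Or.inr ENNReal.ofReal_ne_top)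
    rw [mul_zero] at l2
    refine tendsto_of_tendsto_of_tendsto_of_le_of_le tendsto_const_nhds l2 (fun _ => zero_le)
      fun σ => ?_
    refine (eLpNorm_le_mul_eLpNorm_of_ae_le_mul (ae_of_all _ fun z => ?_) 1).trans
      (mul_le_mul_right (eLpNorm_mono_measure _ hle) _)
    simp only [hF, Pi.sub_apply]
    rw [← sub_mul, norm_mul, mul_comm]
    refine mul_le_mul (hC _) ?_ (norm_nonneg _) ((norm_nonneg _).trans (hC 0))
    rw [Prod.mk_zero_zero, zero_add]
    refine (abs_max_sub_max_le_abs _ _ _).trans_eq ?_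
    rw [Real.norm_eq_abs, ← abs_neg]
    congr 1
    ring
  -- A negative value `L` at `σ = 0` would force values at most `L/2` for all small `σ`, hence a
  -- negative average.
  by_contra hneg
  rw [not_le] at hneg
  have hF0 : ∫ z, F 0 z ∂((volume.restrict Ω).prod volume) < 0 := by
    simpa [hF, Prod.mk_zero_zero] using hneg
  set L := ∫ z, F 0 z ∂((volume.restrict Ω).prod volume)
  obtain ⟨r, hr, hrL⟩ := Metric.eventually_nhds_iff.1
    (hlim.eventually_le_const (show L < L / 2 by linarith))
  -- Support below `a` makes the product an admissible doubled cutoff; support below `r` keeps `σ`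
  -- in the range where the integral is at most `L/2`.
  obtain ⟨k, hk, hkc, hk0, hk1, hks⟩ := exists_bump_lt (lt_min ha hr)
  have hθ := isDoubledCutoff_mul ha hη.1 hη.2.1 hη0 hηa hk hkc hk0
    fun s hs => ⟨(hks s hs).1, (hks s hs).2.trans_le (min_le_left _ _)⟩
  have key := integral_max_sub_nonneg hp hpq hΩ hΩb hψc hψm h₁ h₂ hθ
  simp_rw [fderiv_mul_comp_sub hη.1 hk] at key
  have hFm : Measurable fun z : Space n × ℝ × ℝ =>
      max (b p (u₁ (z.1, z.2.1)) - b p (u₂ (z.1, z.2.2))) 0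
        * (deriv η z.2.1 * k (z.2.2 - z.2.1)) :=
    (((hbm.comp (h₁.measurable.comp (by fun_prop))).sub
      (hbm.comp (h₂.measurable.comp (by fun_prop)))).max measurable_const).mul
      ((hηc.measurable.comp (by fun_prop)).mul (hk.continuous.measurable.comp (by fun_prop)))
  have hint : Integrable (fun z : Space n × ℝ × ℝ =>
      max (b p (u₁ (z.1, z.2.1)) - b p (u₂ (z.1, z.2.2))) 0
        * (deriv η z.2.1 * k (z.2.2 - z.2.1))) ((volume.restrict Ω).prod volume) := by
    obtain ⟨D, hD⟩ := hkc.exists_bound_of_continuous hk.continuous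
    refine integrable_mul_of_support_subset (T := T) (C := C * D)
      (k := fun y : ℝ × ℝ => deriv η y.1 * k (y.2 - y.1))
      (((h₁.integrable_b_fst hp hpq).sub (h₂.integrable_b_snd hp hpq)).pos_part)
      ((hηc.measurable.comp (by fun_prop)).mul (hk.continuous.measurable.comp (by fun_prop)))
      (fun y => ?_) fun y hy => ?_
    · rw [norm_mul]
      exact mul_le_mul (hC _) (hD _) (norm_nonneg _) ((norm_nonneg _).trans (hC 0))
    · rw [← fderiv_mul_comp_sub hη.1 hk] at hy
      exact hθ.mem_box_of_fderiv hy
  obtain ⟨e1, e2⟩ := integral_shear_eq (μ := volume.restrict Ω) hFm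
  have hint2 := e2 hint
  rw [e1, integral_prod_symm _ hint2] at key
  have hkL : ∀ σ, ∫ z : Space n × ℝ, max (b p (u₁ (z.1, z.2)) - b p (u₂ (z.1, z.2 + σ))) 0
        * (deriv η z.2 * k (z.2 + σ - z.2)) ∂((volume.restrict Ω).prod volume)
      = (∫ z, F σ z ∂((volume.restrict Ω).prod volume)) * k σ := fun σ => by
    rw [← integral_mul_const]
    refine integral_congr_ae (ae_of_all _ fun z => ?_)
    obtain ⟨x, t⟩ := z
    simp only [hF, Prod.mk_add_mk, zero_add, add_comm t σ, add_sub_cancel_right]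
    ring
  have hint3 := hint2.integral_prod_right
  simp only [hkL] at key hint3
  have hup : ∫ σ, (∫ z, F σ z ∂((volume.restrict Ω).prod volume)) * k σ ≤ ∫ σ, L / 2 * k σ := by
    refine integral_mono hint3 ((hk.continuous.integrable_of_hasCompactSupport hkc).const_mul _)
      fun σ => ?_
    beta_reduce
    by_cases hσ : k σ = 0
    · simp [hσ]
    refine mul_le_mul_of_nonneg_right (hrL ?_) (hk0 _)
    rw [Real.dist_eq, sub_zero, abs_of_pos (hks σ hσ).1]
    exact (hks σ hσ).2.trans_le (min_le_right _ _)
  rw [integral_const_mul, hk1] at hup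
  linarith

end Entropy
end Trudinger

/-! ### Use of the initial condition and conclusion -/

namespace Trudinger
variable {n : ℕ} {p q T : ℝ} {Ω : Set (Space n)} {ψ u u₁ u₂ : Space n × ℝ → ℝ}
  {G G₁ G₂ : Space n × ℝ → Space n}

theorem exists_bump_ball {r : ℝ} (hr : 0 < r) :
    ∃ k : ℝ → ℝ, ContDiff ℝ ∞ k ∧ HasCompactSupport k ∧ (∀ s, 0 ≤ k s) ∧ ∫ s, k s = 1 ∧
      (∀ s, r ≤ |s| → k s = 0) ∧ ∀ s, |s| < r → k s ≠ 0 := by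
  let β : ContDiffBump (0 : ℝ) := ⟨r / 2, r, by positivity, by linarith⟩
  have hs : ∀ s, β.normed volume s ≠ 0 ↔ |s| < r := fun s => by
    rw [← Function.mem_support, β.support_normed_eq, mem_ball_zero_iff, Real.norm_eq_abs]
  refine ⟨β.normed volume, β.contDiff_normed, β.hasCompactSupport_normed,
    fun s => β.nonneg_normed s, β.integral_normed, fun s h => ?_, fun s h => (hs s).2 h⟩
  by_contra h'
  exact absurd ((hs s).1 h') (not_lt.2 h)

/-- The primitive of two unit masses of opposite sign is compactly supported because they cancel,
and nonnegative because the support of the positive one lies entirely to the left; `har` expresses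
this ordering. -/
theorem isTestFunction_primitive_sub {κ ζ : ℝ → ℝ} {a r : ℝ} (ha : 0 < a) (hr0 : 0 < r)
    (har : 3 * a / 4 ≤ T / 2 - r) (hκ : ContDiff ℝ ∞ κ) (hκc : HasCompactSupport κ)
    (hκ0 : ∀ s, 0 ≤ κ s) (hκ1 : ∫ s, κ s = 1) (hκr : ∀ s, a / 4 ≤ |s| → κ s = 0)
    (hζ : ContDiff ℝ ∞ ζ) (hζc : HasCompactSupport ζ)
    (hζ0 : ∀ s, 0 ≤ ζ s) (hζ1 : ∫ s, ζ s = 1) (hζr : ∀ s, r ≤ |s| → ζ s = 0) :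
    ∃ η : ℝ → ℝ, IsTestFunction (Ioo 0 T) η ∧ (∀ t, 0 ≤ η t) ∧
      ∀ t, deriv η t = κ (t - a / 2) - ζ (t - T / 2) := by
  have hac : a / 4 < a := by linarith
  have hrc : r < r + 1 := by linarith
  have hκi : Integrable κ := hκ.continuous.integrable_of_hasCompactSupport hκc
  have hζi : Integrable ζ := hζ.continuous.integrable_of_hasCompactSupport hζc
  set K : ℝ → ℝ := fun s => ∫ x in (-a)..s, κ x with hK
  set Z : ℝ → ℝ := fun s => ∫ x in (-(r + 1))..s, ζ x with hZ
  have hKd : ∀ s, HasDerivAt K (κ s) s := fun s =>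
    (hκ.continuous.integral_hasStrictDerivAt _ s).hasDerivAt
  have hZd : ∀ s, HasDerivAt Z (ζ s) s := fun s =>
    (hζ.continuous.integral_hasStrictDerivAt _ s).hasDerivAt
  have hsupp : Function.support (fun t => K (t - a / 2) - Z (t - T / 2)) ⊆ Icc (a / 4) (T / 2 + r) := by
    intro t ht
    by_contra hnot
    refine ht ?_
    rw [mem_Icc, not_and_or, not_le, not_le] at hnot
    rcases hnot with h | h
    · simp only [hK, hZ]
      rw [integral_eq_zero_of_le hκr hac (by linarith), integral_eq_zero_of_le hζr hrc (by linarith),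
        sub_zero]
    · simp only [hK, hZ]
      rw [integral_eq_one_of_ge hκr hac hκ1 (by linarith),
        integral_eq_one_of_ge hζr hrc hζ1 (by linarith), sub_self]
  have htsupp : tsupport (fun t => K (t - a / 2) - Z (t - T / 2)) ⊆ Icc (a / 4) (T / 2 + r) :=
    closure_minimal hsupp isClosed_Icc
  refine ⟨fun t => K (t - a / 2) - Z (t - T / 2), ⟨?_, ?_, htsupp.trans fun t ht => ?_⟩,
    fun t => ?_, fun t => ?_⟩
  · exact ((contDiff_primitive hκ).comp (contDiff_id.sub contDiff_const)).sub
      ((contDiff_primitive hζ).comp (contDiff_id.sub contDiff_const))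
  · exact isCompact_Icc.of_isClosed_subset (isClosed_tsupport _) htsupp
  · exact ⟨by linarith [ht.1], by linarith [ht.2]⟩
  · rcases le_total t (T / 2 - r) with h | h
    · simp only [hK, hZ]
      rw [integral_eq_zero_of_le hζr hrc (by linarith), sub_zero]
      exact (primitive_mem_Icc hκ0 hκi hκr hac hκ1 _).1
    · simp only [hK, hZ]
      rw [integral_eq_one_of_ge hκr hac hκ1 (by linarith), sub_nonneg]
      exact (primitive_mem_Icc hζ0 hζi hζr hrc hζ1 _).2
  · exact (((hKd (t - a / 2)).comp_sub_const t (a / 2)).sub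
      ((hZd (t - T / 2)).comp_sub_const t (T / 2))).deriv

/-- The hypothesis `h` says that `f` is weakly nonincreasing, so its later averages are bounded by
averages near `0`, which `hinit` makes arbitrarily small. Testing with a difference of bump
primitives avoids choosing a monotone representative. -/
theorem ae_eq_zero_of_integral_mul_deriv_nonneg {f : ℝ → ℝ} (hf0 : ∀ t, 0 ≤ f t)
    (hfi : Integrable f)
    (h : ∀ η : ℝ → ℝ, IsTestFunction (Ioo 0 T) η → (∀ t, 0 ≤ η t) → 0 ≤ ∫ t, f t * deriv η t)
    (hinit : ∀ ε > 0, ∀ᶠ t in 𝓝[>] 0 ⊓ ae volume, f t ≤ ε) :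
    ∀ᵐ t ∂(volume.restrict (Ioo 0 T)), f t = 0 := by
  have hball : ∀ r, 0 < r → r < T / 2 → ∀ᵐ t ∂(volume.restrict (Metric.ball (T / 2) r)), f t = 0 := by
    intro r hr hrT
    obtain ⟨ζ, hζ, hζc, hζ0, hζ1, hζr, hζp⟩ := exists_bump_ball hr
    have hint : ∀ {k : ℝ → ℝ} (c : ℝ), ContDiff ℝ ∞ k → HasCompactSupport k →
        Integrable fun t => f t * k (t - c) := fun {k} c hk hkc => by
      obtain ⟨C, hC⟩ := hkc.exists_bound_of_continuous hk.continuous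
      exact hfi.mul_bdd (c := C) (hk.continuous.comp (continuous_id.sub
        continuous_const)).aestronglyMeasurable (ae_of_all _ fun t => hC _)
    have hle : ∫ t, f t * ζ (t - T / 2) ≤ 0 := by
      refine le_of_forall_pos_le_add fun ε hε => ?_
      obtain ⟨A, hA, B, hB, hAB⟩ := mem_inf_iff_superset.1 (hinit ε hε)
      obtain ⟨a₀, ha₀, hsub⟩ := mem_nhdsGT_iff_exists_Ioo_subset.1 hA
      have ha₀' : 0 < a₀ := ha₀
      -- The early bump lives in `(a/4, 3a/4)`: below `a₀`, where `f ≤ ε` almost everywhere, and to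
      -- the left of the late bump, which occupies the ball of radius `r` about `T/2`.
      set a := min a₀ (T / 2 - r) with ha
      have ha0 : 0 < a := lt_min ha₀ (by linarith)
      have ha1 : a ≤ a₀ := min_le_left _ _
      have ha2 : a ≤ T / 2 - r := min_le_right _ _
      obtain ⟨κ, hκ, hκc, hκ0, hκ1, hκr, -⟩ := exists_bump_ball (show 0 < a / 4 by linarith)
      obtain ⟨η, hη, hη0, hηd⟩ := isTestFunction_primitive_sub (T := T) ha0 hr (by linarith) hκ hκc
        hκ0 hκ1 hκr hζ hζc hζ0 hζ1 hζr
      have h1 := h η hη hη0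
      simp_rw [hηd, mul_sub] at h1
      rw [integral_sub (hint _ hκ hκc) (hint _ hζ hζc), sub_nonneg] at h1
      refine h1.trans ?_
      have hκs : Integrable fun t => κ (t - a / 2) :=
        (hκ.continuous.integrable_of_hasCompactSupport hκc).comp_sub_right _
      calc ∫ t, f t * κ (t - a / 2) ≤ ∫ t, ε * κ (t - a / 2) := by
            refine integral_mono_ae (hint _ hκ hκc) (hκs.const_mul ε) ?_
            filter_upwards [hB] with t ht
            by_cases hκt : κ (t - a / 2) = 0
            · simp [hκt]
            have h2 : |t - a / 2| < a / 4 := by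
              by_contra h3
              exact hκt (hκr _ (not_lt.1 h3))
            rw [abs_lt] at h2
            exact mul_le_mul_of_nonneg_right
              (hAB ⟨hsub ⟨by linarith [h2.1], by linarith [h2.2]⟩, ht⟩) (hκ0 _)
        _ = 0 + ε := by
            rw [integral_const_mul, integral_sub_right_eq_self (fun t => κ t), hκ1, mul_one, zero_add]
    have hnn : ∀ t, 0 ≤ f t * ζ (t - T / 2) := fun t => mul_nonneg (hf0 t) (hζ0 _)
    -- The late bump is strictly positive on its ball, so a vanishing weighted integral of the
    -- nonnegative `f` forces `f = 0` almost everywhere there.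
    have hz := (integral_eq_zero_iff_of_nonneg hnn (hint _ hζ hζc)).1
      (le_antisymm hle (integral_nonneg hnn))
    rw [ae_restrict_iff' Metric.isOpen_ball.measurableSet]
    filter_upwards [hz] with t ht htb
    refine (mul_eq_zero.1 ht).resolve_right (hζp _ ?_)
    rwa [← Real.dist_eq]
  have hU : Ioo 0 T ⊆ ⋃ k : ℕ, Metric.ball (T / 2) (T / 2 - 1 / (k + 1)) := fun t ht => by
    have hd : 0 < T / 2 - |t - T / 2| := by
      rw [sub_pos, abs_lt]; exact ⟨by linarith [ht.1], by linarith [ht.2]⟩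
    obtain ⟨k, hk⟩ := exists_nat_one_div_lt hd
    rw [mem_iUnion]
    exact ⟨k, by rw [Metric.mem_ball, Real.dist_eq]; linarith⟩
  have hk : ∀ᵐ t ∂(volume.restrict (⋃ k : ℕ, Metric.ball (T / 2) (T / 2 - 1 / ((k : ℝ) + 1)))),
      f t = 0 := by
    rw [ae_restrict_iUnion_iff]
    intro k
    rcases le_or_gt (T / 2 - 1 / (k + 1 : ℝ)) 0 with hk | hk
    · rw [Metric.ball_eq_empty.2 hk]; simp
    · exact hball _ hk (by linarith [show (0 : ℝ) < 1 / (k + 1) by positivity])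
  exact ae_mono (Measure.restrict_mono hU le_rfl) hk

theorem eventually_slice {P : Space n × ℝ → Prop} (hT : 0 < T)
    (hP : ∀ᵐ z ∂((volume : Measure (Space n × ℝ)).restrict (cylinder Ω T)), P z) :
    ∀ᶠ t in 𝓝[>] (0 : ℝ) ⊓ ae volume, ∀ᵐ x ∂(volume.restrict Ω), P (x, t) := by
  rw [volume_restrict_cylinder] at hP
  have h1 := ae_ae_of_ae_prod_swap hP
  rw [ae_restrict_iff' measurableSet_Ioo] at h1
  have h2 : ∀ᶠ t in 𝓝[>] (0 : ℝ) ⊓ ae volume, t ∈ Ioo 0 T :=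
    Filter.Eventually.filter_mono inf_le_left (Ioo_mem_nhdsGT hT)
  filter_upwards [h2, Filter.Eventually.filter_mono inf_le_right h1] with t ht1 ht2
  exact ht2 ht1

/-- The spatial integral of `(b(u₁) - b(u₂))₊` is weakly nonincreasing in time. Near time `0` it is
dominated by the distances of `b(u₁)` and `b(u₂)` from `b(ψ)`, both essentially tending to zero, so
it vanishes; `b` being strictly increasing, the ordering passes to `u₁` and `u₂`. -/
theorem ae_le_of_isWeakSolution (hp : 1 < p) (hΩ : IsOpen Ω) (hΩb : Bornology.IsBounded Ω)
    (hT : 0 < T) (hψc : ∀ t ∈ Ioo 0 T, ContinuousOn (fun x => ψ (x, t)) (closure Ω))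
    (hψ : MemParabolic p Ω T ψ)
    (hψm : ∀ x ∈ frontier Ω, ∀ t s : ℝ, 0 < t → t < s → s < T → ψ (x, t) ≤ ψ (x, s))
    (hu₁ : IsWeakSolution p Ω T ψ u₁) (hu₂ : IsWeakSolution p Ω T ψ u₂) :
    ∀ᵐ z ∂(volume.restrict (cylinder Ω T)), u₁ z ≤ u₂ z := by
  have hfin : IsFiniteMeasure (volume.restrict Ω) := ⟨by
    rw [Measure.restrict_apply_univ]; exact hΩb.measure_lt_top⟩
  have hpq : p.HolderConjugate p.conjExponent := Real.HolderConjugate.conjExponent hp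
  obtain ⟨v₁, G₁, h₁, e₁⟩ := hu₁.exists_incrementSolution hp hΩ hΩb hψ
  obtain ⟨v₂, G₂, h₂, e₂⟩ := hu₂.exists_incrementSolution hp hΩ hΩb hψ
  set f : ℝ → ℝ := fun t => ∫ x in Ω, max (b p (v₁ (x, t)) - b p (v₂ (x, t))) 0 with hf
  have hle : (volume.restrict Ω).prod volume ≤ (volume : Measure (Space n × ℝ)) := by
    rw [Measure.volume_eq_prod, ← Measure.restrict_univ (μ := (volume : Measure ℝ)),
      Measure.prod_restrict, Measure.restrict_univ]
    exact Measure.restrict_le_self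
  have hD : Integrable (fun z => max (b p (v₁ z) - b p (v₂ z)) 0)
      ((volume.restrict Ω).prod volume) :=
    (((h₁.integrable_b hp hpq).sub (h₂.integrable_b hp hpq)).mono_measure hle).pos_part
  have hae := ae_eq_zero_of_integral_mul_deriv_nonneg (T := T) (f := f)
    (fun t => integral_nonneg fun x => le_max_right _ _) hD.integral_prod_right
    (fun η hη hη0 => by
      have key := integral_pos_part_mul_deriv_nonneg hp hpq hΩ hΩb hψc hψm h₁ h₂ hη hη0
      have hηc : Continuous (deriv η) := hη.1.continuous_deriv (by simp)
      obtain ⟨C, hC⟩ := hη.2.1.deriv.exists_bound_of_continuous hηc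
      have hi : Integrable (fun z : Space n × ℝ => max (b p (v₁ z) - b p (v₂ z)) 0 * deriv η z.2)
          ((volume.restrict Ω).prod volume) := hD.mul_bdd (c := C)
        (hηc.measurable.comp measurable_snd).aestronglyMeasurable (ae_of_all _ fun z => hC _)
      rw [integral_prod_symm _ hi] at key
      simpa only [integral_mul_const] using key)
    (fun ε hε => by
      have hsum := (hu₁.initial.add hu₂.initial)
      rw [add_zero] at hsum
      filter_upwards [eventually_slice hT e₁, eventually_slice hT e₂,
        Filter.Eventually.filter_mono inf_le_left (Ioo_mem_nhdsGT hT),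
        hsum.eventually_le_const (ENNReal.ofReal_pos.2 hε)] with t s₁ s₂ htT ht
      refine (ENNReal.ofReal_le_ofReal_iff hε.le).1 (le_trans ?_ ht)
      refine (ofReal_integral_le_lintegral _).trans ?_
      have hm : AEMeasurable (fun x => ENNReal.ofReal |b p (u₁ (x, t)) - b p (ψ (x, t))|)
          (volume.restrict Ω) := by
        -- Splitting the upper integral of a sum requires measurability of one summand; continuity
        -- of the boundary values on the slice supplies it for `ψ`.
        have hψt := ((hψc t htT).mono subset_closure).aemeasurable hΩ.measurableSet (μ := volume)
        have hvt : AEMeasurable (fun x => u₁ (x, t)) (volume.restrict Ω) :=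
          ⟨fun x => v₁ (x, t), h₁.measurable.comp (by fun_prop), s₁⟩
        have hbm := (continuous_b hp).measurable
        exact ((hbm.comp_aemeasurable hvt).sub (hbm.comp_aemeasurable hψt)).abs.ennreal_ofReal
      rw [← lintegral_add_left' hm]
      refine lintegral_mono_ae ?_
      filter_upwards [s₁, s₂] with x hx₁ hx₂
      rw [← hx₁, ← hx₂, ← ENNReal.ofReal_add (abs_nonneg _) (abs_nonneg _)]
      refine ENNReal.ofReal_le_ofReal (max_le ?_ (by positivity))
      linarith [le_abs_self (b p (u₁ (x, t)) - b p (ψ (x, t))),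
        neg_abs_le (b p (u₂ (x, t)) - b p (ψ (x, t)))])
  have hz : ∫ z, max (b p (v₁ z) - b p (v₂ z)) 0 ∂(volume.restrict (cylinder Ω T)) = 0 := by
    rw [volume_restrict_cylinder, integral_prod_symm]
    · exact integral_eq_zero_of_ae hae
    · refine hD.mono_measure ?_
      rw [Measure.prod_restrict, ← Measure.restrict_univ (μ := (volume : Measure ℝ)),
        Measure.prod_restrict, Measure.restrict_univ]
      exact Measure.restrict_mono (prod_mono le_rfl (subset_univ _)) le_rfl
  have hz' := (integral_eq_zero_iff_of_nonneg (fun z => le_max_right _ _)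
    ((((h₁.integrable_b hp hpq).sub (h₂.integrable_b hp hpq)).restrict).pos_part)).1 hz
  filter_upwards [hz', e₁, e₂] with z hzz hz₁ hz₂
  rw [hz₁, hz₂]
  have h3 : b p (v₁ z) - b p (v₂ z) ≤ 0 := (le_max_left _ _).trans_eq hzz
  exact (strictMono_b hp).le_iff_le.1 (sub_nonpos.1 h3)

end Trudinger

theorem proposition3p5 {n : ℕ} {p : ℝ} (hp : 1 < p)
    {Ω : Set (Trudinger.Space n)} (hΩ : Trudinger.IsBoundedLipschitzDomain Ω)
    {T : ℝ} (hT : 0 < T)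
    {ψ : Trudinger.Space n × ℝ → ℝ}
    (hψ_cont : ContinuousOn ψ (closure (Trudinger.cylinder Ω T)))
    (hψ_mem : Trudinger.MemParabolic p Ω T ψ)
    (hψ_mono : ∀ x ∈ frontier Ω, ∀ t s : ℝ, 0 < t → t < s → s < T → ψ (x, t) ≤ ψ (x, s))
    {u₁ u₂ : Trudinger.Space n × ℝ → ℝ}
    (hu₁ : Trudinger.IsWeakSolution p Ω T ψ u₁)
    (hu₂ : Trudinger.IsWeakSolution p Ω T ψ u₂) :
    ∀ᵐ z ∂(volume.restrict (Trudinger.cylinder Ω T)), u₁ z = u₂ z := by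
  have hψc : ∀ t ∈ Ioo 0 T, ContinuousOn (fun x => ψ (x, t)) (closure Ω) := fun t ht =>
    hψ_cont.comp (by fun_prop) fun x hx => by
      rw [Trudinger.cylinder, closure_prod_eq]
      exact ⟨hx, subset_closure ht⟩
  filter_upwards [Trudinger.ae_le_of_isWeakSolution hp hΩ.isOpen hΩ.isBounded hT hψc hψ_mem hψ_mono
    hu₁ hu₂, Trudinger.ae_le_of_isWeakSolution hp hΩ.isOpen hΩ.isBounded hT hψc hψ_mem hψ_mono
    hu₂ hu₁] with z h₁ h₂
  exact le_antisymm h₁ h₂
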